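/- An instance of the $(L,U,\text{soft-}\emptyset,p)$-Supplier problem consists of a finite set $\mathcal C$ of clients and a finite set $\mathcal F$ of facilities (which may overlap), a symmetric function $\mathrm d:(\mathcal C\cup\mathcal F)\times(\mathcal C\cup\mathcal F)\to\mathbb R_{\ge 0}$ satisfying the triangle inequality, and integers $L,U,p\ge 0$ with $L\le U$. A feasible solution consists of a set $C\subseteq\mathcal C$ with $|C|\ge p$, a finite family $F=(u_1,\dots,u_m)$ of facilities $u_j\in\mathcal F$, where $m\ge 0$ is arbitrary and repetitions are allowed (several centers may be opened at the same facility), and an assignment $\phi:C\to\{1,\dots,m\}$ with $L\le|\phi^{-1}(j)|\le U$ for every $j$. Its radius is $\max_{v\in C}\mathrm d(v,u_{\phi(v)})$ (and $0$ if $C=\emptyset$); the goal is to minimize the radius. Theorem. There is a polynomial-time $5$-approximation algorithm for the $(L,U,\text{soft-}\emptyset,p)$-Supplier problem. That is, there are a single deterministic program $A$ and a polynomial $P$ such that, on every instance with $n=|\mathcal C\cup\mathcal F|$, the program $A$ halts after at most $P(n)$ steps; if the instance has a feasible solution, then $A$ outputs a feasible solution whose radius is at most $5$ times the radius of every feasible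 solution, and otherwise $A$ reports that there is none. Here a program is one for a random access machine with unit cost whose operations are addition, truncated subtraction and comparison of natural numbers, reading and writing of variables and (indirectly addressed) array entries, comparison of two entries of the real distance table $\mathrm d$, branching and looping. -/

import Mathlib

open scoped NNReal

namespace CapSupplier

/-! ### The supplier problem with uniform, soft, two-sided capacities and outliers -/

/-- An instance of the (L, U, soft-∅, p)-supplier problem on the points `0, …, n - 1`.
The set of clients and the set of facilities may overlap; together they make up all points.
Distances are arbitrary nonnegative reals. -/
structure Instance (n : ℕ) where
  /-- the clients -/
  clients : Finset (Fin n)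
  /-- the facilities -/
  facilities : Finset (Fin n)
  cover : clients ∪ facilities = Finset.univ
  /-- the distance function -/
  dist : Fin n → Fin n → ℝ≥0
  dist_symm : ∀ x y, dist x y = dist y x
  dist_triangle : ∀ x y z, dist x z ≤ dist x y + dist y z
  /-- the uniform lower capacity bound -/
  L : ℕ
  /-- the uniform upper capacity bound -/
  U : ℕ
  L_le_U : L ≤ U
  /-- the number of clients that have to be served -/
  p : ℕ

/-- A candidate solution: a set of served clients, an indexed finite family of open centers
(the same point may occur several times in it: soft capacities; its length is not prescribed),
and an assignment of the served clients to the open centers. -/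
structure Solution (n : ℕ) where
  /-- the served clients -/
  served : Finset (Fin n)
  /-- the number of open centers -/
  numOpen : ℕ
  /-- the facility at which a center is opened -/
  loc : Fin numOpen → Fin n
  /-- the center that serves a client -/
  assign : {v // v ∈ served} → Fin numOpen

/-- The number of clients that are served by the open center `j`. -/
def Solution.load {n : ℕ} (S : Solution n) (j : Fin S.numOpen) : ℕ :=
  (Finset.univ.filter fun v => S.assign v = j).card

/-- The maximum cluster radius (`0` if no client is served). -/
noncomputable def Solution.radius {n : ℕ} (S : Solution n) (I : Instance n) : ℝ≥0 :=
  Finset.univ.sup fun v : {v // v ∈ S.served} => I.dist v.1 (S.loc (S.assign v))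

/-- `S` satisfies all the constraints of `I`. -/
structure Solution.Feasible {n : ℕ} (S : Solution n) (I : Instance n) : Prop where
  served_clients : S.served ⊆ I.clients
  served_card : I.p ≤ S.served.card
  loc_facilities : ∀ j, S.loc j ∈ I.facilities
  lower : ∀ j, I.L ≤ S.load j
  upper : ∀ j, S.load j ≤ I.U

/-- `S` is feasible and its radius is at most `ρ` times that of every feasible solution, hence
at most `ρ` times the optimal radius. -/
def Solution.IsApprox {n : ℕ} (S : Solution n) (I : Instance n) (ρ : ℝ≥0) : Prop :=
  S.Feasible I ∧ ∀ T : Solution n, T.Feasible I → S.radius I ≤ ρ * T.radius I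

/-! ### The machine model

A deterministic random access machine, programmed in a small imperative language with integer
variables and integer arrays. The only arithmetic is addition and truncated subtraction, so within
`t` steps the bit length of a number grows by at most `O(t)`. The real input distances cannot be
manipulated; the machine can only compare two of them. -/

/-- Memory: natural number variables and arrays, both indexed by natural numbers.
A program mentions only finitely many of each. -/
structure State where
  /-- the contents of the variables -/
  var : ℕ → ℕ
  /-- the contents of the arrays -/
  arr : ℕ → ℕ → ℕ

/-- Expressions. -/
inductive NExpr where
  /-- a constant -/
  | lit (c : ℕ)
  /-- the value of a variable -/
  | var (x : ℕ)
  /-- the entry of array `a` at index `i` -/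
  | get (a : ℕ) (i : NExpr)
  /-- addition -/
  | add (e f : NExpr)
  /-- truncated subtraction -/
  | sub (e f : NExpr)
  /-- `1` if `e ≤ f`, otherwise `0` -/
  | le (e f : NExpr)
  /-- `1` if the distance of `e` and `f` is at most the distance of `g` and `h`,
  otherwise `0` -/
  | distLE (e f g h : NExpr)

/-- The number of operations in an expression. -/
def NExpr.cost : NExpr → ℕ
  | .lit _ => 1
  | .var _ => 1
  | .get _ i => i.cost + 1
  | .add e f => e.cost + f.cost + 1
  | .sub e f => e.cost + f.cost + 1
  | .le e f => e.cost + f.cost + 1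
  | .distLE e f g h => e.cost + f.cost + g.cost + h.cost + 1

/-- The value of an expression in a state, for the (read-only) distance table `d`. -/
noncomputable def NExpr.eval (d : ℕ → ℕ → ℝ≥0) (s : State) : NExpr → ℕ
  | .lit c => c
  | .var x => s.var x
  | .get a i => s.arr a (i.eval d s)
  | .add e f => e.eval d s + f.eval d s
  | .sub e f => e.eval d s - f.eval d s
  | .le e f => if e.eval d s ≤ f.eval d s then 1 else 0
  | .distLE e f g h =>
      if d (e.eval d s) (f.eval d s) ≤ d (g.eval d s) (h.eval d s) then 1 else 0

/-- Programs. -/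
inductive Program where
  /-- do nothing -/
  | skip
  /-- assign the value of `e` to the variable `x` -/
  | assign (x : ℕ) (e : NExpr)
  /-- write the value of `e` into array `a` at index `i` -/
  | store (a : ℕ) (i e : NExpr)
  /-- sequential composition -/
  | seq (A B : Program)
  /-- run `A` if `e` is nonzero, otherwise run `B` -/
  | ite (e : NExpr) (A B : Program)
  /-- run `A` repeatedly as long as `e` is nonzero -/
  | while (e : NExpr) (A : Program)

/-- Overwrite a variable. -/
def State.setVar (s : State) (x v : ℕ) : State :=
  { s with var := Function.update s.var x v }

/-- Overwrite an array entry. -/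
def State.setArr (s : State) (a i v : ℕ) : State :=
  { s with arr := Function.update s.arr a (Function.update (s.arr a) i v) }

/-- `Exec d A s s' t`: with distance table `d`, the program `A` started in state `s` halts in
state `s'` after exactly `t` steps. -/
inductive Exec (d : ℕ → ℕ → ℝ≥0) : Program → State → State → ℕ → Prop where
  | skip (s : State) : Exec d .skip s s 1
  | assign (s : State) (x : ℕ) (e : NExpr) :
      Exec d (.assign x e) s (s.setVar x (e.eval d s)) (e.cost + 1)
  | store (s : State) (a : ℕ) (i e : NExpr) :
      Exec d (.store a i e) s (s.setArr a (i.eval d s) (e.eval d s)) (i.cost + e.cost + 1)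
  | seq {A B : Program} {s₁ s₂ s₃ : State} {t₁ t₂ : ℕ} :
      Exec d A s₁ s₂ t₁ → Exec d B s₂ s₃ t₂ → Exec d (.seq A B) s₁ s₃ (t₁ + t₂)
  | ite_true {e : NExpr} {A B : Program} {s s' : State} {t : ℕ} :
      e.eval d s ≠ 0 → Exec d A s s' t → Exec d (.ite e A B) s s' (e.cost + 1 + t)
  | ite_false {e : NExpr} {A B : Program} {s s' : State} {t : ℕ} :
      e.eval d s = 0 → Exec d B s s' t → Exec d (.ite e A B) s s' (e.cost + 1 + t)
  | while_false {e : NExpr} {A : Program} {s : State} :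
      e.eval d s = 0 → Exec d (.while e A) s s (e.cost + 1)
  | while_true {e : NExpr} {A : Program} {s₁ s₂ s₃ : State} {t₁ t₂ : ℕ} :
      e.eval d s₁ ≠ 0 → Exec d A s₁ s₂ t₁ → Exec d (.while e A) s₂ s₃ t₂ →
        Exec d (.while e A) s₁ s₃ (e.cost + 1 + t₁ + t₂)

/-- The machine is deterministic: the final state and the number of steps are unique. -/
theorem Exec.deterministic {d : ℕ → ℕ → ℝ≥0} {A : Program} {s s₁ s₂ : State} {t₁ t₂ : ℕ}
    (h₁ : Exec d A s s₁ t₁) (h₂ : Exec d A s s₂ t₂) : s₁ = s₂ ∧ t₁ = t₂ := by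
  induction h₁ generalizing s₂ t₂ with
  | skip => cases h₂; exact ⟨rfl, rfl⟩
  | assign => cases h₂; exact ⟨rfl, rfl⟩
  | store => cases h₂; exact ⟨rfl, rfl⟩
  | seq _ _ ihA ihB =>
    cases h₂ with
    | seq a b =>
      obtain ⟨rfl, rfl⟩ := ihA a
      obtain ⟨rfl, rfl⟩ := ihB b
      exact ⟨rfl, rfl⟩
  | ite_true he _ ih =>
    cases h₂ with
    | ite_true _ a => obtain ⟨rfl, rfl⟩ := ih a; exact ⟨rfl, rfl⟩
    | ite_false he' _ => exact absurd he' he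
  | ite_false he _ ih =>
    cases h₂ with
    | ite_true he' _ => exact absurd he he'
    | ite_false _ a => obtain ⟨rfl, rfl⟩ := ih a; exact ⟨rfl, rfl⟩
  | while_false he =>
    cases h₂ with
    | while_false _ => exact ⟨rfl, rfl⟩
    | while_true he' _ _ => exact absurd he he'
  | while_true he _ _ ihA ihB =>
    cases h₂ with
    | while_false he' => exact absurd he' he
    | while_true _ a b =>
      obtain ⟨rfl, rfl⟩ := ihA a
      obtain ⟨rfl, rfl⟩ := ihB b
      exact ⟨rfl, rfl⟩

/-! ### Input and output conventions -/

/-- The distance table that the machine can query; it is `0` outside of the range of the points. -/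
def Instance.distTable {n : ℕ} (I : Instance n) (x y : ℕ) : ℝ≥0 :=
  if h : x < n ∧ y < n then I.dist ⟨x, h.1⟩ ⟨y, h.2⟩ else 0

/-- The initial state: variables `0, 1, 2, 3` hold `n, L, U, p`, and arrays `0` and `1` hold the
indicator functions of the clients and of the facilities. All other entries are `0`. -/
def Instance.input {n : ℕ} (I : Instance n) : State where
  var x :=
    match x with
    | 0 => n
    | 1 => I.L
    | 2 => I.U
    | 3 => I.p
    | _ => 0
  arr a i :=
    match a with
    | 0 => if ∃ h : i < n, (⟨i, h⟩ : Fin n) ∈ I.clients then 1 else 0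
    | 1 => if ∃ h : i < n, (⟨i, h⟩ : Fin n) ∈ I.facilities then 1 else 0
    | _ => 0

/-- In the state `s` the machine outputs the solution `S`: variable `0` is `1`, variable `1` is the
number of open centers, array `0` lists their locations, and array `1` holds `j + 1` for every
client that is assigned to center `j` and `0` for every point that is not served. -/
structure State.OutputsSolution {n : ℕ} (s : State) (S : Solution n) : Prop where
  status : s.var 0 = 1
  numOpen : s.var 1 = S.numOpen
  loc : ∀ j : Fin S.numOpen, s.arr 0 j = S.loc j
  assign : ∀ v : {v // v ∈ S.served}, s.arr 1 v.1 = S.assign v + 1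
  unserved : ∀ v : Fin n, v ∉ S.served → s.arr 1 v = 0

/-- In the state `s` the machine outputs that there is no feasible solution. -/
def State.OutputsInfeasible (s : State) : Prop :=
  s.var 0 = 0

/-- `A` is a polynomial-time `ρ`-approximation algorithm for the (L, U, soft-∅, p)-supplier
problem: on every instance with `n` points it halts after a number of steps that is bounded by a
fixed polynomial in `n`; if the instance has a feasible solution, it outputs a feasible solution
whose radius is at most `ρ` times the optimal radius, and otherwise it outputs that there is
none. -/
def IsPolyTimeApproxAlgorithm (A : Program) (ρ : ℝ≥0) : Prop :=
  ∃ P : Polynomial ℕ, ∀ (n : ℕ) (I : Instance n), ∃ (s : State) (t : ℕ),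
    Exec I.distTable A I.input s t ∧ t ≤ P.eval n ∧
      ((∃ T : Solution n, T.Feasible I) →
        ∃ S : Solution n, s.OutputsSolution S ∧ S.IsApprox I ρ) ∧
      ((¬ ∃ T : Solution n, T.Feasible I) → s.OutputsInfeasible)

end CapSupplier

/-! The radius of a solution that serves a client is the distance of two points, so it suffices to
try every pair of points and to keep the solution found for the smallest distance ρ. For one ρ the
task is to serve, within 5ρ, at least as many clients as any feasible solution of radius at most ρ
(`exists_plan`). Empty clusters are never needed, so L is replaced by max(L, 1); the cases p = 0 and
U = 0 are split off.

Call a facility good if its ball of radius ρ contains at least L clients; a nonempty cluster of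
radius ρ can only use a good facility. Choose good facilities with disjoint balls, the net points,
until the ball of every good facility meets a net ball. Whenever possible, the next net point is a
facility whose ball shares a client with the ball of some good facility that meets an old net ball;
the owner of that old ball becomes its parent, at distance at most 4ρ. A new tree is started only
when no such candidate exists. This order has the effect that two clients with a common good
facility are always assigned to net points of the same tree, although each client is only known to
be within 3ρ of its net point (`Forest.grow`, `Forest.exists_top`). Thus every cluster of a
competing solution belongs to a single tree.

In a tree with N clients a competitor has at most m = ⌊N/L⌋ nonempty clusters, hence serves at most
min(N, mU) clients (`Balanced.card_le`). This number is attained. From the leaves upwards, each net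
point k opens as many clusters of L clients as its own clients and the remainders of its children
allow, and hands its remainder x k < L to its parent. The remainder of the root is then given back
as extras, at most U - L for each opened cluster, and what is left stays unserved. On each edge the
two flows are offset against each other: with S k the sum of the extras in the subtree of k, only |x
k - S k| clients cross the edge above k. Since S k is at most the remainder of the root, fewer than
L clients leave any net point (`Balanced.out_lt`), while at least L clients lie in its ball. So all
movers can be taken from the balls (`Exchanged.le_home`); each moves at most once, and ρ + 4ρ = 5ρ.
Finally the clients of a net point are dealt in turns to its centers (`count_mod_bounds`).

The program is written with `for` loops only. It then denotes a total function `Loop.run`, its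
running time is polynomial by structural induction (`exists_exec`), and its correctness follows from
loop invariants (`forN_induction`) together with the fact that a program changes only what it
mentions (`frame_run`). -/

namespace CapSupplier

/-! ### Loop programs

Programs in which every loop has the form `for i < n`, where `n` is the value of variable `0`.
They denote total functions on states and run in polynomial time. -/

/-- Programs whose loops run through the natural numbers below variable `0`. -/
inductive Loop where
  /-- do nothing -/
  | skip
  /-- assign the value of `e` to the variable `x` -/
  | assign (x : ℕ) (e : NExpr)
  /-- write the value of `e` into array `a` at index `i` -/
  | store (a : ℕ) (i e : NExpr)
  /-- sequential composition -/
  | seq (A B : Loop)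
  /-- run `A` if `e` is nonzero, otherwise run `B` -/
  | ite (e : NExpr) (A B : Loop)
  /-- run `A` with the variable `i` set to `0, …, n - 1` -/
  | forN (i : ℕ) (A : Loop)

namespace Loop

/-- The program that implements a loop program. -/
def toProgram : Loop → Program
  | skip => .skip
  | assign x e => .assign x e
  | store a i e => .store a i e
  | seq A B => .seq A.toProgram B.toProgram
  | ite e A B => .ite e A.toProgram B.toProgram
  | forN i A => .seq (.assign i (.lit 0)) (.while (.le (.add (.var i) (.lit 1)) (.var 0))
      (.seq A.toProgram (.assign i (.add (.var i) (.lit 1)))))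

/-- The state after `k` rounds of a loop with counter `i` and body `f`. -/
def rounds (f : State → State) (i : ℕ) (s : State) : ℕ → State
  | 0 => s.setVar i 0
  | k + 1 => (f (rounds f i s k)).setVar i (k + 1)

/-- The final state of a loop program. -/
noncomputable def run (d : ℕ → ℕ → ℝ≥0) : Loop → State → State
  | skip, s => s
  | assign x e, s => s.setVar x (e.eval d s)
  | store a i e, s => s.setArr a (i.eval d s) (e.eval d s)
  | seq A B, s => B.run d (A.run d s)
  | ite e A B, s => open Classical in if e.eval d s ≠ 0 then A.run d s else B.run d s
  | forN i A, s => rounds (A.run d) i s (s.var 0)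

/-- Whether a loop program contains an assignment to the variable `x`. -/
def writesVar : Loop → ℕ → Bool
  | skip, _ => false
  | assign y _, x => x == y
  | store _ _ _, _ => false
  | seq A B, x => A.writesVar x || B.writesVar x
  | ite _ A B, x => A.writesVar x || B.writesVar x
  | forN i A, x => x == i || A.writesVar x

/-- Whether a loop program contains a write to the array `a`. -/
def writesArr : Loop → ℕ → Bool
  | skip, _ => false
  | assign _ _, _ => false
  | store b _ _, a => a == b
  | seq A B, a => A.writesArr a || B.writesArr a
  | ite _ A B, a => A.writesArr a || B.writesArr a
  | forN _ A, a => A.writesArr a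

/-- No loop body changes its counter. -/
def Safe : Loop → Bool
  | skip => true
  | assign _ _ => true
  | store _ _ _ => true
  | seq A B => A.Safe && B.Safe
  | ite _ A B => A.Safe && B.Safe
  | forN i A => A.Safe && !(A.writesVar i)

end Loop

/-! ### Memory updates and the equations for `Loop.run` -/

@[simp] theorem State.setVar_var (s : State) (x v y : ℕ) :
    (s.setVar x v).var y = if y = x then v else s.var y := by
  simp [State.setVar, Function.update_apply]

@[simp] theorem State.setVar_arr (s : State) (x v : ℕ) : (s.setVar x v).arr = s.arr := rfl

@[simp] theorem State.setArr_var (s : State) (a i v : ℕ) : (s.setArr a i v).var = s.var := rfl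

theorem State.setArr_arr (s : State) (a i v b : ℕ) :
    (s.setArr a i v).arr b = if b = a then Function.update (s.arr a) i v else s.arr b := by
  simp [State.setArr, Function.update_apply]

@[simp] theorem State.setArr_arr_apply (s : State) (a i v b j : ℕ) :
    (s.setArr a i v).arr b j = if b = a then (if j = i then v else s.arr a j) else s.arr b j := by
  rw [State.setArr_arr]
  split_ifs <;> simp_all

@[ext] theorem State.ext' {s s' : State} (hv : ∀ x, s.var x = s'.var x)
    (ha : ∀ a i, s.arr a i = s'.arr a i) : s = s' := by
  cases s; cases s'
  congr
  · exact funext hv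
  · exact funext fun a => funext (ha a)

namespace Loop

variable {d : ℕ → ℕ → ℝ≥0}

@[simp] theorem run_skip (s : State) : skip.run d s = s := rfl

@[simp] theorem run_assign (x : ℕ) (e : NExpr) (s : State) :
    (assign x e).run d s = s.setVar x (e.eval d s) := rfl

@[simp] theorem run_store (a : ℕ) (i e : NExpr) (s : State) :
    (store a i e).run d s = s.setArr a (i.eval d s) (e.eval d s) := rfl

@[simp] theorem run_seq (A B : Loop) (s : State) :
    (seq A B).run d s = B.run d (A.run d s) := rfl

@[simp] theorem run_ite (e : NExpr) (A B : Loop) (s : State) :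
    (ite e A B).run d s = if e.eval d s ≠ 0 then A.run d s else B.run d s := by
  simp only [run]

/-- `s` and `s'` agree except on what `A` may write. -/
structure Frame (A : Loop) (s s' : State) : Prop where
  var : ∀ x, A.writesVar x = false → s'.var x = s.var x
  arr : ∀ a, A.writesArr a = false → s'.arr a = s.arr a

theorem frame_rounds {A : Loop} (hA : ∀ s, A.Frame s (A.run d s)) (i : ℕ) (s : State) (k : ℕ) :
    (forN i A).Frame s (rounds (A.run d) i s k) := by
  induction k with
  | zero =>
    refine ⟨fun x hx => ?_, fun a _ => rfl⟩
    simp only [writesVar, Bool.or_eq_false_iff, beq_eq_false_iff_ne] at hx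
    simp [rounds, hx.1]
  | succ k ih =>
    refine ⟨fun x hx => ?_, fun a ha => ?_⟩
    · have h := ih.var x hx
      simp only [writesVar, Bool.or_eq_false_iff, beq_eq_false_iff_ne] at hx
      simp [rounds, hx.1, (hA _).var x hx.2, h]
    · have h := ih.arr a ha
      rw [← h, ← (hA (rounds (A.run d) i s k)).arr a ha]
      rfl

/-- `writesVar` and `writesArr` are computed by recursion on the syntax, so for a concrete program
the side condition of this frame rule is `rfl`. -/
theorem frame_run (A : Loop) (s : State) : A.Frame s (A.run d s) := by
  induction A generalizing s with
  | skip => exact ⟨fun _ _ => rfl, fun _ _ => rfl⟩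
  | assign y e =>
    refine ⟨fun x hx => ?_, fun _ _ => rfl⟩
    simp only [writesVar, beq_eq_false_iff_ne] at hx
    simp [hx]
  | store b i e =>
    refine ⟨fun _ _ => rfl, fun a ha => ?_⟩
    simp only [writesArr, beq_eq_false_iff_ne] at ha
    simp [State.setArr_arr, ha]
  | seq A B ihA ihB =>
    constructor <;> intro x hx <;> simp only [writesVar, writesArr, Bool.or_eq_false_iff] at hx
    · rw [run_seq, (ihB _).var x hx.2, (ihA _).var x hx.1]
    · rw [run_seq, (ihB _).arr x hx.2, (ihA _).arr x hx.1]
  | ite e A B ihA ihB =>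
    constructor <;> intro x hx <;> simp only [writesVar, writesArr, Bool.or_eq_false_iff] at hx <;>
      rw [run_ite] <;> split_ifs
    · exact (ihA _).var x hx.1
    · exact (ihB _).var x hx.2
    · exact (ihA _).arr x hx.1
    · exact (ihB _).arr x hx.2
  | forN i A ih => exact frame_rounds ih i s _

/-- The rule for loops: an invariant that holds at the start and is preserved by the body holds
at the end. -/
theorem forN_induction {i : ℕ} {A : Loop} {s : State} (Inv : ℕ → State → Prop)
    (zero : Inv 0 (s.setVar i 0))
    (step : ∀ k < s.var 0, ∀ s', (forN i A).Frame s s' → s'.var i = k → Inv k s' →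
      Inv (k + 1) ((A.run d s').setVar i (k + 1))) :
    Inv (s.var 0) ((forN i A).run d s) := by
  have key : ∀ k ≤ s.var 0, Inv k (rounds (A.run d) i s k) := by
    intro k hk
    induction k with
    | zero => exact zero
    | succ k ih =>
      refine step k hk _ (frame_rounds (frame_run A) i s k) ?_ (ih (by omega))
      cases k <;> simp [rounds]
  exact key _ le_rfl

/-- Loop programs run in polynomial time. -/
theorem exists_exec (A : Loop) (hA : A.Safe = true) (h0 : A.writesVar 0 = false) :
    ∃ P : Polynomial ℕ, ∀ (d : ℕ → ℕ → ℝ≥0) (s : State),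
      ∃ t ≤ P.eval (s.var 0), Exec d A.toProgram s (A.run d s) t := by
  induction A with
  | skip => exact ⟨1, fun d s => ⟨1, by simp, .skip s⟩⟩
  | assign x e => exact ⟨Polynomial.C (e.cost + 1), fun d s => ⟨_, by simp, .assign s x e⟩⟩
  | store a i e =>
    exact ⟨Polynomial.C (i.cost + e.cost + 1), fun d s => ⟨_, by simp, .store s a i e⟩⟩
  | seq A B ihA ihB =>
    simp only [Safe, Bool.and_eq_true] at hA
    simp only [writesVar, Bool.or_eq_false_iff] at h0
    obtain ⟨P, hP⟩ := ihA hA.1 h0.1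
    obtain ⟨Q, hQ⟩ := ihB hA.2 h0.2
    refine ⟨P + Q, fun d s => ?_⟩
    obtain ⟨t₁, ht₁, hE₁⟩ := hP d s
    obtain ⟨t₂, ht₂, hE₂⟩ := hQ d (A.run d s)
    rw [(frame_run A s).var 0 h0.1] at ht₂
    exact ⟨_, by simpa using add_le_add ht₁ ht₂, .seq hE₁ hE₂⟩
  | ite e A B ihA ihB =>
    simp only [Safe, Bool.and_eq_true] at hA
    simp only [writesVar, Bool.or_eq_false_iff] at h0
    obtain ⟨P, hP⟩ := ihA hA.1 h0.1
    obtain ⟨Q, hQ⟩ := ihB hA.2 h0.2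
    refine ⟨Polynomial.C (e.cost + 1) + P + Q, fun d s => ?_⟩
    by_cases he : e.eval d s = 0
    · obtain ⟨t, ht, hE⟩ := hQ d s
      refine ⟨_, ?_, by simpa [run_ite, he, toProgram] using Exec.ite_false he hE⟩
      simp; omega
    · obtain ⟨t, ht, hE⟩ := hP d s
      refine ⟨_, ?_, by simpa [run_ite, he, toProgram] using Exec.ite_true he hE⟩
      simp; omega
  | forN i A ih =>
    simp only [Safe, Bool.and_eq_true, Bool.not_eq_true'] at hA
    obtain ⟨hS, hAi⟩ := hA
    have h0' := h0
    simp only [writesVar, Bool.or_eq_false_iff] at h0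
    obtain ⟨P, hP⟩ := ih hS h0.2
    -- Setting the counter costs 2. Besides its body a round costs 6 for the test and 4 for the
    -- increment; the extra factor 1 pays for the last, failing test.
    refine ⟨2 + (Polynomial.X + 1) * (P + 10), fun d s => ?_⟩
    have hn : ∀ k, (rounds (A.run d) i s k).var 0 = s.var 0 := fun k =>
      (frame_rounds (frame_run A) i s k).var 0 h0'
    have hk : ∀ k, (rounds (A.run d) i s k).var i = k := by
      intro k
      cases k <;> simp [rounds]
    -- Induction on the number `j` of rounds still to come, because `Exec` peels off the first round
    -- of a `while`.
    have key : ∀ j ≤ s.var 0, ∃ t ≤ (j + 1) * (P.eval (s.var 0) + 10),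
        Exec d (.while (.le (.add (.var i) (.lit 1)) (.var 0))
          (.seq A.toProgram (.assign i (.add (.var i) (.lit 1)))))
          (rounds (A.run d) i s (s.var 0 - j)) (rounds (A.run d) i s (s.var 0)) t := by
      intro j hj
      induction j with
      | zero =>
        refine ⟨_, ?_, .while_false ?_⟩
        · simp [NExpr.cost]
        · simp [NExpr.eval, hn, hk]
      | succ j ih =>
        obtain ⟨t₂, ht₂, hE₂⟩ := ih (by omega)
        obtain ⟨t₁, ht₁, hE₁⟩ := hP d (rounds (A.run d) i s (s.var 0 - (j + 1)))
        have hE : Exec d (.assign i (.add (.var i) (.lit 1)))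
            (A.run d (rounds (A.run d) i s (s.var 0 - (j + 1))))
            (rounds (A.run d) i s (s.var 0 - j)) 4 := by
          have h := Exec.assign (d := d) (A.run d (rounds (A.run d) i s (s.var 0 - (j + 1)))) i
            (.add (.var i) (.lit 1))
          have e1 : s.var 0 - j = s.var 0 - (j + 1) + 1 := by omega
          rw [e1, rounds]
          simpa [NExpr.eval, (frame_run A _).var i hAi, hk, NExpr.cost] using h
        refine ⟨_, ?_, .while_true ?_ (.seq hE₁ hE) hE₂⟩
        · rw [hn] at ht₁
          simp only [NExpr.cost]
          nlinarith
        · simp [NExpr.eval, hn, hk]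
          omega
    obtain ⟨t, ht, hE⟩ := key (s.var 0) le_rfl
    refine ⟨_, ?_, .seq (.assign s i (.lit 0)) (by simpa [rounds, NExpr.eval, run] using hE)⟩
    simp [NExpr.cost]
    omega

end Loop

/-! ### Nets of facilities with disjoint balls -/

section Net

variable (n : ℕ) (E : ℕ → ℕ → Prop)

/-- `g u` is a nonzero value of `f` on the `E`-neighbours of `u`, or `0` if there is none. -/
def Spreads (f g : ℕ → ℕ) : Prop :=
  ∀ u < n, (g u ≠ 0 → ∃ v < n, E v u ∧ f v = g u) ∧ (g u = 0 → ∀ v < n, E v u → f v = 0)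

variable (own : ℕ → ℕ)

/-- The ball around `u` meets the ball of net point `k`. -/
def Touches (u k : ℕ) : Prop := k ≠ 0 ∧ ∃ v, E v u ∧ own v = k

/-- The ball around `u` meets a ball that meets the ball of net point `k`. -/
def Linked (u k : ℕ) : Prop := ∃ w u₁, E w u ∧ E w u₁ ∧ Touches E own u₁ k

/-- A forest of net points `1, …, K` with disjoint balls; `own v` is the net point in whose ball
`v` lies, `par k` is the parent of `k` and `top k` is the root of its tree. -/
structure Forest (G : ℕ → Prop) (K : ℕ) (fac par top own : ℕ → ℕ) : Prop where
  own_le : ∀ v < n, own v ≤ K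
  own_iff : ∀ k, 1 ≤ k → k ≤ K → ∀ v < n, own v = k ↔ E v (fac k)
  good : ∀ k, 1 ≤ k → k ≤ K → G (fac k)
  par_lt : ∀ k, 1 ≤ k → k ≤ n → par k < k
  par_of_gt : ∀ k, K < k → k ≤ n → par k = 0
  top_root : ∀ k, 1 ≤ k → k ≤ n → par k = 0 → top k = k
  top_par : ∀ k, 1 ≤ k → k ≤ n → par k ≠ 0 → top k = top (par k)
  link : ∀ k, 1 ≤ k → k ≤ n → par k ≠ 0 →
    ∃ v u w, E v u ∧ own v = par k ∧ E w u ∧ own w = k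
  sep : ∀ u k k', Touches E own u k → Linked E own u k' → top k = top k'
  frontier : ∃ R, ∀ u k, G u → (∀ l, ¬ Touches E own u l) → Linked E own u k → top k = R

variable {n E own} {G : ℕ → Prop} {K : ℕ} {fac par top : ℕ → ℕ}

theorem Touches.linked {u k : ℕ} (h : Touches E own u k) : Linked E own u k := by
  obtain ⟨hk, v, hv, rfl⟩ := h
  exact ⟨v, u, hv, hv, hk, v, hv, rfl⟩

theorem Spreads.touches {g : ℕ → ℕ} (h : Spreads n E own g)
    {u : ℕ} (hu : u < n) (h0 : g u ≠ 0) : Touches E own u (g u) := by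
  obtain ⟨v, _, hv, e⟩ := (h u hu).1 h0
  exact ⟨h0, v, hv, e⟩

theorem Spreads.not_touches (hE : ∀ v u, E v u → v < n ∧ u < n) {g : ℕ → ℕ}
    (h : Spreads n E own g) {u : ℕ} (hu : u < n) (h0 : g u = 0) (k : ℕ) :
    ¬ Touches E own u k := by
  rintro ⟨hk, v, hv, e⟩
  exact hk (e ▸ (h u hu).2 h0 v (hE v u hv).1 hv)

/-- The values travel from net balls to facilities (`g₁`), from there to clients (`g₂`) and again to
facilities (`g₃`), which is the path in the definition of `Linked`. -/
theorem Spreads.linked {g₁ g₂ g₃ : ℕ → ℕ}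
    (h₁ : Spreads n E own g₁) (h₂ : Spreads n (fun u v => E v u) g₁ g₂)
    (h₃ : Spreads n E g₂ g₃) {u : ℕ} (hu : u < n) (h0 : g₃ u ≠ 0) : Linked E own u (g₃ u) := by
  obtain ⟨w, hw, hwu, e⟩ := (h₃ u hu).1 h0
  rw [← e] at h0 ⊢
  obtain ⟨u₁, hu₁, hwu₁, e⟩ := (h₂ w hw).1 h0
  rw [← e] at h0 ⊢
  exact ⟨w, u₁, hwu, hwu₁, h₁.touches hu₁ h0⟩

theorem Spreads.not_linked (hE : ∀ v u, E v u → v < n ∧ u < n) {g₁ g₂ g₃ : ℕ → ℕ}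
    (h₁ : Spreads n E own g₁) (h₂ : Spreads n (fun u v => E v u) g₁ g₂)
    (h₃ : Spreads n E g₂ g₃) {u : ℕ} (hu : u < n) (h0 : g₃ u = 0) (k : ℕ) :
    ¬ Linked E own u k := by
  rintro ⟨w, u₁, hwu, hwu₁, ht⟩
  have hw := (hE _ _ hwu).1
  have hu₁ := (hE _ _ hwu₁).2
  exact h₁.not_touches hE hu₁ ((h₂ w hw).2 ((h₃ u hu).2 h0 w hw hwu) u₁ hu₁ hwu₁) k ht

/-- The parent and root functions are set on all of `1, …, n`: a number not yet in use is a tree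
with one vertex, so later sums and loops may run up to `n` instead of `K`. -/
theorem Forest.init (htop : ∀ k, 1 ≤ k → k ≤ n → top k = k)
    (hpar : ∀ k, 1 ≤ k → k ≤ n → par k = 0) (hE : ∀ v u, E v u → v < n ∧ u < n)
    (hown : ∀ v < n, own v = 0) : Forest n E G 0 fac par top own := by
  have ht : ∀ u k, ¬ Touches E own u k := by
    rintro u k ⟨hk, v, hv, e⟩
    exact hk (e ▸ hown v (hE v u hv).1)
  refine ⟨fun v hv => (hown v hv).le, fun k h1 h2 => by omega, fun k h1 h2 => by omega,
    fun k h1 h2 => by rw [hpar k h1 h2]; omega, fun k h1 h2 => hpar k h1 h2,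
    fun k h1 h2 _ => htop k h1 h2, fun k h1 h2 h => absurd (hpar k h1 h2) h,
    fun k h1 h2 h => absurd (hpar k h1 h2) h, fun u k _ h => absurd h (ht u k), 0, ?_⟩
  rintro u k _ _ ⟨w, u₁, _, _, h⟩
  exact absurd h (ht _ _)

/-- The invariant `frontier` says that uncovered good facilities are linked to at most one tree, the
one under construction. A linked candidate joins this tree; by `hc0` a new tree begins only if
nothing uncovered is linked to any old net point. Hence a facility whose ball meets the new ball
cannot connect two different trees, which preserves `sep`. -/
theorem Forest.grow (hE : ∀ v u, E v u → v < n ∧ u < n) (hG : ∀ v u, E v u → G u)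
    (F : Forest n E G K fac par top own) {u₀ c : ℕ} (hu₀ : G u₀)
    (hfree : ∀ l, ¬ Touches E own u₀ l)
    (hc : c ≠ 0 → Linked E own u₀ c)
    (hc0 : c = 0 → ∀ u k, G u → (∀ l, ¬ Touches E own u l) → ¬ Linked E own u k)
    {fac' par' top' own' : ℕ → ℕ}
    (hfac : ∀ k ≤ K, fac' k = fac k) (hfac₀ : fac' (K + 1) = u₀)
    (hpar : ∀ k ≠ K + 1, par' k = par k) (hpar₀ : par' (K + 1) = c)
    (htop : ∀ k ≠ K + 1, top' k = top k) (htop₀ : top' (K + 1) = if c = 0 then K + 1 else top c)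
    (hown₁ : ∀ v, E v u₀ → own' v = K + 1) (hown₂ : ∀ v < n, ¬ E v u₀ → own' v = own v) :
    Forest n E G (K + 1) fac' par' top' own' := by
  have hfree' : ∀ v, E v u₀ → own v = 0 := by
    intro v hv
    by_contra h
    exact hfree _ ⟨h, v, hv, rfl⟩
  have hcK : c ≤ K := by
    rcases Nat.eq_zero_or_pos c with h | h
    · omega
    · obtain ⟨_, _, _, _, _, v, hv, e⟩ := hc (by omega)
      exact e ▸ F.own_le v (hE _ _ hv).1
  have hold : ∀ v < n, own' v ≠ K + 1 → own' v = own v ∧ ¬ E v u₀ := by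
    intro v hv h
    have : ¬ E v u₀ := fun h' => h (hown₁ v h')
    exact ⟨hown₂ v hv this, this⟩
  have hkeep : ∀ v < n, own v ≠ 0 → own' v = own v := by
    intro v hv h
    exact hown₂ v hv fun h' => h (hfree' v h')
  have T_old : ∀ u k, k ≠ K + 1 → Touches E own' u k → Touches E own u k := by
    rintro u k hk ⟨h0, v, hv, e⟩
    exact ⟨h0, v, hv, by rw [← (hold v (hE _ _ hv).1 (by omega)).1, e]⟩
  have T_mono : ∀ u k, Touches E own u k → Touches E own' u k := by
    rintro u k ⟨h0, v, hv, e⟩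
    exact ⟨h0, v, hv, by rw [hkeep v (hE _ _ hv).1 (by omega), e]⟩
  have T_le : ∀ u k, Touches E own u k → k ≤ K := by
    rintro u k ⟨h0, v, hv, e⟩
    exact e ▸ F.own_le v (hE _ _ hv).1
  have T_new : ∀ u, Touches E own' u (K + 1) → ∃ v, E v u ∧ E v u₀ := by
    rintro u ⟨_, v, hv, e⟩
    refine ⟨v, hv, ?_⟩
    by_contra h
    have := hown₂ v (hE _ _ hv).1 h
    have := F.own_le v (hE _ _ hv).1
    omega
  obtain ⟨R, hR⟩ := F.frontier
  have hRc : c ≠ 0 → top c = R := fun h => hR u₀ c hu₀ hfree (hc h)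
  have htop₁ : ∀ k, (∃ u, Touches E own u k) → top' k = top k := by
    rintro k ⟨u, h⟩
    have := T_le u k h
    exact htop k (by omega)
  -- an old net point that is linked to a facility whose ball meets the new ball
  have key : ∀ u k', Touches E own' u (K + 1) → Linked E own u k' → top' (K + 1) = top k' := by
    intro u k' hu hl
    obtain ⟨v, hvu, hvu₀⟩ := T_new u hu
    have hl₀ : ∀ k, Touches E own u k → Linked E own u₀ k := fun k hk => ⟨v, u, hvu₀, hvu, hk⟩
    -- If `u` meets an old ball `k`, the shared client `v` links `u₀` to `k`, so `k` lies in the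
    -- frontier tree, and `sep` carries this over to `k'`. Otherwise `u` itself was uncovered and
    -- linked to `k'`. Either way a link existed, so `c ≠ 0` and the new point joined the frontier
    -- tree.
    by_cases hf : ∃ k, Touches E own u k
    · obtain ⟨k, hk⟩ := hf
      have hc' : c ≠ 0 := fun h => hc0 h u₀ k hu₀ hfree (hl₀ k hk)
      rw [htop₀, if_neg hc', hRc hc', ← F.sep u k k' hk hl]
      exact (hR u₀ k hu₀ hfree (hl₀ k hk)).symm
    · push Not at hf
      have hgu := hG _ _ hvu
      have hc' : c ≠ 0 := fun h => hc0 h u k' hgu hf hl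
      rw [htop₀, if_neg hc', hRc hc']
      exact (hR u k' hgu hf hl).symm
  refine ⟨?_, ?_, ?_, ?_, ?_, ?_, ?_, ?_, ?_, ?_⟩
  · intro v hv
    by_cases h : E v u₀
    · exact (hown₁ v h).le
    · rw [hown₂ v hv h]
      exact (F.own_le v hv).trans (by omega)
  · intro k h1 h2 v hv
    have hle := F.own_le v hv
    rcases Nat.lt_or_ge k (K + 1) with h | h
    · rw [hfac k (by omega), ← F.own_iff k h1 (by omega) v hv]
      by_cases hv₀ : E v u₀
      · rw [hown₁ v hv₀, hfree' v hv₀]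
        omega
      · rw [hown₂ v hv hv₀]
    · obtain rfl : k = K + 1 := by omega
      rw [hfac₀]
      by_cases hv₀ : E v u₀
      · simp [hown₁ v hv₀, hv₀]
      · rw [hown₂ v hv hv₀]
        exact ⟨by omega, fun h => absurd h hv₀⟩
  · intro k h1 h2
    rcases Nat.lt_or_ge k (K + 1) with h | h
    · rw [hfac k (by omega)]
      exact F.good k h1 (by omega)
    · obtain rfl : k = K + 1 := by omega
      rwa [hfac₀]
  · intro k h1 h2
    by_cases h : k = K + 1
    · subst h
      omega
    · rw [hpar k h]
      exact F.par_lt k h1 h2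
  · intro k h1 h2
    rw [hpar k (by omega)]
    exact F.par_of_gt k (by omega) h2
  · intro k h1 h2 h3
    by_cases h : k = K + 1
    · subst h
      rw [htop₀, if_pos (by omega)]
    · rw [htop k h]
      exact F.top_root k h1 h2 (by rw [← hpar k h, h3])
  · intro k h1 h2 h3
    by_cases h : k = K + 1
    · subst h
      rw [htop₀, if_neg (by omega), hpar₀, htop c (by omega)]
    · rw [hpar k h] at h3 ⊢
      have : par k ≠ K + 1 := by
        have := F.par_lt k h1 h2
        by_cases hk : K < k
        · exact absurd (F.par_of_gt k hk h2) h3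
        · omega
      rw [htop k h, htop _ this]
      exact F.top_par k h1 h2 h3
  · intro k h1 h2 h3
    by_cases h : k = K + 1
    · subst h
      obtain ⟨w, u, hw, hwu, h0, v, hv, e⟩ := hc (by omega)
      exact ⟨v, u, w, hv, by rw [hkeep v (hE _ _ hv).1 (by omega), e, hpar₀], hwu, hown₁ w hw⟩
    · rw [hpar k h] at h3 ⊢
      obtain ⟨v, u, w, hv, e, hw, e'⟩ := F.link k h1 h2 h3
      exact ⟨v, u, w, hv, by rw [hkeep v (hE _ _ hv).1 (by omega), e], hw,
        by rw [hkeep w (hE _ _ hw).1 (by omega), e']⟩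
  · rintro u k k' hk ⟨w, u₁, hwu, hwu₁, hk'⟩
    by_cases h : k = K + 1 <;> by_cases h' : k' = K + 1
    · rw [h, h']
    · subst h
      have ht := T_old _ _ h' hk'
      rw [htop₁ k' ⟨_, ht⟩]
      exact key u k' hk ⟨w, u₁, hwu, hwu₁, ht⟩
    -- Here the new point is at the far end: the same path read from `u₁` links `u₁` to the old
    -- point `k`.
    · subst h'
      have ht := T_old _ _ h hk
      rw [htop₁ k ⟨_, ht⟩]
      exact (key u₁ k hk' ⟨w, u, hwu₁, hwu, ht⟩).symm
    · have ht := T_old _ _ h hk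
      have ht' := T_old _ _ h' hk'
      rw [htop₁ k ⟨_, ht⟩, htop₁ k' ⟨_, ht'⟩]
      exact F.sep u k k' ht ⟨w, u₁, hwu, hwu₁, ht'⟩
  -- The frontier tree is now that of the new point. An uncovered facility linked to an old point
  -- was uncovered before, which forces `c ≠ 0`, so the new point belongs to the previous frontier
  -- tree.
  · refine ⟨top' (K + 1), ?_⟩
    rintro u k hu hf ⟨w, u₁, hwu, hwu₁, hk⟩
    by_cases h : k = K + 1
    · rw [h]
    · have ht := T_old _ _ h hk
      have hf' : ∀ l, ¬ Touches E own u l := fun l hl => hf l (T_mono u l hl)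
      have hl : Linked E own u k := ⟨w, u₁, hwu, hwu₁, ht⟩
      have hc' : c ≠ 0 := fun h => hc0 h u k hu hf' hl
      rw [htop₁ k ⟨_, ht⟩, htop₀, if_neg hc', hRc hc']
      exact hR u k hu hf' hl

/-- Net balls are nonempty, and a client has only one owner, so each net point accounts for a client
of its own. This bounds the number of greedy rounds. -/
theorem Forest.K_le_card (F : Forest n E G K fac par top own) (hE : ∀ v u, E v u → v < n ∧ u < n)
    (hne : ∀ u, G u → ∃ v, E v u) : K ≤ ((Finset.range n).filter fun v => own v ≠ 0).card := by
  have : Finset.Icc 1 K ⊆ ((Finset.range n).filter fun v => own v ≠ 0).image own := by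
    intro k hk
    rw [Finset.mem_Icc] at hk
    obtain ⟨v, hv⟩ := hne _ (F.good k hk.1 hk.2)
    have hvn := (hE _ _ hv).1
    have e := (F.own_iff k hk.1 hk.2 v hvn).2 hv
    exact Finset.mem_image.2 ⟨v, by simp [hvn, e]; omega, e⟩
  simpa using (Finset.card_le_card this).trans Finset.card_image_le

theorem Forest.K_le (F : Forest n E G K fac par top own) (hE : ∀ v u, E v u → v < n ∧ u < n)
    (hne : ∀ u, G u → ∃ v, E v u) : K ≤ n :=
  (F.K_le_card hE hne).trans ((Finset.card_filter_le _ _).trans (by simp))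

/-- With `n` net points every point is owned, so the ball of any good facility meets a net ball.
This is why `n` greedy rounds suffice. -/
theorem Forest.touches_of_eq (F : Forest n E G n fac par top own)
    (hE : ∀ v u, E v u → v < n ∧ u < n) (hne : ∀ u, G u → ∃ v, E v u) {u : ℕ} (hu : G u) :
    ∃ k, Touches E own u k := by
  obtain ⟨v, hv⟩ := hne u hu
  have h : ((Finset.range n).filter fun v => own v ≠ 0) = Finset.range n :=
    Finset.eq_of_subset_of_card_le (Finset.filter_subset _ _)
      (by simpa using F.K_le_card hE hne)
  have hv' : v ∈ (Finset.range n).filter fun v => own v ≠ 0 := by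
    rw [h]; simpa using (hE _ _ hv).1
  exact ⟨own v, (Finset.mem_filter.1 hv').2, v, hv, rfl⟩

/-- Every client near a good facility is assigned to a net point. -/
theorem Forest.exists_top (F : Forest n E G K fac par top own)
    (hE : ∀ v u, E v u → v < n ∧ u < n) (hG : ∀ v u, E v u → G u)
    (hall : ∀ u, G u → ∃ k, Touches E own u k) {g₁ g₂ asg : ℕ → ℕ}
    (h₁ : Spreads n E own g₁) (h₂ : Spreads n (fun u v => E v u) g₁ g₂)
    (hasg : ∀ v < n, asg v = if own v ≠ 0 then own v else g₂ v) {v : ℕ} (hv : v < n) :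
    (asg v ≠ 0 → ∃ u, E v u ∧ Touches E own u (asg v)) ∧
      (∀ u, E v u → asg v ≠ 0 ∧ ∀ k, Touches E own u k → top (asg v) = top k) := by
  have hg : own v = 0 → asg v = g₂ v := fun h => by simp [hasg v hv, h]
  have ho : own v ≠ 0 → asg v = own v := fun h => by simp [hasg v hv, h]
  have hex : asg v ≠ 0 → ∃ u, E v u ∧ Touches E own u (asg v) := by
    intro h0
    by_cases h : own v = 0
    · rw [hg h] at h0 ⊢
      obtain ⟨u, hu, hvu, e⟩ := (h₂ v hv).1 h0
      rw [← e] at h0 ⊢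
      exact ⟨u, hvu, h₁.touches hu h0⟩
    · rw [ho h]
      have hle := F.own_le v hv
      have := (F.own_iff (own v) (by omega) hle v hv).1 rfl
      exact ⟨_, this, h, v, this, rfl⟩
  refine ⟨hex, fun u hvu => ?_⟩
  have h0 : asg v ≠ 0 := by
    by_cases h : own v = 0
    · rw [hg h]
      intro h0
      obtain ⟨k, hk⟩ := hall u (hG _ _ hvu)
      have hu := (hE _ _ hvu).2
      exact h₁.not_touches hE hu ((h₂ v hv).2 h0 u hu hvu) k hk
    · rwa [ho h]
  refine ⟨h0, fun k hk => ?_⟩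
  obtain ⟨u₁, hvu₁, ht⟩ := hex h0
  -- The client `v` lies in the balls of `u` and `u₁`, so `u` is linked to `asg v`.
  exact (F.sep u k _ hk ⟨v, u₁, hvu, hvu₁, ht⟩).symm

end Net

/-! ### Balancing the clusters along a forest -/

section Balance

/-- `par` and `top` are the parent function and the root function of a forest on `1, …, n`;
the parent of a root is `0`. -/
structure IsForest (n : ℕ) (par top : ℕ → ℕ) : Prop where
  par_lt : ∀ k, 1 ≤ k → k ≤ n → par k < k
  top_root : ∀ k, 1 ≤ k → k ≤ n → par k = 0 → top k = k
  top_par : ∀ k, 1 ≤ k → k ≤ n → par k ≠ 0 → top k = top (par k)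

variable {n : ℕ} {par top : ℕ → ℕ}

theorem IsForest.top_mem (F : IsForest n par top) (k : ℕ) (h1 : 1 ≤ k) (h2 : k ≤ n) :
    1 ≤ top k ∧ top k ≤ n ∧ par (top k) = 0 := by
  induction k using Nat.strong_induction_on with
  | _ k ih =>
    have hlt := F.par_lt k h1 h2
    by_cases h : par k = 0
    · rw [F.top_root k h1 h2 h]
      exact ⟨h1, h2, h⟩
    · rw [F.top_par k h1 h2 h]
      exact ih _ hlt (by omega) (by omega)

/-- The children of `k`. -/
def children (n : ℕ) (par : ℕ → ℕ) (k : ℕ) : Finset ℕ := (Finset.Icc 1 n).filter (par · = k)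

/-- The tree with root `r`. -/
def tree (n : ℕ) (top : ℕ → ℕ) (r : ℕ) : Finset ℕ := (Finset.Icc 1 n).filter (top · = r)

theorem mem_children {k c : ℕ} : c ∈ children n par k ↔ (1 ≤ c ∧ c ≤ n) ∧ par c = k := by
  simp [children]

theorem mem_tree {r k : ℕ} : k ∈ tree n top r ↔ (1 ≤ k ∧ k ≤ n) ∧ top k = r := by
  simp [tree]

/-- Summing the recursion over the tree, the value of every vertex other than the root occurs once
as a vertex and once as a child, and cancels. The weights are integers since `cnt k - L * a k` may
be negative. -/
theorem IsForest.sum_tree (F : IsForest n par top) {f w : ℕ → ℤ}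
    (h : ∀ k, 1 ≤ k → k ≤ n → f k = w k + ∑ c ∈ children n par k, f c) {r : ℕ} (h1 : 1 ≤ r)
    (h2 : r ≤ n) (hr : par r = 0) : f r = ∑ k ∈ tree n top r, w k := by
  have e1 : ∑ k ∈ tree n top r, w k =
      ∑ k ∈ tree n top r, f k - ∑ k ∈ tree n top r, ∑ c ∈ children n par k, f c := by
    rw [← Finset.sum_sub_distrib]
    refine Finset.sum_congr rfl fun k hk => ?_
    rw [mem_tree] at hk
    rw [h k hk.1.1 hk.1.2]
    ring
  have e2 : ∑ k ∈ tree n top r, ∑ c ∈ children n par k, f c =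
      ∑ c ∈ (tree n top r).filter (par · ≠ 0), f c := by
    rw [← Finset.sum_fiberwise_of_maps_to (s := (tree n top r).filter (par · ≠ 0))
      (t := tree n top r) (g := par) (f := f)]
    · refine Finset.sum_congr rfl fun k hk => Finset.sum_congr ?_ fun _ _ => rfl
      ext c
      simp only [mem_children, Finset.mem_filter, mem_tree] at hk ⊢
      constructor
      · rintro ⟨hc, rfl⟩
        have h0 : par c ≠ 0 := by omega
        exact ⟨⟨⟨hc, by rw [F.top_par c hc.1 hc.2 h0, hk.2]⟩, h0⟩, rfl⟩
      · rintro ⟨⟨⟨hc, _⟩, _⟩, e⟩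
        exact ⟨hc, e⟩
    · intro c hc
      simp only [Finset.mem_filter, mem_tree] at hc ⊢
      obtain ⟨⟨hc, e⟩, h0⟩ := hc
      have := F.par_lt c hc.1 hc.2
      exact ⟨by omega, by rw [← F.top_par c hc.1 hc.2 h0, e]⟩
  have e3 : (tree n top r).filter (par · = 0) = {r} := by
    ext c
    simp only [Finset.mem_filter, mem_tree, Finset.mem_singleton]
    constructor
    · rintro ⟨⟨hc, e⟩, h0⟩
      rw [← F.top_root c hc.1 hc.2 h0, e]
    · rintro rfl
      exact ⟨⟨⟨h1, h2⟩, F.top_root _ h1 h2 hr⟩, hr⟩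
  rw [e1, e2, ← Finset.sum_filter_add_sum_filter_not (tree n top r) (par · = 0) f, e3]
  simp

/-- How many clusters each net point opens and how many clients it exchanges: net point `k` opens
`a k` clusters, which get `L * a k + e k` clients in total. It passes `x k - S k` clients to its
parent, or receives `S k - x k` clients from it. The parent of a root stands for the clients that
are not served. -/
structure Balanced (n L U : ℕ) (par top cnt a x e S : ℕ → ℕ) : Prop where
  forest : IsForest n par top
  lt : ∀ k, 1 ≤ k → k ≤ n → x k < L
  up : ∀ k, 1 ≤ k → k ≤ n → L * a k + x k = cnt k + ∑ c ∈ children n par k, x c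
  extra : ∀ k, 1 ≤ k → k ≤ n → e k ≤ a k * (U - L)
  sum_extra : ∀ k, 1 ≤ k → k ≤ n → S k = e k + ∑ c ∈ children n par k, S c
  budget : ∀ r, 1 ≤ r → r ≤ n → par r = 0 →
    ∑ k ∈ tree n top r, e k = min (x r) (∑ k ∈ tree n top r, a k * (U - L))

variable {L U : ℕ} {cnt a x e S : ℕ → ℕ}

/-- As `x r < L`, this is division with remainder: rounding at each net point separately loses
nothing, and the tree opens ⌊N/L⌋ clusters for its N clients. -/
theorem Balanced.tree_count (B : Balanced n L U par top cnt a x e S) {r : ℕ} (h1 : 1 ≤ r)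
    (h2 : r ≤ n) (hr : par r = 0) :
    L * ∑ k ∈ tree n top r, a k + x r = ∑ k ∈ tree n top r, cnt k := by
  have := B.forest.sum_tree (f := fun k => (x k : ℤ)) (w := fun k => (cnt k : ℤ) - L * a k)
    (fun k hk1 hk2 => by have := B.up k hk1 hk2; zify at this; linarith) h1 h2 hr
  rw [Finset.sum_sub_distrib, ← Finset.mul_sum] at this
  zify
  linarith

theorem Balanced.S_root (B : Balanced n L U par top cnt a x e S) {r : ℕ} (h1 : 1 ≤ r)
    (h2 : r ≤ n) (hr : par r = 0) : S r = min (x r) (∑ k ∈ tree n top r, a k * (U - L)) := by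
  rw [← B.budget r h1 h2 hr]
  have := B.forest.sum_tree (f := fun k => (S k : ℤ)) (w := fun k => (e k : ℤ))
    (fun k hk1 hk2 => by have := B.sum_extra k hk1 hk2; zify at this; linarith) h1 h2 hr
  zify
  exact this

theorem Balanced.S_root_le (B : Balanced n L U par top cnt a x e S) {r : ℕ} (h1 : 1 ≤ r)
    (h2 : r ≤ n) (hr : par r = 0) : S r ≤ x r := by
  rw [B.S_root h1 h2 hr]
  exact min_le_left _ _

/-- Subtree sums do not decrease towards the root, where the extras were paid out of the remainder
`x r < L`. -/
theorem Balanced.S_lt (B : Balanced n L U par top cnt a x e S) (k : ℕ) (h1 : 1 ≤ k)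
    (h2 : k ≤ n) : S k < L := by
  induction k using Nat.strong_induction_on with
  | _ k ih =>
    have hlt := B.forest.par_lt k h1 h2
    by_cases h : par k = 0
    · exact (B.S_root_le h1 h2 h).trans_lt (B.lt k h1 h2)
    · refine lt_of_le_of_lt ?_ (ih _ hlt (by omega) (by omega))
      rw [B.sum_extra (par k) (by omega) (by omega)]
      exact le_add_left (Finset.single_le_sum (f := S) (fun _ _ => Nat.zero_le _)
        (mem_children.2 ⟨⟨h1, h2⟩, rfl⟩))

/-- Fewer than `L` clients have to leave the ball of any net point. -/
theorem Balanced.out_lt (B : Balanced n L U par top cnt a x e S) {k : ℕ} (h1 : 1 ≤ k)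
    (h2 : k ≤ n) : (x k - S k) + ∑ c ∈ children n par k, (S c - x c) < L := by
  -- The children's sum is at most `S k`, so the outflow is at most the maximum of `x k` and `S k`,
  -- both smaller than `L`.
  have h : ∑ c ∈ children n par k, (S c - x c) ≤ ∑ c ∈ children n par k, S c :=
    Finset.sum_le_sum fun c _ => Nat.sub_le _ _
  have := B.sum_extra k h1 h2
  have := B.lt k h1 h2
  have := B.S_lt k h1 h2
  omega

/-- A net point without clients and children sends no clients. -/
theorem Balanced.out_eq_zero (B : Balanced n L U par top cnt a x e S) {k : ℕ} (h1 : 1 ≤ k)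
    (h2 : k ≤ n) (hch : children n par k = ∅) (hcnt : cnt k = 0) :
    (x k - S k) + ∑ c ∈ children n par k, (S c - x c) = 0 := by
  have hu := B.up k h1 h2
  rw [hch, hcnt, Finset.sum_empty] at hu
  rw [hch]
  simp
  omega

theorem sum_tree_eq (F : IsForest n par top) (f : ℕ → ℕ) :
    ∑ k ∈ Finset.Icc 1 n, f k =
      ∑ r ∈ (Finset.Icc 1 n).filter (par · = 0), ∑ k ∈ tree n top r, f k := by
  rw [← Finset.sum_fiberwise_of_maps_to (s := Finset.Icc 1 n) (g := top)
    (t := (Finset.Icc 1 n).filter (par · = 0)) (f := f)]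
  · rfl
  · intro k hk
    rw [Finset.mem_Icc] at hk
    have := F.top_mem k hk.1 hk.2
    simp only [Finset.mem_filter, Finset.mem_Icc]
    tauto

/-- Clusters of sizes between `L` and `U` that respect the trees do not serve more clients. -/
theorem Balanced.card_le (B : Balanced n L U par top cnt a x e S) (hL : L ≤ U)
    {asg : ℕ → ℕ}
    (hcnt : ∀ k, 1 ≤ k → k ≤ n → cnt k = ((Finset.range n).filter (asg · = k)).card)
    {J : Type*} [DecidableEq J] {V : Finset ℕ} (hV : ∀ v ∈ V, v < n ∧ 1 ≤ asg v ∧ asg v ≤ n)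
    (φ : ℕ → J) (hφ : ∀ v ∈ V, ∀ w ∈ V, φ v = φ w → top (asg v) = top (asg w))
    (hlow : ∀ v ∈ V, L ≤ (V.filter (φ · = φ v)).card)
    (hup : ∀ v ∈ V, (V.filter (φ · = φ v)).card ≤ U) :
    V.card ≤ ∑ k ∈ Finset.Icc 1 n, (L * a k + e k) := by
  rw [sum_tree_eq B.forest, Finset.card_eq_sum_card_fiberwise (f := fun v => top (asg v))
    (t := (Finset.Icc 1 n).filter (par · = 0))]
  · refine Finset.sum_le_sum fun r hr => ?_
    rw [Finset.mem_filter, Finset.mem_Icc] at hr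
    obtain ⟨⟨h1, h2⟩, hr⟩ := hr
    set W := V.filter (fun v => top (asg v) = r) with hW
    have hT : W.card ≤ ∑ k ∈ tree n top r, cnt k := by
      rw [Finset.card_eq_sum_card_fiberwise (s := W) (f := asg) (t := tree n top r)]
      · refine Finset.sum_le_sum fun k hk => ?_
        rw [mem_tree] at hk
        rw [hcnt k hk.1.1 hk.1.2]
        refine Finset.card_le_card fun v hv => ?_
        simp only [hW, Finset.mem_filter, Finset.mem_range] at hv ⊢
        exact ⟨(hV v hv.1.1).1, hv.2⟩
      · intro v hv
        simp only [hW, Finset.coe_filter, Set.mem_ofPred_eq, Finset.mem_coe, mem_tree] at hv ⊢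
        exact ⟨(hV v hv.1).2, hv.2⟩
    have hfib : ∀ j ∈ W.image φ, L ≤ (W.filter (φ · = j)).card ∧
        (W.filter (φ · = j)).card ≤ U := by
      intro j hj
      obtain ⟨v, hv, rfl⟩ := Finset.mem_image.1 hj
      have hv' := Finset.mem_filter.1 hv
      -- By `hφ` a cluster that meets the tree of `r` is contained in it, so its size bounds remain
      -- valid inside `W`.
      have : W.filter (φ · = φ v) = V.filter (φ · = φ v) := by
        ext w
        simp only [hW, Finset.mem_filter]
        constructor
        · rintro ⟨⟨h, _⟩, e⟩
          exact ⟨h, e⟩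
        · rintro ⟨h, e⟩
          exact ⟨⟨h, (hφ w h v hv'.1 e).trans hv'.2⟩, e⟩
      rw [this]
      exact ⟨hlow v hv'.1, hup v hv'.1⟩
    have hc := Finset.card_eq_sum_card_image φ W
    have hge : (W.image φ).card * L ≤ W.card := by
      rw [hc, ← smul_eq_mul]
      exact Finset.card_nsmul_le_sum _ _ _ fun j hj => (hfib j hj).1
    have hle : W.card ≤ (W.image φ).card * U := by
      rw [hc, ← smul_eq_mul]
      exact Finset.sum_le_card_nsmul _ _ _ fun j hj => (hfib j hj).2
    have ht := B.tree_count h1 h2 hr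
    have hx := B.lt r h1 h2
    rw [Finset.sum_add_distrib, ← Finset.mul_sum, B.budget r h1 h2 hr, ← Finset.sum_mul]
    set m := ∑ k ∈ tree n top r, a k
    set M := (W.image φ).card
    -- `M` clusters use at least `L * M` clients, but the tree has only `L * m + x r < L * (m + 1)`.
    have hMm : M ≤ m := by
      by_contra h
      push Not at h
      have : L * (m + 1) ≤ L * M := Nat.mul_le_mul_left _ h
      nlinarith
    have h3 : W.card ≤ m * U := hle.trans (Nat.mul_le_mul_right _ hMm)
    obtain ⟨D, rfl⟩ := Nat.exists_eq_add_of_le hL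
    rw [Nat.add_sub_cancel_left]
    -- Either the whole remainder is distributed and every client of the tree is served, or all `m`
    -- clusters are filled up to `U`.
    rcases min_cases (x r) (m * D) with ⟨h, _⟩ | ⟨h, _⟩ <;> rw [h]
    · omega
    · calc W.card ≤ m * (L + D) := h3
        _ = L * m + m * D := by ring
  · intro v hv
    have := hV v hv
    have := B.forest.top_mem _ this.2.1 this.2.2
    simp only [Finset.coe_filter, Finset.mem_Icc, Set.mem_ofPred_eq]
    tauto

/-! ### Moving the clients -/

/-- The number of points below `n` with `f v = k`. -/
def fiberCard (n : ℕ) (f : ℕ → ℕ) (k : ℕ) : ℕ := ((Finset.range n).filter (f · = k)).card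

/-- The number of points `v` below `n` with `own v = asg v = k`. -/
def homeCard (n : ℕ) (own asg : ℕ → ℕ) (k : ℕ) : ℕ :=
  ((Finset.range n).filter fun v => own v = k ∧ asg v = k).card

/-- `asg'` arises from `asg` by moving `m` points from their home `src` to `dst`. -/
structure Moved (n : ℕ) (own asg asg' : ℕ → ℕ) (src dst m : ℕ) : Prop where
  ex : ∃ M ⊆ (Finset.range n).filter (fun v => own v = src ∧ asg v = src), M.card = m ∧
    ∀ v < n, asg' v = if v ∈ M then dst else asg v

variable {own asg asg' : ℕ → ℕ} {src dst m : ℕ}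

theorem Moved.homeCard_src (h : Moved n own asg asg' src dst m) (hne : src ≠ dst) :
    homeCard n own asg' src + m = homeCard n own asg src := by
  obtain ⟨M, hM, rfl, hasg⟩ := h.ex
  rw [homeCard, homeCard, ← Finset.card_sdiff_add_card_eq_card hM]
  congr 2
  ext v
  simp only [Finset.mem_filter, Finset.mem_range, Finset.mem_sdiff]
  constructor
  · rintro ⟨hv, h1, h2⟩
    rw [hasg v hv] at h2
    split_ifs at h2 with h3
    · exact absurd h2.symm hne
    · exact ⟨⟨hv, h1, h2⟩, h3⟩
  · rintro ⟨⟨hv, h1, h2⟩, h3⟩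
    exact ⟨hv, h1, by rw [hasg v hv, if_neg h3, h2]⟩

theorem Moved.homeCard_of_ne (h : Moved n own asg asg' src dst m) {k : ℕ} (hk : k ≠ src) :
    homeCard n own asg' k = homeCard n own asg k := by
  obtain ⟨M, hM, rfl, hasg⟩ := h.ex
  rw [homeCard, homeCard]
  congr 1
  refine Finset.filter_congr fun v hv => and_congr_right fun h1 => ?_
  rw [hasg v (Finset.mem_range.1 hv), if_neg]
  intro h
  exact hk (h1.symm.trans (Finset.mem_filter.1 (hM h)).2.1)

theorem Moved.fiberCard_eq (h : Moved n own asg asg' src dst m) (hne : src ≠ dst) (k : ℕ) :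
    (fiberCard n asg' k : ℤ) =
      fiberCard n asg k - (if k = src then (m : ℤ) else 0) + (if k = dst then (m : ℤ) else 0) := by
  obtain ⟨M, hM, rfl, hasg⟩ := h.ex
  have hM' : ∀ v ∈ M, v < n ∧ asg v = src := fun v hv => by
    have := Finset.mem_filter.1 (hM hv)
    exact ⟨Finset.mem_range.1 this.1, this.2.2⟩
  rw [fiberCard, fiberCard]
  by_cases h1 : k = src
  · subst h1
    rw [if_pos rfl, if_neg hne]
    have : (Finset.range n).filter (asg' · = k) = (Finset.range n).filter (asg · = k) \ M := by
      ext v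
      simp only [Finset.mem_filter, Finset.mem_range, Finset.mem_sdiff]
      by_cases hv : v < n
      · rw [hasg v hv]
        by_cases hm : v ∈ M
        · simp [hm, hne.symm]
        · simp [hm]
      · simp [hv]
    rw [this]
    have hs : M ⊆ (Finset.range n).filter (asg · = k) := fun v hv => by simp [hM' v hv]
    have := Finset.card_sdiff_add_card_eq_card hs
    push_cast [← this]
    ring
  · by_cases h2 : k = dst
    · subst h2
      rw [if_neg h1, if_pos rfl]
      have : (Finset.range n).filter (asg' · = k) =
          (Finset.range n).filter (asg · = k) ∪ M := by
        ext v
        simp only [Finset.mem_filter, Finset.mem_range, Finset.mem_union]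
        by_cases hv : v < n
        · rw [hasg v hv]
          by_cases hm : v ∈ M
          · simp [hm, hv]
          · simp [hm]
        · have : v ∉ M := fun h => hv (hM' v h).1
          simp [hv, this]
      rw [this, Finset.card_union_of_disjoint]
      · push_cast
        ring
      · rw [Finset.disjoint_left]
        intro v hv hm
        exact h1 ((Finset.mem_filter.1 hv).2.symm.trans (hM' v hm).2)
    · rw [if_neg h1, if_neg h2]
      rw [sub_zero, add_zero, Nat.cast_inj]
      congr 1
      refine Finset.filter_congr fun v hv => ?_
      rw [hasg v (Finset.mem_range.1 hv)]
      split_ifs with hm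
      · rw [(hM' v hm).2]
        exact ⟨fun h => absurd h.symm h2, fun h => absurd h.symm h1⟩
      · rfl

/-- The situation after the exchange of clients between `k` and its parent for all `k ≤ i`, when
`asg₀` is the original assignment. -/
structure Exchanged (n : ℕ) (par x S own asg₀ : ℕ → ℕ) (i : ℕ) (asg : ℕ → ℕ) : Prop where
  home : ∀ k, 1 ≤ k → k ≤ n → homeCard n own asg k + (if k ≤ i then x k - S k else 0) +
    ∑ c ∈ (children n par k).filter (· ≤ i), (S c - x c) = homeCard n own asg₀ k
  count : ∀ k, 1 ≤ k → k ≤ n → (fiberCard n asg k : ℤ) = fiberCard n asg₀ k -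
    (if k ≤ i then (x k : ℤ) - S k else 0) +
    ∑ c ∈ (children n par k).filter (· ≤ i), ((x c : ℤ) - S c)
  asg_eq : ∀ v < n, asg v = asg₀ v ∨ (1 ≤ own v ∧ own v ≤ n ∧ asg v = par (own v)) ∨
    (1 ≤ asg v ∧ asg v ≤ n ∧ own v ≠ 0 ∧ par (asg v) = own v)

theorem Exchanged.zero {asg₀ : ℕ → ℕ} : Exchanged n par x S own asg₀ 0 asg₀ := by
  have : ∀ k, (children n par k).filter (· ≤ 0) = ∅ := by
    intro k
    ext c
    simp only [Finset.mem_filter, mem_children, Finset.notMem_empty, iff_false]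
    omega
  refine ⟨fun k h1 h2 => ?_, fun k h1 h2 => ?_, fun v _ => .inl rfl⟩
  · rw [this, if_neg (by omega)]
    simp
  · rw [this, if_neg (by omega)]
    simp

theorem sum_children_succ {M : Type*} [AddCommMonoid M] (f : ℕ → M) {i : ℕ} (hi : i < n) (k : ℕ) :
    ∑ c ∈ (children n par k).filter (· ≤ i + 1), f c =
      (if par (i + 1) = k then f (i + 1) else 0) +
        ∑ c ∈ (children n par k).filter (· ≤ i), f c := by
  split_ifs with h
  · rw [← Finset.sum_insert]
    · congr 1
      ext c
      simp only [Finset.mem_filter, mem_children, Finset.mem_insert]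
      constructor
      · rintro ⟨⟨h1, h2⟩, h3⟩
        by_cases hc : c = i + 1
        · exact .inl hc
        · exact .inr ⟨⟨h1, h2⟩, by omega⟩
      · rintro (rfl | ⟨⟨h1, h2⟩, h3⟩)
        · exact ⟨⟨by omega, h⟩, le_rfl⟩
        · exact ⟨⟨h1, h2⟩, by omega⟩
    · simp
  · rw [zero_add]
    congr 1
    refine Finset.filter_congr fun c hc => ?_
    rw [mem_children] at hc
    have : c ≠ i + 1 := by
      rintro rfl
      exact h hc.2
    omega

/-- There are enough clients for the next exchange. -/
theorem Exchanged.le_home {asg₀ : ℕ → ℕ} {i : ℕ} (h : Exchanged n par x S own asg₀ i asg)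
    (hi : i < n) (hout : ∀ k, 1 ≤ k → k ≤ n →
      (x k - S k) + ∑ c ∈ children n par k, (S c - x c) ≤ homeCard n own asg₀ k)
    (hpar : par (i + 1) < i + 1) :
    x (i + 1) - S (i + 1) ≤ homeCard n own asg (i + 1) ∧
      (par (i + 1) ≠ 0 → S (i + 1) - x (i + 1) ≤ homeCard n own asg (par (i + 1))) := by
  constructor
  · have h1 := h.home (i + 1) (by omega) hi
    have h2 := hout (i + 1) (by omega) hi
    rw [if_neg (by omega)] at h1
    have : ∑ c ∈ (children n par (i + 1)).filter (· ≤ i), (S c - x c) ≤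
        ∑ c ∈ children n par (i + 1), (S c - x c) :=
      Finset.sum_le_sum_of_subset (Finset.filter_subset _ _)
    omega
  · intro h0
    have h1 := h.home (par (i + 1)) (by omega) (by omega)
    have h2 := hout (par (i + 1)) (by omega) (by omega)
    -- The flow needed now is the next term of the sum over the children of the parent; the total
    -- outflow fits by `hout`, so enough clients remain at home.
    have h3 := sum_children_succ (n := n) (par := par) (fun c => S c - x c) hi (par (i + 1))
    rw [if_pos rfl] at h3
    have : ∑ c ∈ (children n par (par (i + 1))).filter (· ≤ i + 1), (S c - x c) ≤
        ∑ c ∈ children n par (par (i + 1)), (S c - x c) :=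
      Finset.sum_le_sum_of_subset (Finset.filter_subset _ _)
    split_ifs at h1 <;> omega

/-- Only clients that are still at home are moved, and a mover is no longer at home, so nobody moves
twice; hence the three cases of `asg_eq` are kept. By `hS` clients never have to come from the
fictitious parent `0` of a root. -/
theorem Exchanged.succ {asg₀ : ℕ → ℕ} {i : ℕ} (h : Exchanged n par x S own asg₀ i asg)
    (hi : i < n) (hpar : par (i + 1) < i + 1)
    (hS : par (i + 1) = 0 → S (i + 1) ≤ x (i + 1))
    (hmv : if S (i + 1) ≤ x (i + 1) then
        Moved n own asg asg' (i + 1) (par (i + 1)) (x (i + 1) - S (i + 1))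
      else Moved n own asg asg' (par (i + 1)) (i + 1) (S (i + 1) - x (i + 1))) :
    Exchanged n par x S own asg₀ (i + 1) asg' := by
  constructor
  · intro k h1 h2
    have hh := h.home k h1 h2
    rw [sum_children_succ _ hi]
    split_ifs at hmv with hc
    · have e1 := hmv.homeCard_src (by omega)
      have e2 := fun hk => hmv.homeCard_of_ne (k := k) hk
      by_cases hk : k = i + 1
      · subst hk
        rw [if_pos le_rfl, if_neg (by omega)]
        rw [if_neg (by omega)] at hh
        omega
      · have e2 := e2 hk
        have : (if k ≤ i + 1 then x k - S k else 0) = if k ≤ i then x k - S k else 0 :=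
          if_congr (by omega) rfl rfl
        rw [this]
        split_ifs at hh ⊢ <;> omega
    · have e1 := hmv.homeCard_src (by omega)
      have e2 := fun hk => hmv.homeCard_of_ne (k := k) hk
      by_cases hk : k = par (i + 1)
      · rw [if_pos hk.symm]
        rw [← hk] at e1
        have : (if k ≤ i + 1 then x k - S k else 0) = if k ≤ i then x k - S k else 0 :=
          if_congr (by omega) rfl rfl
        rw [this]
        omega
      · have e2 := e2 hk
        rw [if_neg (show ¬ par (i + 1) = k from fun h => hk h.symm)]
        by_cases hk' : k = i + 1
        · subst hk'
          rw [if_pos le_rfl]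
          rw [if_neg (by omega)] at hh
          omega
        · have : (if k ≤ i + 1 then x k - S k else 0) = if k ≤ i then x k - S k else 0 :=
            if_congr (by omega) rfl rfl
          rw [this]
          omega
  · intro k h1 h2
    have hh := h.count k h1 h2
    rw [sum_children_succ _ hi]
    have hi1 : (if k ≤ i + 1 then (x k : ℤ) - S k else 0) =
        (if k ≤ i then (x k : ℤ) - S k else 0) + if k = i + 1 then (x k : ℤ) - S k else 0 := by
      split_ifs <;> omega
    rw [hi1]
    split_ifs at hmv with hc
    · have e := hmv.fiberCard_eq (by omega) k
      rw [Nat.cast_sub hc] at e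
      by_cases hk : k = i + 1
      · subst hk
        rw [if_neg (show ¬ par (i + 1) = i + 1 by omega)]
        rw [if_pos rfl, if_neg (show ¬ i + 1 = par (i + 1) by omega)] at e
        rw [if_pos rfl]
        linarith
      · rw [if_neg hk] at e
        rw [if_neg hk]
        simp only [eq_comm (a := par (i + 1)) (b := k)]
        linarith
    · have e := hmv.fiberCard_eq (by omega) k
      rw [Nat.cast_sub (by omega)] at e
      by_cases hk : k = i + 1
      · subst hk
        rw [if_neg (show ¬ par (i + 1) = i + 1 by omega)]
        rw [if_pos rfl, if_neg (show ¬ i + 1 = par (i + 1) by omega)] at e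
        rw [if_pos rfl]
        linarith
      · rw [if_neg hk] at e
        rw [if_neg hk]
        simp only [eq_comm (a := par (i + 1)) (b := k)]
        rw [hh] at e
        split_ifs at e ⊢ <;> linarith
  · intro v hv
    split_ifs at hmv with hc
    · obtain ⟨M, hM, _, hasg⟩ := hmv.ex
      rw [hasg v hv]
      split_ifs with hm
      · have := (Finset.mem_filter.1 (hM hm)).2
        exact .inr (.inl ⟨by omega, by omega, by rw [this.1]⟩)
      · exact h.asg_eq v hv
    · obtain ⟨M, hM, _, hasg⟩ := hmv.ex
      rw [hasg v hv]
      split_ifs with hm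
      · have := (Finset.mem_filter.1 (hM hm)).2
        exact .inr (.inr ⟨by omega, by omega, fun h => by omega, this.1.symm⟩)
      · exact h.asg_eq v hv

/-- Conservation of clients: after all exchanges `k` has `cnt k - (x k - S k) + ∑ (x c - S c)`
clients, and the recursions for `x` and `S` turn this into `L * a k + e k`. -/
theorem Exchanged.fiberCard_eq {asg₀ : ℕ → ℕ} (h : Exchanged n par x S own asg₀ n asg)
    (B : Balanced n L U par top cnt a x e S)
    (hcnt : ∀ k, 1 ≤ k → k ≤ n → cnt k = fiberCard n asg₀ k) (k : ℕ) (h1 : 1 ≤ k) (h2 : k ≤ n) :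
    fiberCard n asg k = L * a k + e k := by
  have hc := h.count k h1 h2
  have hf : (children n par k).filter (· ≤ n) = children n par k :=
    Finset.filter_true_of_mem fun c hc => (mem_children.1 hc).1.2
  rw [hf, if_pos h2, Finset.sum_sub_distrib] at hc
  have hu := B.up k h1 h2
  have hs := B.sum_extra k h1 h2
  rw [hcnt k h1 h2] at hu
  zify at hu hs ⊢
  linarith

end Balance

/-! ### The program -/

namespace NExpr

/-- `1` if `e` is zero, otherwise `0` -/
def not (e : NExpr) : NExpr := .sub (.lit 1) e

/-- `1` if both `e` and `f` are nonzero, otherwise `0` -/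
def and (e f : NExpr) : NExpr := .sub (.lit 1) (.add e.not f.not)

/-- `1` if `e` and `f` are equal, otherwise `0` -/
def eq (e f : NExpr) : NExpr := .and (.le e f) (.le f e)

variable (d : ℕ → ℕ → ℝ≥0) (s : State)

@[simp] theorem eval_lit (c : ℕ) : (lit c).eval d s = c := rfl

@[simp] theorem eval_var (x : ℕ) : (var x).eval d s = s.var x := rfl

@[simp] theorem eval_get (a : ℕ) (i : NExpr) : (get a i).eval d s = s.arr a (i.eval d s) := rfl

@[simp] theorem eval_add (e f : NExpr) : (add e f).eval d s = e.eval d s + f.eval d s := rfl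

@[simp] theorem eval_sub (e f : NExpr) : (sub e f).eval d s = e.eval d s - f.eval d s := rfl

-- Tests only ask whether a value vanishes, so the simp lemmas for conditions describe when they
-- evaluate to `0` rather than their values.
@[simp] theorem eval_le (e f : NExpr) :
    (le e f).eval d s = 0 ↔ ¬ e.eval d s ≤ f.eval d s := by
  simp [eval]

@[simp] theorem eval_distLE (e f g h : NExpr) : (distLE e f g h).eval d s = 0 ↔
    ¬ d (e.eval d s) (f.eval d s) ≤ d (g.eval d s) (h.eval d s) := by
  simp [eval]

@[simp] theorem eval_not (e : NExpr) : (not e).eval d s = 0 ↔ e.eval d s ≠ 0 := by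
  simp [not, eval]
  omega

@[simp] theorem eval_and (e f : NExpr) :
    (and e f).eval d s = 0 ↔ ¬ (e.eval d s ≠ 0 ∧ f.eval d s ≠ 0) := by
  simp [and, not, eval]
  omega

@[simp] theorem eval_eq (e f : NExpr) : (eq e f).eval d s = 0 ↔ e.eval d s ≠ f.eval d s := by
  simp [eq]
  omega

end NExpr

namespace Loop

local infixr:60 " ;; " => Loop.seq
local notation "v[" x "]" => NExpr.var x
local infixl:65 " +' " => NExpr.add
local infixl:65 " -' " => NExpr.sub
local infix:50 " ≤' " => NExpr.le
local notation "c[" x "]" => NExpr.lit x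

/-- Count the `j` that satisfy `c` in the variable `acc`. -/
def count (acc j : ℕ) (c : NExpr) : Loop :=
  assign acc c[0] ;; forN j (ite c (assign acc (v[acc] +' c[1])) skip)

/-- Set `acc` to the value of `e` for the last `j` that satisfies `c`. -/
def find (acc j : ℕ) (c e : NExpr) : Loop :=
  assign acc c[0] ;; forN j (ite c (assign acc e) skip)

/-! The variables are

* `0`: `n`; `1`: `L`; `2`: `U`; `3`: `p`
* `4`, `5`: the points whose distance is the current radius
* `6`, `7`: loop counters; `10`: counter of rounds
* `8`, `11`, `13`, `14`, `15`: auxiliary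
* `9`: the number of net points
* `16`, `17`, `18`: source, target and number of clients of a move
* `19`: whether a solution has been found; `20`, `21`: the points whose distance is its radius
* `22`: the number of open centers

and the arrays are

* `0`: clients; `1`: facilities; `2`: good facilities
* `3`: the net point in whose ball a client lies
* `4`, `5`, `6`: net points that are reached in one, two, three steps
* `7`, `8`, `9`: facility, parent and root of a net point
* `10`: the assignment of the clients to the net points
* `11`, `12`, `13`: number of clients, number of clusters and remainder of a net point
* `14`: remaining budget of a root; `15`: sum of the extras in a subtree; `20`: extras
* `16`: number of the first center of a net point; `17`: number of the next center
* `18`, `19`: output -/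

/-- `v` is a client within the current radius of the good facility `u`. -/
def edge (v u : NExpr) : NExpr :=
  .and (.get 0 v) (.and (.get 2 u) (.distLE v u v[4] v[5]))

/-- Find the good facilities. -/
def good : Loop :=
  forN 6 (count 8 7 (.and (.get 0 v[7]) (.distLE v[7] v[6] v[4] v[5])) ;;
    ite (.and (.get 1 v[6]) (v[1] ≤' v[8])) (store 2 v[6] c[1]) (store 2 v[6] c[0]))

/-- Set entry `i` of `dst` to a nonzero entry `j` of `src` that satisfies `e`. -/
def spread (src dst : ℕ) (e : NExpr) : Loop :=
  forN 6 (find 8 7 (.and e (.get src v[7])) (.get src v[7]) ;; store dst v[6] v[8])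

/-- Empty net. -/
def initNet : Loop :=
  assign 9 c[0] ;; forN 6 (store 3 v[6] c[0] ;; store 8 (v[6] +' c[1]) c[0] ;;
    store 9 (v[6] +' c[1]) (v[6] +' c[1]))

/-- Compute the net points that are reached in one and two steps. -/
def reach : Loop := spread 3 4 (edge v[7] v[6]) ;; spread 4 5 (edge v[6] v[7])

/-- Find a new net point, preferably one that is linked to an old one. -/
def select : Loop :=
  -- Facilities are stored shifted by one, so that `0` means that none was found.
  find 8 6 (.and (.get 2 v[6]) (.not (.get 4 v[6]))) (v[6] +' c[1]) ;;
  find 11 6 (.and (.get 2 v[6]) (.and (.not (.get 4 v[6])) (.get 6 v[6]))) (v[6] +' c[1]) ;;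
  ite v[11] skip (assign 11 v[8])

/-- Add a new net point. -/
def extend : Loop :=
  assign 9 (v[9] +' c[1]) ;; assign 11 (v[11] -' c[1]) ;; store 7 v[9] v[11] ;;
  store 8 v[9] (.get 6 v[11]) ;;
  -- A new root keeps the initial entry, its own number.
  ite (.get 6 v[11]) (store 9 v[9] (.get 9 (.get 6 v[11]))) skip ;;
  forN 6 (ite (edge v[6] v[11]) (store 3 v[6] v[9]) skip)

/-- One round of the construction of the net. -/
def growRound : Loop :=
  reach ;; spread 5 6 (edge v[7] v[6]) ;; select ;; ite v[11] extend skip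

/-- Construct the net and assign the clients to it. -/
def net : Loop :=
  initNet ;; forN 10 growRound ;; reach ;;
  forN 6 (ite (.get 3 v[6]) (store 10 v[6] (.get 3 v[6])) (store 10 v[6] (.get 5 v[6])))

/-- Count the clients of each net point. -/
def sizes : Loop :=
  forN 6 (count 8 7 (.eq (.get 10 v[7]) (v[6] +' c[1])) ;; store 11 (v[6] +' c[1]) v[8])

/-- Divide the size of net point `15` by `L`. -/
def divide : Loop :=
  assign 13 c[0] ;; assign 14 (.get 11 v[15]) ;;
  forN 7 (ite (v[1] ≤' v[14]) (assign 14 (v[14] -' v[1]) ;; assign 13 (v[13] +' c[1])) skip)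

/-- Pass the remainders to the parents. -/
def passUp : Loop :=
  forN 6 (assign 15 (v[0] -' v[6]) ;; divide ;; store 12 v[15] v[13] ;; store 13 v[15] v[14] ;;
    store 14 v[15] v[14] ;;
    -- For a root this writes to entry `0`, which belongs to no net point.
    store 11 (.get 8 v[15]) (.get 11 (.get 8 v[15]) +' v[14]))

/-- The number of extras that net point `15` keeps. -/
def keep : Loop :=
  assign 8 c[0] ;;
  forN 7 (ite ((v[7] +' c[1]) ≤' .get 12 v[15]) (assign 8 (v[8] +' (v[2] -' v[1]))) skip) ;;
  ite (v[8] ≤' .get 14 (.get 9 v[15])) skip (assign 8 (.get 14 (.get 9 v[15])))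

/-- Distribute the remainders of the roots. -/
def distribute : Loop :=
  forN 6 (store 15 (v[6] +' c[1]) c[0]) ;;
  forN 6 (assign 15 (v[0] -' v[6]) ;; keep ;; store 20 v[15] v[8] ;;
    store 14 (.get 9 v[15]) (.get 14 (.get 9 v[15]) -' v[8]) ;;
    store 15 v[15] (.get 15 v[15] +' v[8]) ;;
    store 15 (.get 8 v[15]) (.get 15 (.get 8 v[15]) +' .get 15 v[15]))

/-- Move `18` clients from their home `16` to `17`. -/
def move : Loop :=
  forN 7 (ite (.and v[18] (.and (.eq (.get 3 v[7]) v[16]) (.eq (.get 10 v[7]) v[16])))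
    (store 10 v[7] v[17] ;; assign 18 (v[18] -' c[1])) skip)

/-- Exchange clients between the net points and their parents. -/
def exchange : Loop :=
  forN 6 (assign 15 (v[6] +' c[1]) ;;
    ite (.get 15 v[15] ≤' .get 13 v[15])
      (assign 16 v[15] ;; assign 17 (.get 8 v[15]) ;;
        assign 18 (.get 13 v[15] -' .get 15 v[15]))
      (assign 17 v[15] ;; assign 16 (.get 8 v[15]) ;;
        assign 18 (.get 15 v[15] -' .get 13 v[15])) ;;
    move)

/-- Open the centers. -/
def openCenters : Loop :=
  assign 22 c[0] ;;
  forN 6 (assign 15 (v[6] +' c[1]) ;; store 16 v[15] v[22] ;; store 17 v[15] c[0] ;;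
    forN 7 (ite ((v[7] +' c[1]) ≤' .get 12 v[15])
      (store 18 v[22] (.get 7 v[15]) ;; assign 22 (v[22] +' c[1])) skip))

/-- Assign the clients of each net point to its centers in turns. -/
def assignCenters : Loop :=
  forN 6 (assign 15 (.get 10 v[6]) ;;
    ite v[15] (store 17 v[15] (.get 17 v[15] +' c[1]) ;;
        -- The turn counter has already been increased, which yields the shift by one required of
        -- the output.
        store 19 v[6] (.get 16 v[15] +' .get 17 v[15]) ;;
        ite (.eq (.get 17 v[15]) (.get 12 v[15])) (store 17 v[15] c[0]) skip)
      (store 19 v[6] c[0]))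

/-- Save the solution if it serves enough clients and is the best one so far. -/
def save : Loop :=
  count 8 7 (.get 10 v[7]) ;;
  -- The negated conjunction expresses that nothing has been saved yet or that the current radius is
  -- no larger than the saved one.
  ite (.and (v[3] ≤' v[8]) (.not (.and v[19] (.not (.distLE v[4] v[5] v[20] v[21])))))
    (assign 19 c[1] ;; assign 20 v[4] ;; assign 21 v[5] ;; openCenters ;; assignCenters) skip

/-- Try the distance of `4` and `5` as the radius. -/
def attempt : Loop := good ;; net ;; sizes ;; passUp ;; distribute ;; exchange ;; save

/-- The algorithm; in the end variable `19` indicates whether there is a solution. -/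
def supplier : Loop :=
  ite v[3]
    (ite v[2]
      -- With lower bound `1` in place of `0` every opened center has a client, which also bounds
      -- the number of centers by `n`.
      (ite v[1] skip (assign 1 c[1]) ;; forN 4 (forN 5 attempt) ;;
        forN 6 (store 0 v[6] (.get 18 v[6]) ;; store 1 v[6] (.get 19 v[6])) ;;
        assign 1 v[22])
      skip)
    (forN 6 (store 1 v[6] c[0]) ;; assign 1 c[0] ;; assign 19 c[1])

theorem supplier_safe : supplier.Safe = true := rfl

theorem supplier_writesVar : supplier.writesVar 0 = false := rfl

/-! ### Specifications -/

variable {d : ℕ → ℕ → ℝ≥0}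

/-- Quantifying over `z` expresses that the condition does not depend on the accumulator, which
changes during the loop. -/
theorem run_count {acc j : ℕ} {c : NExpr} {s : State} (hne : acc ≠ j) (hacc : acc ≠ 0)
    (P : ℕ → Prop) [DecidablePred P]
    (h : ∀ k < s.var 0, ∀ z, c.eval d ((s.setVar acc z).setVar j k) ≠ 0 ↔ P k) :
    (count acc j c).run d s =
      (s.setVar acc ((Finset.range (s.var 0)).filter P).card).setVar j (s.var 0) := by
  have := forN_induction (d := d) (i := j) (A := ite c (assign acc (v[acc] +' c[1])) skip)
    (s := s.setVar acc 0)
    (fun k s' => s' = (s.setVar acc ((Finset.range k).filter P).card).setVar j k) (by simp) ?_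
  · rw [count, run_seq, run_assign, NExpr.eval_lit, this]
    simp [hacc.symm]
  · rintro k hk s' _ - rfl
    have hk' : k < s.var 0 := by simpa [hacc.symm] using hk
    rw [run_ite]
    simp only [h k hk', Finset.range_add_one, Finset.filter_insert]
    split_ifs with hP
    · rw [Finset.card_insert_of_notMem (by simp)]
      ext <;> simp
      grind
    · ext <;> simp
      grind

/-- Which match is returned is irrelevant for the algorithm, so only its existence is recorded. -/
theorem run_find {acc j : ℕ} {c e : NExpr} {s : State} (hacc : acc ≠ 0)
    (P : ℕ → Prop) (f : ℕ → ℕ)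
    (h : ∀ k < s.var 0, ∀ z, c.eval d ((s.setVar acc z).setVar j k) ≠ 0 ↔ P k)
    (hf : ∀ k < s.var 0, ∀ z, P k → e.eval d ((s.setVar acc z).setVar j k) = f k) :
    ∃ z, (find acc j c e).run d s = (s.setVar acc z).setVar j (s.var 0) ∧
      ((∃ k < s.var 0, P k ∧ z = f k) ∨ ((∀ k < s.var 0, ¬ P k) ∧ z = 0)) := by
  have := forN_induction (d := d) (i := j) (A := ite c (assign acc e) skip)
    (s := s.setVar acc 0)
    (fun m s' => ∃ z, s' = (s.setVar acc z).setVar j m ∧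
      ((∃ k < m, P k ∧ z = f k) ∨ ((∀ k < m, ¬ P k) ∧ z = 0))) ⟨0, by simp⟩ ?_
  · rw [find, run_seq, run_assign, NExpr.eval_lit]
    simpa [hacc.symm] using this
  · rintro m hm s' _ - ⟨z, rfl, hz⟩
    have hm' : m < s.var 0 := by simpa [hacc.symm] using hm
    rw [run_ite]
    split_ifs with hP <;> rw [h m hm' z] at hP
    · refine ⟨f m, ?_, .inl ⟨m, by omega, hP, rfl⟩⟩
      rw [run_assign, hf m hm' z hP]
      ext <;> simp
      grind
    · refine ⟨z, ?_, ?_⟩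
      · ext <;> simp
        grind
      · rcases hz with ⟨k, hk, h⟩ | ⟨h1, h2⟩
        · exact .inl ⟨k, by omega, h⟩
        · refine .inr ⟨fun k hk => ?_, h2⟩
          rcases Nat.lt_succ_iff_lt_or_eq.1 hk with h | rfl
          · exact h1 k h
          · exact hP

theorem spreads_spread {src dst : ℕ} {e : NExpr} {s : State} (hne : src ≠ dst)
    (R : ℕ → ℕ → Prop)
    (he : ∀ s', (spread src dst e).Frame s s' → s'.var 6 < s.var 0 → s'.var 7 < s.var 0 →
      (e.eval d s' ≠ 0 ↔ R (s'.var 7) (s'.var 6))) :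
    Spreads (s.var 0) R (s.arr src) (((spread src dst e).run d s).arr dst) := by
  have := forN_induction (d := d) (i := 6)
    (A := find 8 7 (.and e (.get src v[7])) (.get src v[7]) ;; store dst v[6] v[8]) (s := s)
    (fun m s' => ∀ u < m, (s'.arr dst u ≠ 0 → ∃ v < s.var 0, R v u ∧ s.arr src v = s'.arr dst u) ∧
      (s'.arr dst u = 0 → ∀ v < s.var 0, R v u → s.arr src v = 0)) (by simp) ?_
  · exact this
  · intro m hm s' hF h6 ih
    have hsrc : s'.arr src = s.arr src := hF.arr src (by simp [find, writesArr, hne])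
    have h0 : s'.var 0 = s.var 0 := hF.var 0 rfl
    have hfr : ∀ z k, (spread src dst e).Frame s ((s'.setVar 8 z).setVar 7 k) := by
      refine fun z k => ⟨fun x hx => ?_, fun a ha => hF.arr a ha⟩
      have := hF.var x hx
      simp [spread, find, writesVar] at hx
      simp [hx, this]
    obtain ⟨z, hz, hz'⟩ := run_find (d := d) (acc := 8) (j := 7) (c := .and e (.get src v[7]))
      (e := .get src v[7]) (s := s') (by norm_num) (fun k => R k m ∧ s.arr src k ≠ 0)
      (fun k => s.arr src k)
      (fun k hk z => by
        have := he _ (hfr z k) (by simpa [h6] using hm) (by simpa [h0] using hk)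
        simp only [State.setVar_var] at this
        simp [hsrc, h6] at this ⊢
        tauto) (fun k _ z _ => by simp [hsrc])
    rw [run_seq, hz]
    intro u hu
    simp only [run_store, NExpr.eval_var, State.setVar_var, State.setVar_arr, if_true,
      State.setArr_arr_apply, h6]
    simp only [show ¬ (6 = 7) by decide, show ¬ (6 = 8) by decide, show ¬ (8 = 7) by decide, if_false]
    by_cases hum : u = m
    · subst hum
      simp only [if_true]
      rw [h0] at hz'
      rcases hz' with ⟨k, hk, ⟨h1, h2⟩, rfl⟩ | ⟨h1, rfl⟩
      · exact ⟨fun _ => ⟨k, hk, h1, rfl⟩, fun h => absurd h h2⟩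
      · exact ⟨fun h => absurd rfl h, fun _ v hv hR => by simpa using fun h => h1 v hv ⟨hR, h⟩⟩
    · simp only [if_neg hum]
      exact ih u (by omega)

/-! ### The net -/

/-- In the state `s`, the relation `E` holds between the clients and the good facilities within
the current radius, and `G` holds for the good facilities. -/
structure Represents (d : ℕ → ℕ → ℝ≥0) (n : ℕ) (E : ℕ → ℕ → Prop) (G : ℕ → Prop) (s : State) :
    Prop where
  n_eq : s.var 0 = n
  lt : ∀ v u, E v u → v < n ∧ u < n
  good_lt : ∀ u, G u → u < n
  good_of : ∀ v u, E v u → G u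
  nonempty : ∀ u, G u → ∃ v, E v u
  edge_iff : ∀ v < n, ∀ u < n, E v u ↔
    s.arr 0 v ≠ 0 ∧ s.arr 2 u ≠ 0 ∧ d v u ≤ d (s.var 4) (s.var 5)
  good_iff : ∀ u < n, G u ↔ s.arr 2 u ≠ 0

variable {n : ℕ} {E : ℕ → ℕ → Prop} {G : ℕ → Prop} {s s' : State}

theorem Represents.frame {A : Loop} (h : Represents d n E G s) (hF : A.Frame s s')
    (hA : (A.writesVar 0 || A.writesVar 4 || A.writesVar 5 || A.writesArr 0 || A.writesArr 2) =
      false) : Represents d n E G s' := by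
  simp only [Bool.or_eq_false_iff] at hA
  obtain ⟨⟨⟨⟨h0, h4⟩, h5⟩, ha0⟩, ha2⟩ := hA
  obtain ⟨i1, i2, i3, i4, i5, i6, i7⟩ := h
  refine ⟨by rw [hF.var 0 h0, i1], i2, i3, i4, i5, ?_, ?_⟩
  · rw [hF.var 4 h4, hF.var 5 h5, hF.arr 0 ha0, hF.arr 2 ha2]
    exact i6
  · rw [hF.arr 2 ha2]
    exact i7

theorem Represents.run {A : Loop} (h : Represents d n E G s)
    (hA : (A.writesVar 0 || A.writesVar 4 || A.writesVar 5 || A.writesArr 0 || A.writesArr 2) =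
      false) : Represents d n E G (A.run d s) :=
  h.frame (frame_run A s) hA

theorem Represents.eval_edge (h : Represents d n E G s) {e f : NExpr} (he : e.eval d s < n)
    (hf : f.eval d s < n) : (edge e f).eval d s ≠ 0 ↔ E (e.eval d s) (f.eval d s) := by
  rw [h.edge_iff _ he _ hf]
  simp [edge]

theorem Represents.spread_in (h : Represents d n E G s) {src dst : ℕ} (hne : src ≠ dst)
    (h0 : dst ≠ 0) (h2 : dst ≠ 2) : Spreads n E (s.arr src)
      (((spread src dst (edge (.var 7) (.var 6))).run d s).arr dst) := by
  have := spreads_spread (d := d) (s := s) (e := edge (.var 7) (.var 6)) hne E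
    fun s' hF h6 h7 => by
      rw [h.n_eq] at h6 h7
      exact (h.frame hF (by simp [spread, find, writesVar, writesArr, h0.symm, h2.symm])).eval_edge
        (e := .var 7) (f := .var 6) h7 h6
  rwa [h.n_eq] at this

theorem Represents.spread_out (h : Represents d n E G s) {src dst : ℕ} (hne : src ≠ dst)
    (h0 : dst ≠ 0) (h2 : dst ≠ 2) : Spreads n (fun u v => E v u) (s.arr src)
      (((spread src dst (edge (.var 6) (.var 7))).run d s).arr dst) := by
  have := spreads_spread (d := d) (s := s) (e := edge (.var 6) (.var 7)) hne (fun u v => E v u)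
    fun s' hF h6 h7 => by
      rw [h.n_eq] at h6 h7
      exact (h.frame hF (by simp [spread, find, writesVar, writesArr, h0.symm, h2.symm])).eval_edge
        (e := .var 6) (f := .var 7) h6 h7
  rwa [h.n_eq] at this

theorem Represents.reach (h : Represents d n E G s) :
    Spreads n E (s.arr 3) ((reach.run d s).arr 4) ∧
      Spreads n (fun u v => E v u) ((reach.run d s).arr 4) ((reach.run d s).arr 5) := by
  have h1 := h.spread_in (src := 3) (dst := 4) (by decide) (by decide) (by decide)
  have h2 := (h.run (A := spread 3 4 (edge (.var 7) (.var 6))) rfl).spread_out (src := 4)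
    (dst := 5) (by decide) (by decide) (by decide)
  have e : (Loop.reach.run d s).arr 4 = ((spread 3 4 (edge (.var 7) (.var 6))).run d s).arr 4 :=
    (frame_run (spread 4 5 (edge (.var 6) (.var 7))) _).arr 4 rfl
  rw [e]
  exact ⟨h1, h2⟩

/-- The last clause is the priority of linked candidates: an unlinked facility is chosen only if no
uncovered good facility is linked, as `Forest.grow` demands in `hc0`. -/
theorem run_select (hn : ∀ u < s.var 0, G u ↔ s.arr 2 u ≠ 0) (h2 : ∀ u, G u → u < s.var 0) :
    ((select.run d s).var 11 = 0 → ∀ u, G u → s.arr 4 u ≠ 0) ∧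
    ((select.run d s).var 11 ≠ 0 → G ((select.run d s).var 11 - 1) ∧
      s.arr 4 ((select.run d s).var 11 - 1) = 0 ∧
      (s.arr 6 ((select.run d s).var 11 - 1) = 0 → ∀ u, G u → s.arr 4 u = 0 → s.arr 6 u = 0)) := by
  obtain ⟨z, hz, hz'⟩ := run_find (d := d) (acc := 8) (j := 6)
    (c := .and (.get 2 (.var 6)) (.not (.get 4 (.var 6)))) (e := .add (.var 6) (.lit 1)) (s := s)
    (by decide) (fun u => G u ∧ s.arr 4 u = 0) (fun u => u + 1)
    (fun k hk z => by simp [hn k hk]) (fun k hk z _ => by simp)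
  obtain ⟨y, hy, hy'⟩ := run_find (d := d) (acc := 11) (j := 6)
    (c := .and (.get 2 (.var 6)) (.and (.not (.get 4 (.var 6))) (.get 6 (.var 6))))
    (e := .add (.var 6) (.lit 1)) (s := (s.setVar 8 z).setVar 6 (s.var 0))
    (by decide) (fun u => G u ∧ s.arr 4 u = 0 ∧ s.arr 6 u ≠ 0) (fun u => u + 1)
    (fun k hk z => by
      have hk : k < s.var 0 := by simpa using hk
      simp [hn k hk]) (fun k hk z _ => by simp)
  have e : (select.run d s).var 11 = if y = 0 then z else y := by
    simp only [select, run_seq, hz, hy, run_ite]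
    split_ifs with h1 h2 h2 <;> simp_all
  have h0 : ((s.setVar 8 z).setVar 6 (s.var 0)).var 0 = s.var 0 := by simp
  rw [e]
  rw [h0] at hy'
  rcases hy' with ⟨k, hk, ⟨h1, h3, h4⟩, rfl⟩ | ⟨h1, rfl⟩
  · simp [h1, h3, h4]
  · simp only [if_true]
    rcases hz' with ⟨k, hk, ⟨h3, h4⟩, rfl⟩ | ⟨h3, rfl⟩
    · refine ⟨by simp, fun _ => ⟨by simpa using h3, by simpa using h4, fun _ u hu h5 => ?_⟩⟩
      by_contra h6
      exact h1 u (h2 u hu) ⟨hu, h5, h6⟩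
    · exact ⟨fun _ u hu h => h3 u (h2 u hu) ⟨hu, h⟩, fun h => absurd rfl h⟩

theorem Represents.run_extend (h : Represents d n E G s) (hlt : s.var 11 - 1 < n) :
    (extend.run d s).var 9 = s.var 9 + 1 ∧
      (∀ k, (extend.run d s).arr 7 k =
        if k = s.var 9 + 1 then s.var 11 - 1 else s.arr 7 k) ∧
      (∀ k, (extend.run d s).arr 8 k =
        if k = s.var 9 + 1 then s.arr 6 (s.var 11 - 1) else s.arr 8 k) ∧
      (∀ k, (extend.run d s).arr 9 k =
        if k = s.var 9 + 1 ∧ s.arr 6 (s.var 11 - 1) ≠ 0 then s.arr 9 (s.arr 6 (s.var 11 - 1))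
        else s.arr 9 k) ∧
      (∀ v, E v (s.var 11 - 1) → (extend.run d s).arr 3 v = s.var 9 + 1) ∧
      (∀ v, ¬ E v (s.var 11 - 1) → (extend.run d s).arr 3 v = s.arr 3 v) := by
  obtain ⟨s', hs₀⟩ : ∃ s', s' = extend.run d s := ⟨_, rfl⟩
  obtain ⟨K, hK⟩ : ∃ K, K = s.var 9 := ⟨_, rfl⟩
  obtain ⟨u, hu⟩ : ∃ u, u = s.var 11 - 1 := ⟨_, rfl⟩
  obtain ⟨c, hc⟩ : ∃ c, c = s.arr 6 u := ⟨_, rfl⟩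
  rw [← hs₀, ← hK, ← hu, ← hc]
  rw [← hu] at hlt
  obtain ⟨B, hB⟩ : ∃ B, B = forN 6
      (ite (edge (.var 6) (.var 11)) (store 3 (.var 6) (.var 9)) skip) := ⟨_, rfl⟩
  obtain ⟨s₁, hs₁, hs'⟩ : ∃ s₁, s₁ = (if c ≠ 0 then
      (((((s.setVar 9 (K + 1)).setVar 11 u).setArr 7 (K + 1) u).setArr 8 (K + 1) c).setArr 9
        (K + 1) (s.arr 9 c)) else
      ((((s.setVar 9 (K + 1)).setVar 11 u).setArr 7 (K + 1) u).setArr 8 (K + 1) c)) ∧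
      s' = B.run d s₁ := by
    refine ⟨_, rfl, ?_⟩
    simp only [hs₀, extend, run_seq, hB]
    congr 1
    simp [hK, hu, hc]
  have hv : ∀ x, s₁.var x = if x = 11 then u else if x = 9 then K + 1 else s.var x := by
    intro x
    rw [hs₁]
    split_ifs <;> simp_all
  have ha : ∀ b i, b ≠ 7 → b ≠ 8 → b ≠ 9 → s₁.arr b i = s.arr b i := by
    intro b i h7 h8 h9
    rw [hs₁]
    split_ifs <;> simp [h7, h8, h9]
  have hF := frame_run (d := d) B s₁
  rw [← hs'] at hF
  have hR : Represents d n E G s₁ := by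
    obtain ⟨i1, i2, i3, i4, i5, i6, i7⟩ := h
    refine ⟨by simp [hv, i1], i2, i3, i4, i5, ?_, ?_⟩
    · simpa [hv, ha] using i6
    · simpa [ha] using i7
  have hown := forN_induction (d := d) (i := 6) (s := s₁)
    (A := ite (edge (.var 6) (.var 11)) (store 3 (.var 6) (.var 9)) skip)
    (fun m s₂ => ∀ v, (E v u ∧ v < m → s₂.arr 3 v = K + 1) ∧
      (¬ (E v u ∧ v < m) → s₂.arr 3 v = s.arr 3 v))
    (by intro v; simp [ha]) (by
      intro m hm s₂ hF₂ h6 ih v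
      have h11 : s₂.var 11 = u := by rw [hF₂.var 11 rfl, hv]; simp
      have h9 : s₂.var 9 = K + 1 := by rw [hF₂.var 9 rfl, hv]; simp
      have he := (hR.frame hF₂ rfl).eval_edge (e := .var 6) (f := .var 11)
        (by rw [NExpr.eval_var, h6]; rwa [hR.n_eq] at hm) (by rw [NExpr.eval_var, h11]; exact hlt)
      rw [NExpr.eval_var, NExpr.eval_var, h6, h11] at he
      have ih := ih v
      rw [run_ite]
      split_ifs with hc <;> rw [he] at hc
      · by_cases hvm : v = m
        · subst hvm
          simp [h6, h9, hc]
        · have : v < m + 1 ↔ v < m := by omega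
          simpa [h6, hvm, this] using ih
      · by_cases hvm : v = m
        · subst hvm
          simpa [hc] using ih
        · have : v < m + 1 ↔ v < m := by omega
          simpa [this] using ih)
  rw [hR.n_eq, ← hB, ← hs'] at hown
  refine ⟨?_, ?_, ?_, ?_, fun v hv => (hown v).1 ⟨hv, (h.lt v u hv).1⟩,
    fun v hv => (hown v).2 fun h => hv h.1⟩
  · rw [hF.var 9 (by rw [hB]; rfl), hv]
    simp
  · intro k
    rw [hF.arr 7 (by rw [hB]; rfl), hs₁]
    split_ifs <;> simp_all
  · intro k
    rw [hF.arr 8 (by rw [hB]; rfl), hs₁]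
    split_ifs <;> simp_all
  · intro k
    rw [hF.arr 9 (by rw [hB]; rfl), hs₁]
    split_ifs <;> simp_all

/-- The arrays `7`, `8`, `9`, `3` contain a net. -/
def HasForest (n : ℕ) (E : ℕ → ℕ → Prop) (G : ℕ → Prop) (s : State) : Prop :=
  Forest n E G (s.var 9) (s.arr 7) (s.arr 8) (s.arr 9) (s.arr 3)

theorem HasForest.frame {A : Loop} (h : HasForest n E G s) (hF : A.Frame s s')
    (hA : (A.writesVar 9 || A.writesArr 7 || A.writesArr 8 || A.writesArr 9 || A.writesArr 3) =
      false) : HasForest n E G s' := by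
  simp only [Bool.or_eq_false_iff] at hA
  obtain ⟨⟨⟨⟨h0, h4⟩, h5⟩, ha0⟩, ha2⟩ := hA
  rw [HasForest, hF.var 9 h0, hF.arr 7 h4, hF.arr 8 h5, hF.arr 9 ha0, hF.arr 3 ha2]
  exact h

/-- Either a net point is added or nothing is left to cover. `hK` guarantees that the number of a
new net point is at most `n`, the range in which the arrays are initialized. -/
theorem Represents.run_growRound (h : Represents d n E G s) (F : HasForest n E G s)
    (hK : s.var 9 < n ∨ ∀ u, G u → ∃ k, Touches E (s.arr 3) u k) :
    HasForest n E G (growRound.run d s) ∧ ((growRound.run d s).var 9 = s.var 9 + 1 ∧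
      (¬ ∀ u, G u → ∃ k, Touches E (s.arr 3) u k) ∨
      ∀ u, G u → ∃ k, Touches E ((growRound.run d s).arr 3) u k) := by
  obtain ⟨h₁, h₂⟩ := h.reach
  obtain ⟨s₁, hs₁⟩ : ∃ s₁, s₁ = Loop.reach.run d s := ⟨_, rfl⟩
  have hR₁ := h.run (A := Loop.reach) rfl
  have hF₁ := frame_run (d := d) Loop.reach s
  rw [← hs₁] at h₁ h₂ hR₁ hF₁
  have h₃ := hR₁.spread_in (src := 5) (dst := 6) (by decide) (by decide) (by decide)
  obtain ⟨s₂, hs₂⟩ : ∃ s₂, s₂ = (spread 5 6 (edge (.var 7) (.var 6))).run d s₁ := ⟨_, rfl⟩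
  have hR₂ := hR₁.run (A := spread 5 6 (edge (.var 7) (.var 6))) rfl
  have hF₂ := frame_run (d := d) (spread 5 6 (edge (.var 7) (.var 6))) s₁
  rw [← hs₂] at h₃ hR₂ hF₂
  rw [← hF₂.arr 4 rfl] at h₁ h₂
  have hsel := run_select (d := d) (G := G) (s := s₂) (by rw [hR₂.n_eq]; exact hR₂.good_iff)
    (by rw [hR₂.n_eq]; exact hR₂.good_lt)
  obtain ⟨s₃, hs₃⟩ : ∃ s₃, s₃ = select.run d s₂ := ⟨_, rfl⟩
  have hR₃ := hR₂.run (A := select) rfl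
  have hF₃ := frame_run (d := d) select s₂
  rw [← hs₃] at hsel hR₃ hF₃
  have hrun : growRound.run d s = if s₃.var 11 ≠ 0 then extend.run d s₃ else s₃ := by
    simp only [growRound, run_seq, ← hs₁, ← hs₂, ← hs₃, run_ite, NExpr.eval_var, run_skip]
    exact if_congr Iff.rfl rfl rfl
  have F₃ : HasForest n E G s₃ := ((F.frame hF₁ rfl).frame hF₂ rfl).frame hF₃ rfl
  have e3 : s₃.arr 3 = s.arr 3 := by rw [hF₃.arr 3 rfl, hF₂.arr 3 rfl, hF₁.arr 3 rfl]
  have e9 : s₃.var 9 = s.var 9 := by rw [hF₃.var 9 rfl, hF₂.var 9 rfl, hF₁.var 9 rfl]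
  have e6 : s₃.arr 6 = s₂.arr 6 := hF₃.arr 6 rfl
  rw [hrun]
  split_ifs with h11
  · obtain ⟨hG, h4, h6⟩ := hsel.2 h11
    have hlt := h.good_lt _ hG
    have hfree := h₁.not_touches h.lt hlt h4
    have hKn : s.var 9 < n := by
      rcases hK with h | h
      · exact h
      · obtain ⟨k, hk⟩ := h _ hG
        exact absurd hk (hfree k)
    obtain ⟨i1, i2, i3, i4, i5, i6⟩ := hR₃.run_extend hlt
    generalize extend.run d s₃ = s₄ at *
    rw [HasForest, i1]
    have hle := (F₃.K_le h.lt h.nonempty)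
    refine ⟨F₃.grow (u₀ := s₃.var 11 - 1) (c := s₃.arr 6 (s₃.var 11 - 1)) h.lt h.good_of hG
      (by rw [e3]; exact hfree) ?_ ?_ ?_ ?_ ?_ ?_ ?_ ?_ i5 (fun v _ => i6 v), .inl ⟨by rw [e9], fun h => ?_⟩⟩
    · intro h0
      rw [e6] at h0 ⊢
      rw [e3]
      exact h₁.linked h₂ h₃ hlt h0
    · intro h0 u k hu hf
      rw [e6] at h0
      rw [e3] at hf ⊢
      have hun := h.good_lt u hu
      have h4u : s₂.arr 4 u = 0 := by
        by_contra hne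
        exact hf _ (h₁.touches hun hne)
      exact h₁.not_linked h.lt h₂ h₃ hun (h6 h0 u hu h4u) k
    · intro k hk
      rw [i2, if_neg (by omega)]
    · rw [i2, if_pos rfl]
    · intro k hk
      rw [i3, if_neg hk]
    · rw [i3, if_pos rfl]
    · intro k hk
      simp [i4, hk]
    · rw [i4]
      -- The slot of the new point was a tree with one vertex, so without a parent its root entry is
      -- already correct.
      have := F₃.top_root (s₃.var 9 + 1) (by omega) (by omega)
        (F₃.par_of_gt _ (by omega) (by omega))
      by_cases h0 : s₃.arr 6 (s₃.var 11 - 1) = 0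
      · rw [if_neg fun h => h.2 h0, if_pos h0, this]
      · rw [if_pos ⟨rfl, h0⟩, if_neg h0]
    · obtain ⟨k, hk⟩ := h _ hG
      exact hfree k hk
  · rw [not_not] at h11
    refine ⟨F₃, .inr fun u hu => ?_⟩
    rw [e3]
    exact ⟨_, h₁.touches (h.good_lt u hu) (hsel.1 h11 u hu)⟩

theorem Represents.run_initNet (h : Represents d n E G s) :
    HasForest n E G (initNet.run d s) := by
  have h9 : (initNet.run d s).var 9 = 0 := by
    rw [initNet, run_seq, (frame_run (forN 6 _) _).var 9 rfl]
    simp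
  have := forN_induction (d := d) (i := 6) (s := s.setVar 9 0)
    (A := seq (store 3 (.var 6) (.lit 0)) (seq (store 8 (.add (.var 6) (.lit 1)) (.lit 0))
    (store 9 (.add (.var 6) (.lit 1)) (.add (.var 6) (.lit 1)))))
    (fun m s' => ∀ i < m, s'.arr 3 i = 0 ∧ s'.arr 8 (i + 1) = 0 ∧ s'.arr 9 (i + 1) = i + 1)
    (by simp) (by
      intro m hm s₂ hF h6 ih i hi
      rcases Nat.lt_succ_iff_lt_or_eq.1 hi with hi | rfl
      · have := ih i hi
        simp [h6, hi.ne, this]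
      · simp [h6])
  have h0 : (s.setVar 9 0).var 0 = n := by simp [h.n_eq]
  rw [h0] at this
  rw [HasForest, h9]
  refine Forest.init ?_ ?_ h.lt fun v hv => (this v hv).1
  · intro k h1 h2
    obtain ⟨i, rfl⟩ := Nat.exists_eq_add_of_le' h1
    exact (this i h2).2.2
  · intro k h1 h2
    obtain ⟨i, rfl⟩ := Nat.exists_eq_add_of_le' h1
    exact (this i h2).2.1

/-- After the construction of the net, every client near a good facility is assigned to a nearby
net point. -/
theorem Represents.run_net (h : Represents d n E G s) :
    HasForest n E G (net.run d s) ∧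
      (∀ v < n, (net.run d s).arr 3 v ≠ 0 → (net.run d s).arr 10 v = (net.run d s).arr 3 v) ∧
      ∀ v < n, ((net.run d s).arr 10 v ≠ 0 → ∃ u, E v u ∧
        Touches E ((net.run d s).arr 3) u ((net.run d s).arr 10 v)) ∧
      (∀ u, E v u → (net.run d s).arr 10 v ≠ 0 ∧ ∃ k, Touches E ((net.run d s).arr 3) u k ∧
        (net.run d s).arr 9 ((net.run d s).arr 10 v) = (net.run d s).arr 9 k ∧
        ∀ k', Touches E ((net.run d s).arr 3) u k' →
          (net.run d s).arr 9 k' = (net.run d s).arr 9 k) := by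
  obtain ⟨s₁, hs₁⟩ : ∃ s₁, s₁ = initNet.run d s := ⟨_, rfl⟩
  have F₁ := h.run_initNet
  have hR₁ := h.run (A := initNet) rfl
  have h9₁ : (initNet.run d s).var 9 = 0 := by
    rw [initNet, run_seq, (frame_run (forN 6 _) _).var 9 rfl]
    simp
  rw [← hs₁] at F₁ hR₁ h9₁
  obtain ⟨s₂, hs₂⟩ : ∃ s₂, s₂ = (forN 10 growRound).run d s₁ := ⟨_, rfl⟩
  have hR₂ := hR₁.run (A := forN 10 growRound) rfl
  -- After `m` rounds there are `m` net points, unless every good facility is covered. At `m = n`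
  -- the first alternative implies the second by counting.
  have hgrow := forN_induction (d := d) (i := 10) (A := growRound) (s := s₁)
    (fun m s' => HasForest n E G s' ∧ (s'.var 9 = m ∨ ∀ u, G u → ∃ k, Touches E (s'.arr 3) u k))
    ⟨F₁, .inl (by simpa using h9₁)⟩ (by
      intro m hm s' hF h10 ⟨ih₁, ih₂⟩
      rw [hR₁.n_eq] at hm
      have := (hR₁.frame hF rfl).run_growRound ih₁ (ih₂.imp_left fun e => by rwa [e])
      refine ⟨this.1, ?_⟩
      rcases this.2 with ⟨e, hne⟩ | hall
      · exact .inl (by simpa [e] using ih₂.resolve_right hne)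
      · exact .inr hall)
  rw [hR₁.n_eq, ← hs₂] at hgrow
  rw [← hs₂] at hR₂
  obtain ⟨F₂, hall⟩ := hgrow
  have hall : ∀ u, G u → ∃ k, Touches E (s₂.arr 3) u k := by
    rcases hall with e | hall
    · rw [HasForest, e] at F₂
      exact fun u hu => F₂.touches_of_eq h.lt h.nonempty hu
    · exact hall
  obtain ⟨h₁, h₂⟩ := hR₂.reach
  obtain ⟨s₃, hs₃⟩ : ∃ s₃, s₃ = Loop.reach.run d s₂ := ⟨_, rfl⟩
  have hR₃ := hR₂.run (A := Loop.reach) rfl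
  have hF₃ := frame_run (d := d) Loop.reach s₂
  rw [← hs₃] at h₁ h₂ hR₃ hF₃
  obtain ⟨s₄, hs₄⟩ : ∃ s₄, s₄ = net.run d s := ⟨_, rfl⟩
  have hasg := forN_induction (d := d) (i := 6) (s := s₃)
    (A := ite (.get 3 (.var 6)) (store 10 (.var 6) (.get 3 (.var 6)))
      (store 10 (.var 6) (.get 5 (.var 6))))
    (fun m s' => ∀ v < m, s'.arr 10 v = if s₃.arr 3 v ≠ 0 then s₃.arr 3 v else s₃.arr 5 v)
    (by simp) (by
      intro m hm s' hF h6 ih v hv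
      have e3 : s'.arr 3 = s₃.arr 3 := hF.arr 3 rfl
      have e5 : s'.arr 5 = s₃.arr 5 := hF.arr 5 rfl
      rcases Nat.lt_succ_iff_lt_or_eq.1 hv with hv | rfl
      · rw [← ih v hv, run_ite]
        split_ifs <;> simp [h6, hv.ne]
      · rw [run_ite]
        simp only [NExpr.eval_get, NExpr.eval_var, e3, h6]
        split_ifs <;> simp [h6, e3, e5])
  have hF₄ := frame_run (d := d) (forN 6 (ite (.get 3 (.var 6)) (store 10 (.var 6)
    (.get 3 (.var 6))) (store 10 (.var 6) (.get 5 (.var 6))))) s₃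
  have e : (forN 6 (ite (.get 3 (.var 6)) (store 10 (.var 6)
    (.get 3 (.var 6))) (store 10 (.var 6) (.get 5 (.var 6))))).run d s₃ = s₄ := by
    simp only [hs₄, net, run_seq, ← hs₁, ← hs₂, ← hs₃]
  rw [hR₃.n_eq, e] at hasg
  rw [e] at hF₄
  rw [← hs₄]
  have F₄ : HasForest n E G s₄ := (F₂.frame hF₃ rfl).frame hF₄ rfl
  have e3 : s₃.arr 3 = s₂.arr 3 := hF₃.arr 3 rfl
  have e3' : s₄.arr 3 = s₃.arr 3 := hF₄.arr 3 rfl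
  rw [← e3] at h₁ hall
  rw [← e3'] at h₁ hall hasg
  refine ⟨F₄, fun v hv h0 => by rw [hasg v hv, if_pos h0], fun v hv => ?_⟩
  have := F₄.exists_top h.lt h.good_of hall h₁ h₂ hasg hv
  refine ⟨this.1, fun u hu => ⟨(this.2 u hu).1, ?_⟩⟩
  obtain ⟨k, hk⟩ := hall u (h.good_of _ _ hu)
  exact ⟨k, hk, (this.2 u hu).2 k hk, fun k' hk' =>
    ((this.2 u hu).2 k' hk').symm.trans ((this.2 u hu).2 k hk)⟩

/-! ### The balancing -/

theorem run_sizes (hn : s.var 0 = n) (k : ℕ) (h1 : 1 ≤ k) (h2 : k ≤ n) :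
    (sizes.run d s).arr 11 k = fiberCard n (s.arr 10) k := by
  have := forN_induction (d := d) (i := 6) (s := s)
    (A := seq (count 8 7 (.eq (.get 10 (.var 7)) (.add (.var 6) (.lit 1))))
      (store 11 (.add (.var 6) (.lit 1)) (.var 8)))
    (fun m s' => ∀ k < m, s'.arr 11 (k + 1) = fiberCard n (s.arr 10) (k + 1)) (by simp) (by
      intro m hm s' hF h6 ih k hk
      have h0 : s'.var 0 = n := by rw [hF.var 0 rfl, hn]
      have h10 : s'.arr 10 = s.arr 10 := hF.arr 10 rfl
      rw [run_seq, run_count (by decide) (by decide) (fun v => s.arr 10 v = m + 1)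
        (fun k _ z => by simp [h6, h10]), h0]
      rcases Nat.lt_succ_iff_lt_or_eq.1 hk with hk | rfl
      · simp [h6, hk.ne, ih k hk]
      · simp [h6, fiberCard])
  rw [hn] at this
  obtain ⟨i, rfl⟩ := Nat.exists_eq_add_of_le' h1
  exact this i h2

/-- Division by repeated subtraction. Every round so far has subtracted unless the remainder is
already below `L`; as `L ≥ 1`, `n ≥ A` rounds are enough. -/
theorem run_divide {A : ℕ} (hA : s.arr 11 (s.var 15) = A) (hn : A ≤ s.var 0) (hL : 1 ≤ s.var 1) :
    s.var 1 * (divide.run d s).var 13 + (divide.run d s).var 14 = A ∧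
      (divide.run d s).var 14 < s.var 1 := by
  have := forN_induction (d := d) (i := 7) (s := (s.setVar 13 0).setVar 14 A)
    (A := ite (.le (.var 1) (.var 14)) (seq (assign 14 (.sub (.var 14) (.var 1)))
      (assign 13 (.add (.var 13) (.lit 1)))) skip)
    (fun m s' => s.var 1 * s'.var 13 + s'.var 14 = A ∧ (s'.var 14 < s.var 1 ∨ s'.var 13 = m))
    (by simp) (by
      intro m hm s' hF h7 ⟨ih₁, ih₂⟩
      have h1 : s'.var 1 = s.var 1 := by rw [hF.var 1 rfl]; simp
      rw [run_ite]
      simp only [Ne, NExpr.eval_le, not_not, NExpr.eval_var, h1]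
      split_ifs with h
      · have : s'.var 13 = m := by omega
        simp [h1, this] at ih₁ ⊢
        rw [mul_add]
        omega
      · simp only [run_skip, State.setVar_var]
        simp
        omega)
  have h0 : ((s.setVar 13 0).setVar 14 A).var 0 = s.var 0 := by simp
  have e : divide.run d s = (forN 7 (ite (.le (.var 1) (.var 14))
      (seq (assign 14 (.sub (.var 14) (.var 1)))
      (assign 13 (.add (.var 13) (.lit 1)))) skip)).run d ((s.setVar 13 0).setVar 14 A) := by
    simp only [divide, run_seq]
    congr 1
    simp [hA]
  rw [h0, ← e] at this
  refine ⟨this.1, ?_⟩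
  rcases this.2 with h | h
  · exact h
  · rw [h] at this
    have : s.var 0 ≤ s.var 1 * s.var 0 := Nat.le_mul_of_pos_left _ hL
    omega

/-- Meant for loops that run through the net points in decreasing order: the children beyond `i` are
those already processed. -/
theorem sum_children_pred {par : ℕ → ℕ} (f : ℕ → ℕ) {i : ℕ} (hi : i < n) (k : ℕ) :
    ∑ c ∈ (children n par k).filter (i < ·), f c =
      (if par (i + 1) = k then f (i + 1) else 0) +
        ∑ c ∈ (children n par k).filter (i + 1 < ·), f c := by
  split_ifs with h
  · rw [← Finset.sum_insert]
    · congr 1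
      ext c
      simp only [Finset.mem_filter, mem_children, Finset.mem_insert]
      constructor
      · rintro ⟨⟨h1, h2⟩, h3⟩
        by_cases hc : c = i + 1
        · exact .inl hc
        · exact .inr ⟨⟨h1, h2⟩, by omega⟩
      · rintro (rfl | ⟨⟨h1, h2⟩, h3⟩)
        · exact ⟨⟨by omega, h⟩, by omega⟩
        · exact ⟨⟨h1, h2⟩, by omega⟩
    · simp
  · rw [zero_add]
    congr 1
    refine Finset.filter_congr fun c hc => ?_
    rw [mem_children] at hc
    have : c ≠ i + 1 := by
      rintro rfl
      exact h hc.2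
    omega

theorem children_filter_lt {par : ℕ → ℕ} (hpar : ∀ k, 1 ≤ k → k ≤ n → par k < k) (k : ℕ) :
    (children n par k).filter (k < ·) = children n par k := by
  refine Finset.filter_true_of_mem fun c hc => ?_
  rw [mem_children] at hc
  have := hpar c hc.1.1 hc.1.2
  omega

theorem children_filter_eq_empty {par : ℕ → ℕ} (k : ℕ) :
    (children n par k).filter (n < ·) = ∅ := by
  ext c
  simp only [Finset.mem_filter, mem_children, Finset.notMem_empty, iff_false]
  omega

theorem run_passUp (hn : s.var 0 = n) (hL : 1 ≤ s.var 1)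
    (hpar : ∀ k, 1 ≤ k → k ≤ n → s.arr 8 k < k) (hcnt : ∑ k ∈ Finset.Icc 1 n, s.arr 11 k ≤ n) :
    ∀ k, 1 ≤ k → k ≤ n → (passUp.run d s).arr 13 k < s.var 1 ∧
      s.var 1 * (passUp.run d s).arr 12 k + (passUp.run d s).arr 13 k =
        s.arr 11 k + ∑ c ∈ children n (s.arr 8) k, (passUp.run d s).arr 13 c ∧
      (passUp.run d s).arr 12 k ≤ n ∧ (passUp.run d s).arr 14 k = (passUp.run d s).arr 13 k := by
  -- Decreasing order puts children before parents. The bound on the sum persists, as a remainder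
  -- only moves to a smaller index; it ensures that `n` rounds suffice for each division.
  have := forN_induction (d := d) (i := 6) (s := s)
    (A := seq (assign 15 (.sub (.var 0) (.var 6))) <| seq divide <|
      seq (store 12 (.var 15) (.var 13)) <| seq (store 13 (.var 15) (.var 14)) <|
      seq (store 14 (.var 15) (.var 14))
      (store 11 (.get 8 (.var 15)) (.add (.get 11 (.get 8 (.var 15))) (.var 14))))
    (fun m s' => ∀ i, i + m = n → (∀ k, i < k → k ≤ n → s'.arr 13 k < s.var 1 ∧
      s.var 1 * s'.arr 12 k + s'.arr 13 k =
        s.arr 11 k + ∑ c ∈ children n (s.arr 8) k, s'.arr 13 c ∧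
      s'.arr 12 k ≤ n ∧ s'.arr 14 k = s'.arr 13 k) ∧
      (∀ k, 1 ≤ k → k ≤ i → s'.arr 11 k =
        s.arr 11 k + ∑ c ∈ (children n (s.arr 8) k).filter (i < ·), s'.arr 13 c) ∧
      ∑ k ∈ Finset.Icc 1 i, s'.arr 11 k ≤ n) ?_ ?_
  · rw [hn] at this
    intro k h1 h2
    exact (this 0 (by omega)).1 k h1 h2
  · intro i hi
    obtain rfl : i = n := by omega
    refine ⟨fun k h1 h2 => by omega, fun k h1 h2 => ?_, by simpa using hcnt⟩
    rw [children_filter_eq_empty]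
    simp
  · intro m hm s' hF h6 ih i hi
    obtain ⟨ih₁, ih₂, ih₃⟩ := ih (i + 1) (by omega)
    have h0 : s'.var 0 = n := by rw [hF.var 0 rfl, hn]
    have h1 : s'.var 1 = s.var 1 := hF.var 1 rfl
    have h8 : s'.arr 8 = s.arr 8 := hF.arr 8 rfl
    have h15 : n - m = i + 1 := by omega
    rw [Finset.sum_Icc_succ_top (by omega)] at ih₃
    have hdiv := run_divide (d := d) (s := s'.setVar 15 (i + 1)) (A := s'.arr 11 (i + 1))
      (by simp) (by simp [h0]; omega) (by simpa [h1] using hL)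
    have hFd := frame_run (d := d) divide (s'.setVar 15 (i + 1))
    obtain ⟨s₂, hs₂⟩ : ∃ s₂, s₂ = divide.run d (s'.setVar 15 (i + 1)) := ⟨_, rfl⟩
    rw [← hs₂] at hdiv hFd
    simp only [State.setVar_var, show ¬ (1 = 15) by decide, if_false, h1] at hdiv
    obtain ⟨hq, hr⟩ := hdiv
    have e15 : s₂.var 15 = i + 1 := by rw [hFd.var 15 rfl]; simp
    have earr : ∀ b, s₂.arr b = s'.arr b := fun b => hFd.arr b rfl
    have hpi := hpar (i + 1) (by omega) (by omega)
    obtain ⟨s₃, hs₃⟩ : ∃ s₃, s₃ = ((((s₂.setArr 12 (i + 1) (s₂.var 13)).setArr 13 (i + 1)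
      (s₂.var 14)).setArr 14 (i + 1) (s₂.var 14)).setArr 11 (s.arr 8 (i + 1))
      (s'.arr 11 (s.arr 8 (i + 1)) + s₂.var 14)) := ⟨_, rfl⟩
    have hrun : (seq (assign 15 (.sub (.var 0) (.var 6))) <| seq divide <|
      seq (store 12 (.var 15) (.var 13)) <| seq (store 13 (.var 15) (.var 14)) <|
      seq (store 14 (.var 15) (.var 14))
      (store 11 (.get 8 (.var 15)) (.add (.get 11 (.get 8 (.var 15))) (.var 14)))).run d s' =
        s₃ := by
      simp only [run_seq, run_assign, NExpr.eval_sub, NExpr.eval_var, h0, h6, h15, ← hs₂, hs₃]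
      simp [e15, earr, h8]
    rw [hrun, State.setVar_arr]
    have e12 : ∀ k, s₃.arr 12 k = if k = i + 1 then s₂.var 13 else s'.arr 12 k := by
      intro k; simp [hs₃, earr]
    have e13 : ∀ k, s₃.arr 13 k = if k = i + 1 then s₂.var 14 else s'.arr 13 k := by
      intro k; simp [hs₃, earr]
    have e14 : ∀ k, s₃.arr 14 k = if k = i + 1 then s₂.var 14 else s'.arr 14 k := by
      intro k; simp [hs₃, earr]
    have e11 : ∀ k, s₃.arr 11 k = s'.arr 11 k + if k = s.arr 8 (i + 1) then s₂.var 14 else 0 := by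
      intro k; simp [hs₃, earr]; split_ifs <;> simp_all
    have hsum : ∀ k, ∑ c ∈ (children n (s.arr 8) k).filter (i + 1 < ·), s₃.arr 13 c =
        ∑ c ∈ (children n (s.arr 8) k).filter (i + 1 < ·), s'.arr 13 c := by
      refine fun k => Finset.sum_congr rfl fun c hc => ?_
      rw [e13, if_neg (by have := (Finset.mem_filter.1 hc).2; omega)]
    have hsum' : ∀ k, i < k → ∑ c ∈ children n (s.arr 8) k, s₃.arr 13 c =
        ∑ c ∈ children n (s.arr 8) k, s'.arr 13 c := by
      refine fun k hk => Finset.sum_congr rfl fun c hc => ?_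
      rw [e13, if_neg]
      rw [mem_children] at hc
      have := hpar c hc.1.1 hc.1.2
      omega
    refine ⟨fun k h1k h2k => ?_, fun k h1k h2k => ?_, ?_⟩
    · rw [hsum' k h1k, e12, e13, e14]
      by_cases hk : k = i + 1
      · subst hk
        simp only [if_true]
        refine ⟨hr, ?_, ?_, trivial⟩
        · have := ih₂ (i + 1) (by omega) le_rfl
          rw [children_filter_lt hpar] at this
          rw [hq, this]
        · have : s₂.var 13 ≤ s.var 1 * s₂.var 13 := Nat.le_mul_of_pos_left _ hL
          omega
      · simp only [if_neg hk]
        exact ih₁ k (by omega) h2k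
    · rw [sum_children_pred _ (by omega), hsum, e11, ih₂ k h1k (by omega), e13, if_pos rfl]
      simp only [eq_comm (a := s.arr 8 (i + 1))]
      omega
    · simp only [e11]
      rw [Finset.sum_add_distrib, Finset.sum_ite_eq']
      have : s₂.var 14 ≤ s'.arr 11 (i + 1) := by omega
      split_ifs <;> omega

/-- The machine cannot multiply, so the product is accumulated in a loop of `n` rounds, which is
long enough because the number of clusters is at most `n`. -/
theorem run_keep (hn : s.arr 12 (s.var 15) ≤ s.var 0) :
    (keep.run d s).var 8 = min (s.arr 12 (s.var 15) * (s.var 2 - s.var 1))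
      (s.arr 14 (s.arr 9 (s.var 15))) := by
  have := forN_induction (d := d) (i := 7) (s := s.setVar 8 0)
    (A := ite (.le (.add (.var 7) (.lit 1)) (.get 12 (.var 15)))
      (assign 8 (.add (.var 8) (.sub (.var 2) (.var 1)))) skip)
    (fun m s' => s'.var 8 = min m (s.arr 12 (s.var 15)) * (s.var 2 - s.var 1))
    (by simp) (by
      intro m hm s' hF h7 ih
      have h1 : s'.var 1 = s.var 1 := by rw [hF.var 1 rfl]; simp
      have h2 : s'.var 2 = s.var 2 := by rw [hF.var 2 rfl]; simp
      have h15 : s'.var 15 = s.var 15 := by rw [hF.var 15 rfl]; simp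
      have h12 : s'.arr 12 = s.arr 12 := by rw [hF.arr 12 rfl]; simp
      rw [run_ite]
      simp only [Ne, NExpr.eval_le, not_not, NExpr.eval_var, NExpr.eval_add, NExpr.eval_lit,
        NExpr.eval_get, h12, h15, h7]
      split_ifs with h
      · rw [min_eq_left h]
        rw [min_eq_left (by omega)] at ih
        simp [h1, h2, ih]
        ring
      · rw [min_eq_right (by omega)] at ih ⊢
        simp [ih])
  have h0 : (s.setVar 8 0).var 0 = s.var 0 := by simp
  have hF := frame_run (d := d) (forN 7 (ite (.le (.add (.var 7) (.lit 1)) (.get 12 (.var 15)))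
      (assign 8 (.add (.var 8) (.sub (.var 2) (.var 1)))) skip)) (s.setVar 8 0)
  rw [h0, min_eq_right hn] at this
  rw [keep, run_seq, run_seq, run_assign, NExpr.eval_lit]
  generalize (forN 7 (ite (.le (.add (.var 7) (.lit 1)) (.get 12 (.var 15)))
      (assign 8 (.add (.var 8) (.sub (.var 2) (.var 1)))) skip)).run d (s.setVar 8 0) = s₁ at *
  have h15 : s₁.var 15 = s.var 15 := by rw [hF.var 15 rfl]; simp
  have h9 : s₁.arr 9 = s.arr 9 := by rw [hF.arr 9 rfl]; simp
  have h14 : s₁.arr 14 = s.arr 14 := by rw [hF.arr 14 rfl]; simp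
  rw [run_ite]
  simp only [Ne, NExpr.eval_le, not_not, NExpr.eval_var, NExpr.eval_get, h15, h9, h14, run_skip,
    run_assign]
  split_ifs with h
  · rw [min_eq_left (by omega), this]
  · rw [min_eq_right (by omega)]
    simp

/-- Greedy distribution: the budget left at a root and the extras paid so far add up to `x r`, and
either the budget is used up or every processed net point of the tree has its maximal extra. At the
end this gives the minimum. -/
theorem run_distribute (hn : s.var 0 = n) {par top a x : ℕ → ℕ} (F : IsForest n par top)
    (hpar : s.arr 8 = par) (htop : s.arr 9 = top) (ha : s.arr 12 = a)
    (hx : ∀ k, 1 ≤ k → k ≤ n → s.arr 14 k = x k) (han : ∀ k, 1 ≤ k → k ≤ n → a k ≤ n) :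
    (∀ k, 1 ≤ k → k ≤ n → (distribute.run d s).arr 20 k ≤ a k * (s.var 2 - s.var 1)) ∧
    (∀ k, 1 ≤ k → k ≤ n → (distribute.run d s).arr 15 k =
      (distribute.run d s).arr 20 k + ∑ c ∈ children n par k, (distribute.run d s).arr 15 c) ∧
    ∀ r, 1 ≤ r → r ≤ n → par r = 0 → ∑ k ∈ tree n top r, (distribute.run d s).arr 20 k =
      min (x r) (∑ k ∈ tree n top r, a k * (s.var 2 - s.var 1)) := by
  obtain ⟨D, hD⟩ : ∃ D, D = s.var 2 - s.var 1 := ⟨_, rfl⟩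
  rw [← hD]
  obtain ⟨s₀, hs₀⟩ : ∃ s₀, s₀ = (forN 6 (store 15 (.add (.var 6) (.lit 1)) (.lit 0))).run d s :=
    ⟨_, rfl⟩
  have hzero := forN_induction (d := d) (i := 6) (s := s)
    (A := store 15 (.add (.var 6) (.lit 1)) (.lit 0))
    (fun m s' => ∀ k < m, s'.arr 15 (k + 1) = 0) (by simp) (by
      intro m hm s' hF h6 ih k hk
      rcases Nat.lt_succ_iff_lt_or_eq.1 hk with hk | rfl
      · simp [h6, hk.ne, ih k hk]
      · simp [h6])
  have hF₀ := frame_run (d := d) (forN 6 (store 15 (.add (.var 6) (.lit 1)) (.lit 0))) s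
  rw [← hs₀, hn] at hzero
  rw [← hs₀] at hF₀
  have hn₀ : s₀.var 0 = n := by rw [hF₀.var 0 rfl, hn]
  have := forN_induction (d := d) (i := 6) (s := s₀)
    (A := seq (assign 15 (.sub (.var 0) (.var 6))) <| seq keep <|
      seq (store 20 (.var 15) (.var 8)) <|
      seq (store 14 (.get 9 (.var 15)) (.sub (.get 14 (.get 9 (.var 15))) (.var 8))) <|
      seq (store 15 (.var 15) (.add (.get 15 (.var 15)) (.var 8)))
      (store 15 (.get 8 (.var 15)) (.add (.get 15 (.get 8 (.var 15))) (.get 15 (.var 15)))))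
    (fun m s' => ∀ i, i + m = n →
      (∀ k, i < k → k ≤ n → s'.arr 20 k ≤ a k * D ∧
        s'.arr 15 k = s'.arr 20 k + ∑ c ∈ children n par k, s'.arr 15 c) ∧
      (∀ k, 1 ≤ k → k ≤ i → s'.arr 15 k =
        ∑ c ∈ (children n par k).filter (i < ·), s'.arr 15 c) ∧
      ∀ r, 1 ≤ r → r ≤ n → par r = 0 →
        s'.arr 14 r + ∑ k ∈ (tree n top r).filter (i < ·), s'.arr 20 k = x r ∧
        (s'.arr 14 r = 0 ∨ ∀ k ∈ (tree n top r).filter (i < ·), s'.arr 20 k = a k * D)) ?_ ?_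
  · rw [hn₀] at this
    have e : (forN 6 (seq (assign 15 (.sub (.var 0) (.var 6))) <| seq keep <|
      seq (store 20 (.var 15) (.var 8)) <|
      seq (store 14 (.get 9 (.var 15)) (.sub (.get 14 (.get 9 (.var 15))) (.var 8))) <|
      seq (store 15 (.var 15) (.add (.get 15 (.var 15)) (.var 8)))
      (store 15 (.get 8 (.var 15)) (.add (.get 15 (.get 8 (.var 15)))
        (.get 15 (.var 15)))))).run d s₀ = distribute.run d s := by
      rw [hs₀]; rfl
    rw [e] at this
    obtain ⟨h1, -, h3⟩ := this 0 (by omega)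
    generalize distribute.run d s = s₁ at *
    refine ⟨fun k hk1 hk2 => (h1 k hk1 hk2).1, fun k hk1 hk2 => (h1 k hk1 hk2).2,
      fun r hr1 hr2 hr => ?_⟩
    obtain ⟨h4, h5⟩ := h3 r hr1 hr2 hr
    have hf : (tree n top r).filter (0 < ·) = tree n top r :=
      Finset.filter_true_of_mem fun c hc => (mem_tree.1 hc).1.1
    rw [hf] at h4 h5
    have hle : ∑ k ∈ tree n top r, s₁.arr 20 k ≤ ∑ k ∈ tree n top r, a k * D :=
      Finset.sum_le_sum fun k hk => (h1 k (mem_tree.1 hk).1.1 (mem_tree.1 hk).1.2).1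
    rcases h5 with h5 | h5
    · rw [min_eq_left (by omega)]
      omega
    · have : ∑ k ∈ tree n top r, s₁.arr 20 k = ∑ k ∈ tree n top r, a k * D :=
        Finset.sum_congr rfl h5
      rw [min_eq_right (by omega), this]
  · intro i hi
    obtain rfl : i = n := by omega
    have hf : ∀ r, (tree i top r).filter (i < ·) = ∅ := fun r => by
      ext c
      simp only [Finset.mem_filter, mem_tree, Finset.notMem_empty, iff_false]
      omega
    refine ⟨fun k h1 h2 => by omega, fun k h1 h2 => ?_, fun r hr1 hr2 hr => ?_⟩
    · rw [children_filter_eq_empty, Finset.sum_empty, State.setVar_arr]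
      obtain ⟨j, rfl⟩ := Nat.exists_eq_add_of_le' h1
      exact hzero j h2
    · rw [hf, State.setVar_arr, hF₀.arr 14 rfl, hx r hr1 hr2]
      simp
  · intro m hm s' hF h6 ih i hi
    rw [hn₀] at hm
    obtain ⟨ih₁, ih₂, ih₃⟩ := ih (i + 1) (by omega)
    have h0 : s'.var 0 = n := by rw [hF.var 0 rfl, hn₀]
    have h1 : s'.var 1 = s.var 1 := by rw [hF.var 1 rfl, hF₀.var 1 rfl]
    have h2 : s'.var 2 = s.var 2 := by rw [hF.var 2 rfl, hF₀.var 2 rfl]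
    have h8 : s'.arr 8 = par := by rw [hF.arr 8 rfl, hF₀.arr 8 rfl, hpar]
    have h9 : s'.arr 9 = top := by rw [hF.arr 9 rfl, hF₀.arr 9 rfl, htop]
    have h12 : s'.arr 12 = a := by rw [hF.arr 12 rfl, hF₀.arr 12 rfl, ha]
    have h15 : n - m = i + 1 := by omega
    have hkeep := run_keep (d := d) (s := s'.setVar 15 (i + 1))
      (by simpa [h0, h12] using han (i + 1) (by omega) (by omega))
    have hFk := frame_run (d := d) keep (s'.setVar 15 (i + 1))
    obtain ⟨s₂, hs₂⟩ : ∃ s₂, s₂ = keep.run d (s'.setVar 15 (i + 1)) := ⟨_, rfl⟩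
    rw [← hs₂] at hkeep hFk
    obtain ⟨z, hz⟩ : ∃ z, z = s₂.var 8 := ⟨_, rfl⟩
    rw [← hz] at hkeep
    simp [h1, h2, h9, h12, ← hD] at hkeep
    have e15 : s₂.var 15 = i + 1 := by rw [hFk.var 15 rfl]; simp
    have earr : ∀ b, s₂.arr b = s'.arr b := fun b => hFk.arr b rfl
    have hpi := F.par_lt (i + 1) (by omega) (by omega)
    obtain ⟨s₃, hs₃⟩ : ∃ s₃, s₃ = ((((s₂.setArr 20 (i + 1) z).setArr 14 (top (i + 1))
      (s'.arr 14 (top (i + 1)) - z)).setArr 15 (i + 1) (s'.arr 15 (i + 1) + z)).setArr 15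
      (par (i + 1)) (s'.arr 15 (par (i + 1)) + (s'.arr 15 (i + 1) + z))) := ⟨_, rfl⟩
    have hrun : (seq (assign 15 (.sub (.var 0) (.var 6))) <| seq keep <|
      seq (store 20 (.var 15) (.var 8)) <|
      seq (store 14 (.get 9 (.var 15)) (.sub (.get 14 (.get 9 (.var 15))) (.var 8))) <|
      seq (store 15 (.var 15) (.add (.get 15 (.var 15)) (.var 8)))
      (store 15 (.get 8 (.var 15)) (.add (.get 15 (.get 8 (.var 15)))
        (.get 15 (.var 15))))).run d s' = s₃ := by
      simp only [run_seq, run_assign, NExpr.eval_sub, NExpr.eval_var, h0, h6, h15, ← hs₂, hs₃]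
      simp [e15, earr, h8, h9, ← hz, hpi.ne]
    rw [hrun, State.setVar_arr]
    have e20 : ∀ k, s₃.arr 20 k = if k = i + 1 then z else s'.arr 20 k := by
      intro k; simp [hs₃, earr]
    have e14 : ∀ k, s₃.arr 14 k = if k = top (i + 1) then s'.arr 14 k - z else s'.arr 14 k := by
      intro k; simp [hs₃, earr]; split_ifs <;> simp_all
    have e15' : ∀ k, s₃.arr 15 k = if k = i + 1 then s'.arr 15 (i + 1) + z else
        s'.arr 15 k + if k = par (i + 1) then s'.arr 15 (i + 1) + z else 0 := by
      intro k
      simp [hs₃, earr]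
      by_cases hk1 : k = par (i + 1)
      · have : k ≠ i + 1 := by omega
        simp [hk1, hpi.ne]
      · simp [hk1]
    have hsum : ∀ k, ∑ c ∈ (children n par k).filter (i + 1 < ·), s₃.arr 15 c =
        ∑ c ∈ (children n par k).filter (i + 1 < ·), s'.arr 15 c := by
      refine fun k => Finset.sum_congr rfl fun c hc => ?_
      have := (Finset.mem_filter.1 hc).2
      rw [e15', if_neg (by omega), if_neg (by omega), add_zero]
    have hsum' : ∀ k, i < k → ∑ c ∈ children n par k, s₃.arr 15 c =
        ∑ c ∈ children n par k, s'.arr 15 c := by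
      refine fun k hk => Finset.sum_congr rfl fun c hc => ?_
      rw [mem_children] at hc
      have := F.par_lt c hc.1.1 hc.1.2
      rw [e15', if_neg (by omega), if_neg (by omega), add_zero]
    refine ⟨fun k h1k h2k => ?_, fun k h1k h2k => ?_, fun r hr1 hr2 hr => ?_⟩
    · rw [hsum' k h1k, e15', e20]
      by_cases hk : k = i + 1
      · subst hk
        simp only [if_true]
        have := ih₂ (i + 1) (by omega) le_rfl
        rw [children_filter_lt F.par_lt] at this
        exact ⟨hkeep ▸ min_le_left _ _, by omega⟩
      · simp only [if_neg hk]
        rw [if_neg (by omega), add_zero]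
        exact ih₁ k (by omega) h2k
    · rw [sum_children_pred _ (by omega), hsum, e15', if_neg (by omega), ih₂ k h1k (by omega),
        e15', if_pos rfl]
      simp only [eq_comm (a := par (i + 1))]
      omega
    · obtain ⟨ih₃, ih₄⟩ := ih₃ r hr1 hr2 hr
      have hsum₂ : ∀ k ∈ (tree n top r).filter (i + 1 < ·), s₃.arr 20 k = s'.arr 20 k := by
        intro k hk
        rw [e20, if_neg (by have := (Finset.mem_filter.1 hk).2; omega)]
      have hsum₃ : ∑ k ∈ (tree n top r).filter (i + 1 < ·), s₃.arr 20 k =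
          ∑ k ∈ (tree n top r).filter (i + 1 < ·), s'.arr 20 k := Finset.sum_congr rfl hsum₂
      by_cases hr' : top (i + 1) = r
      · have hins : (tree n top r).filter (i < ·) =
            insert (i + 1) ((tree n top r).filter (i + 1 < ·)) := by
          ext c
          simp only [Finset.mem_filter, mem_tree, Finset.mem_insert]
          constructor
          · rintro ⟨h, h'⟩
            by_cases hc : c = i + 1
            · exact .inl hc
            · exact .inr ⟨h, by omega⟩
          · rintro (rfl | ⟨h, h'⟩)
            · exact ⟨⟨by omega, hr'⟩, by omega⟩
            · exact ⟨h, by omega⟩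
        rw [hr'] at hkeep
        rw [hins, Finset.sum_insert (by simp), e14, if_pos hr'.symm, hsum₃,
          e20, if_pos rfl]
        have hz2 : z ≤ s'.arr 14 r := hkeep ▸ min_le_right _ _
        refine ⟨by omega, ?_⟩
        rcases min_cases (a (i + 1) * D) (s'.arr 14 r) with ⟨h, h'⟩ | ⟨h, h'⟩
        · rcases ih₄ with ih₄ | ih₄
          · exact .inl (by omega)
          · refine .inr fun k hk => ?_
            rcases Finset.mem_insert.1 hk with rfl | hk
            · rw [e20, if_pos rfl, hkeep, h]
            · rw [hsum₂ k hk, ih₄ k hk]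
        · exact .inl (by omega)
      · have hins : (tree n top r).filter (i < ·) = (tree n top r).filter (i + 1 < ·) := by
          refine Finset.filter_congr fun c hc => ?_
          have : c ≠ i + 1 := by
            rintro rfl
            exact hr' (mem_tree.1 hc).2
          omega
        rw [hins, e14, if_neg (Ne.symm hr'), hsum₃]
        exact ⟨ih₃, ih₄.imp_right fun h k hk => by rw [hsum₂ k hk, h k hk]⟩

/-! ### The exchange of clients and the output -/

theorem run_good (hn : s.var 0 = n) {u : ℕ} (hu : u < n) : (good.run d s).arr 2 u ≠ 0 ↔
    s.arr 1 u ≠ 0 ∧ s.var 1 ≤ ((Finset.range n).filter fun v =>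
      s.arr 0 v ≠ 0 ∧ d v u ≤ d (s.var 4) (s.var 5)).card := by
  have := forN_induction (d := d) (i := 6) (s := s)
    (A := seq (count 8 7 (.and (.get 0 (.var 7)) (.distLE (.var 7) (.var 6) (.var 4) (.var 5))))
      (ite (.and (.get 1 (.var 6)) (.le (.var 1) (.var 8))) (store 2 (.var 6) (.lit 1))
        (store 2 (.var 6) (.lit 0))))
    (fun m s' => ∀ u < m, s'.arr 2 u ≠ 0 ↔
      s.arr 1 u ≠ 0 ∧ s.var 1 ≤ ((Finset.range n).filter fun v =>
        s.arr 0 v ≠ 0 ∧ d v u ≤ d (s.var 4) (s.var 5)).card) (by simp) (by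
      intro m hm s' hF h6 ih u hu
      have h0 : s'.var 0 = n := by rw [hF.var 0 rfl, hn]
      have h1 : s'.var 1 = s.var 1 := hF.var 1 rfl
      have h4 : s'.var 4 = s.var 4 := hF.var 4 rfl
      have h5 : s'.var 5 = s.var 5 := hF.var 5 rfl
      have e0 : s'.arr 0 = s.arr 0 := hF.arr 0 rfl
      have e1 : s'.arr 1 = s.arr 1 := hF.arr 1 rfl
      rw [run_seq, run_count (by decide) (by decide)
        (fun v => s.arr 0 v ≠ 0 ∧ d v m ≤ d (s.var 4) (s.var 5))
        (fun k _ z => by simp [h6, e0, h4, h5]), h0, run_ite]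
      rcases Nat.lt_succ_iff_lt_or_eq.1 hu with hu | rfl
      · rw [← ih u hu]
        split_ifs <;> simp [h6, hu.ne]
      · split_ifs with h <;> simp [h6, h1, e1] at h ⊢ <;> tauto)
  rw [hn] at this
  exact this u hu

/-- Scanning greedily, either the quota is met or all home clients seen so far are in `M`; by `hm`
the quota is met at the end. -/
theorem run_move (hn : s.var 0 = n)
    (hm : s.var 18 ≤ homeCard n (s.arr 3) (s.arr 10) (s.var 16)) :
    Moved n (s.arr 3) (s.arr 10) ((move.run d s).arr 10) (s.var 16) (s.var 17) (s.var 18) := by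
  have := forN_induction (d := d) (i := 7) (s := s)
    (A := ite (.and (.var 18) (.and (.eq (.get 3 (.var 7)) (.var 16))
      (.eq (.get 10 (.var 7)) (.var 16))))
      (seq (store 10 (.var 7) (.var 17)) (assign 18 (.sub (.var 18) (.lit 1)))) skip)
    (fun m s' => ∃ M ⊆ (Finset.range m).filter
        (fun v => s.arr 3 v = s.var 16 ∧ s.arr 10 v = s.var 16),
      M.card + s'.var 18 = s.var 18 ∧ (∀ v, s'.arr 10 v = if v ∈ M then s.var 17 else s.arr 10 v) ∧
      (s'.var 18 = 0 ∨ M = (Finset.range m).filter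
        (fun v => s.arr 3 v = s.var 16 ∧ s.arr 10 v = s.var 16)))
    ⟨∅, by simp⟩ (by
      rintro m hm s' hF h7 ⟨M, hM, hc, hasg, hor⟩
      have h16 : s'.var 16 = s.var 16 := hF.var 16 rfl
      have h17 : s'.var 17 = s.var 17 := hF.var 17 rfl
      have e3 : s'.arr 3 = s.arr 3 := hF.arr 3 rfl
      have hmM : m ∉ M := fun h => by simpa using hM h
      have e10 : s'.arr 10 m = s.arr 10 m := by rw [hasg, if_neg hmM]
      rw [run_ite, Finset.range_add_one, Finset.filter_insert]
      simp only [Ne, NExpr.eval_and, NExpr.eval_eq, NExpr.eval_var, NExpr.eval_get, not_not, h7, h16,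
        e3, e10]
      by_cases h' : s.arr 3 m = s.var 16 ∧ s.arr 10 m = s.var 16
      · rw [if_pos h']
        by_cases h : s'.var 18 = 0
        · rw [if_neg (by simp [h])]
          exact ⟨M, hM.trans (Finset.subset_insert _ _), by simpa using hc, hasg,
            .inl (by simpa using h)⟩
        · rw [if_pos ⟨h, h'⟩]
          refine ⟨insert m M, Finset.insert_subset_insert m hM, ?_, ?_, ?_⟩
          · rw [Finset.card_insert_of_notMem hmM]
            simp
            omega
          · intro v
            by_cases hv : v = m
            · simp [hv, h7, h17]
            · simp [hv, h7, hasg]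
          · exact .inr (by rw [hor.resolve_left h])
      · rw [if_neg h', if_neg fun h => h' h.2]
        exact ⟨M, hM, by simpa using hc, hasg, by simpa using hor⟩)
  rw [hn] at this
  obtain ⟨M, hM, hc, hasg, hor⟩ := this
  refine ⟨M, hM, ?_, fun v _ => hasg v⟩
  rcases hor with h | h
  · change _ + (move.run d s).var 18 = _ at hc
    change (move.run d s).var 18 = _ at h
    omega
  · rw [homeCard, ← h] at hm
    omega

theorem run_exchange (hn : s.var 0 = n) {par x S own asg₀ : ℕ → ℕ} (hpar : s.arr 8 = par)
    (hx : s.arr 13 = x) (hS : s.arr 15 = S) (hown : s.arr 3 = own) (hasg : s.arr 10 = asg₀)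
    (hlt : ∀ k, 1 ≤ k → k ≤ n → par k < k)
    (hroot : ∀ k, 1 ≤ k → k ≤ n → par k = 0 → S k ≤ x k)
    (hout : ∀ k, 1 ≤ k → k ≤ n →
      (x k - S k) + ∑ c ∈ children n par k, (S c - x c) ≤ homeCard n own asg₀ k) :
    Exchanged n par x S own asg₀ n ((exchange.run d s).arr 10) := by
  have := forN_induction (d := d) (i := 6) (s := s)
    (A := seq (assign 15 (.add (.var 6) (.lit 1))) <| seq
    (ite (.le (.get 15 (.var 15)) (.get 13 (.var 15)))
      (seq (assign 16 (.var 15)) <| seq (assign 17 (.get 8 (.var 15))) <|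
        assign 18 (.sub (.get 13 (.var 15)) (.get 15 (.var 15))))
      (seq (assign 17 (.var 15)) <| seq (assign 16 (.get 8 (.var 15))) <|
        assign 18 (.sub (.get 15 (.var 15)) (.get 13 (.var 15))))) move)
    (fun m s' => Exchanged n par x S own asg₀ m (s'.arr 10)) (by
      rw [State.setVar_arr, hasg]
      exact .zero) (by
      intro i hi s' hF h6 ih
      rw [hn] at hi
      have h0 : s'.var 0 = n := by rw [hF.var 0 rfl, hn]
      have e8 : s'.arr 8 = par := by rw [hF.arr 8 rfl, hpar]
      have e13 : s'.arr 13 = x := by rw [hF.arr 13 rfl, hx]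
      have e15 : s'.arr 15 = S := by rw [hF.arr 15 rfl, hS]
      have e3 : s'.arr 3 = own := by rw [hF.arr 3 rfl, hown]
      have hpi := hlt (i + 1) (by omega) hi
      have hle := ih.le_home hi hout hpi
      have hr := hroot (i + 1) (by omega) hi
      rw [State.setVar_arr]
      refine ih.succ hi hpi hr ?_
      rw [run_seq, run_seq, run_ite]
      split_ifs with h1 h2 h2
      · have := run_move (d := d) (n := n) (s := ((((s'.setVar 15 (i + 1)).setVar 16 (i + 1)).setVar
          17 (par (i + 1))).setVar 18 (x (i + 1) - S (i + 1)))) (by simp [h0])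
          (by simpa [e3] using hle.1)
        simpa [h6, e8, e13, e15, e3] using this
      · exact absurd h2 (by simpa [h6, e13, e15] using h1)
      · exact absurd h2 (by simpa [h6, e13, e15] using h1)
      -- In this branch `S` exceeds `x`, so by `hroot` the net point is not a root and its parent
      -- has clients to give.
      · have := run_move (d := d) (n := n) (s := ((((s'.setVar 15 (i + 1)).setVar 17 (i + 1)).setVar
          16 (par (i + 1))).setVar 18 (S (i + 1) - x (i + 1)))) (by simp [h0])
          (by simpa [e3] using hle.2 (by omega))
        simpa [h6, e8, e13, e15, e3] using this)
  rw [hn] at this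
  exact this

/-- The centers of a net point get consecutive numbers, starting after those of all smaller net
points. -/
theorem run_openCenters (hn : s.var 0 = n) {a fac : ℕ → ℕ} (ha : s.arr 12 = a)
    (hfac : s.arr 7 = fac) (han : ∀ k, 1 ≤ k → k ≤ n → a k ≤ n) :
    (openCenters.run d s).var 22 = ∑ j ∈ Finset.range n, a (j + 1) ∧
      ∀ i < n, (openCenters.run d s).arr 17 (i + 1) = 0 ∧
        (openCenters.run d s).arr 16 (i + 1) = ∑ j ∈ Finset.range i, a (j + 1) ∧
        ∀ t < a (i + 1), (openCenters.run d s).arr 18 (∑ j ∈ Finset.range i, a (j + 1) + t) =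
          fac (i + 1) := by
  have := forN_induction (d := d) (i := 6) (s := s.setVar 22 0)
    (A := seq (assign 15 (.add (.var 6) (.lit 1))) <| seq (store 16 (.var 15) (.var 22)) <|
      seq (store 17 (.var 15) (.lit 0)) (forN 7 (ite (.le (.add (.var 7) (.lit 1))
        (.get 12 (.var 15))) (seq (store 18 (.var 22) (.get 7 (.var 15)))
        (assign 22 (.add (.var 22) (.lit 1)))) skip)))
    (fun m s' => s'.var 22 = ∑ j ∈ Finset.range m, a (j + 1) ∧
      ∀ i < m, s'.arr 17 (i + 1) = 0 ∧ s'.arr 16 (i + 1) = ∑ j ∈ Finset.range i, a (j + 1) ∧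
        ∀ t < a (i + 1), s'.arr 18 (∑ j ∈ Finset.range i, a (j + 1) + t) = fac (i + 1))
    (by simp) ?_
  · have h0 : (s.setVar 22 0).var 0 = n := by simpa using hn
    rw [h0] at this
    exact this
  · intro m hm s' hF h6 ⟨ih₁, ih₂⟩
    have hm : m < n := by simpa [hn] using hm
    have h0 : s'.var 0 = n := by rw [hF.var 0 rfl]; simpa using hn
    have e12 : s'.arr 12 = a := by rw [hF.arr 12 rfl]; simpa using ha
    have e7 : s'.arr 7 = fac := by rw [hF.arr 7 rfl]; simpa using hfac
    obtain ⟨b, hb⟩ : ∃ b, b = ∑ j ∈ Finset.range m, a (j + 1) := ⟨_, rfl⟩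
    rw [← hb] at ih₁
    obtain ⟨s₁, hs₁⟩ : ∃ s₁, s₁ = ((s'.setVar 15 (m + 1)).setArr 16 (m + 1) b).setArr 17 (m + 1) 0 :=
      ⟨_, rfl⟩
    obtain ⟨s₂, hs₂⟩ : ∃ s₂, s₂ = (forN 7 (ite (.le (.add (.var 7) (.lit 1))
        (.get 12 (.var 15))) (seq (store 18 (.var 22) (.get 7 (.var 15)))
        (assign 22 (.add (.var 22) (.lit 1)))) skip)).run d s₁ := ⟨_, rfl⟩
    have hloop := forN_induction (d := d) (i := 7) (s := s₁) (A := ite (.le (.add (.var 7) (.lit 1))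
        (.get 12 (.var 15))) (seq (store 18 (.var 22) (.get 7 (.var 15)))
        (assign 22 (.add (.var 22) (.lit 1)))) skip)
      (fun t s₃ => s₃.var 22 = b + min t (a (m + 1)) ∧ (∀ c < b, s₃.arr 18 c = s'.arr 18 c) ∧
        ∀ c < min t (a (m + 1)), s₃.arr 18 (b + c) = fac (m + 1))
      (by simp [hs₁, ih₁]) (by
        intro t ht s₃ hF₃ h7 ⟨ih₃, ih₄, ih₅⟩
        have h15 : s₃.var 15 = m + 1 := by rw [hF₃.var 15 rfl, hs₁]; simp
        have h12 : s₃.arr 12 = a := by rw [hF₃.arr 12 rfl, ← e12, hs₁]; ext; simp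
        have h7' : s₃.arr 7 = fac := by rw [hF₃.arr 7 rfl, ← e7, hs₁]; ext; simp
        rw [run_ite]
        simp only [Ne, NExpr.eval_le, not_not, NExpr.eval_var, NExpr.eval_add, NExpr.eval_lit,
          NExpr.eval_get, h12, h15, h7]
        split_ifs with h
        · rw [min_eq_left h]
          rw [min_eq_left (by omega)] at ih₃ ih₅
          refine ⟨by simp [ih₃]; omega, fun c hc => ?_, fun c hc => ?_⟩
          · have : c ≠ b + t := by omega
            simp [ih₃, this, ih₄ c hc]
          · by_cases hct : c = t
            · simp [hct, ih₃, h7', h15]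
            · simp [ih₃, hct, ih₅ c (by omega)]
        · rw [min_eq_right (by omega)] at ih₃ ih₅ ⊢
          exact ⟨by simpa using ih₃, ih₄, ih₅⟩)
    have h01 : s₁.var 0 = n := by simp [hs₁, h0]
    have hF₂ := frame_run (d := d) (forN 7 (ite (.le (.add (.var 7) (.lit 1))
        (.get 12 (.var 15))) (seq (store 18 (.var 22) (.get 7 (.var 15)))
        (assign 22 (.add (.var 22) (.lit 1)))) skip)) s₁
    rw [h01, ← hs₂, min_eq_right (han (m + 1) (by omega) hm)] at hloop
    rw [← hs₂] at hF₂
    have hrun : (seq (assign 15 (.add (.var 6) (.lit 1))) <| seq (store 16 (.var 15) (.var 22)) <|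
      seq (store 17 (.var 15) (.lit 0)) (forN 7 (ite (.le (.add (.var 7) (.lit 1))
        (.get 12 (.var 15))) (seq (store 18 (.var 22) (.get 7 (.var 15)))
        (assign 22 (.add (.var 22) (.lit 1)))) skip))).run d s' = s₂ := by
      rw [hs₂, hs₁]
      simp only [run_seq]
      congr 1
      simp [h6, ih₁]
    rw [hrun]
    obtain ⟨h3, h4, h5⟩ := hloop
    have e17 : s₂.arr 17 = s₁.arr 17 := hF₂.arr 17 rfl
    have e16 : s₂.arr 16 = s₁.arr 16 := hF₂.arr 16 rfl
    rw [State.setVar_arr]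
    refine ⟨by simp [h3, Finset.sum_range_succ, hb], fun i hi => ?_⟩
    rw [e17, e16]
    rcases Nat.lt_succ_iff_lt_or_eq.1 hi with hi | rfl
    · obtain ⟨j1, j2, j3⟩ := ih₂ i hi
      refine ⟨by simp [hs₁, j1], by simp [hs₁, hi.ne, j2], fun t ht => ?_⟩
      -- Earlier blocks end below `b`, so the new entries do not overwrite them.
      rw [h4 _ ?_, j3 t ht]
      rw [hb]
      calc _ < ∑ j ∈ Finset.range i, a (j + 1) + a (i + 1) := by omega
        _ = ∑ j ∈ Finset.range (i + 1), a (j + 1) := (Finset.sum_range_succ _ _).symm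
        _ ≤ _ := Finset.sum_le_sum_of_subset (Finset.range_subset_range.2 hi)
    · refine ⟨by simp [hs₁], by simp [hs₁, hb], fun t ht => ?_⟩
      rw [← hb]
      exact h5 t ht

/-- Array `17` holds the number of clients of a net point seen so far modulo its number of centers;
resetting it replaces a division. -/
theorem run_assignCenters (hn : s.var 0 = n) {asg a base : ℕ → ℕ} (hasg : s.arr 10 = asg)
    (ha : s.arr 12 = a) (hbase : s.arr 16 = base)
    (hpos : ∀ v < n, asg v ≠ 0 → asg v ≤ n ∧ 0 < a (asg v))
    (h17 : ∀ k, 1 ≤ k → k ≤ n → s.arr 17 k = 0) :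
    ∀ v < n, (assignCenters.run d s).arr 19 v = if asg v = 0 then 0 else
      base (asg v) + Nat.count (fun w => asg w = asg v) v % a (asg v) + 1 := by
  have := forN_induction (d := d) (i := 6) (s := s)
    (A := seq (assign 15 (.get 10 (.var 6))) <|
    ite (.var 15) (seq (store 17 (.var 15) (.add (.get 17 (.var 15)) (.lit 1))) <|
        seq (store 19 (.var 6) (.add (.get 16 (.var 15)) (.get 17 (.var 15)))) <|
        ite (.eq (.get 17 (.var 15)) (.get 12 (.var 15))) (store 17 (.var 15) (.lit 0)) skip)
      (store 19 (.var 6) (.lit 0)))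
    (fun m s' => (∀ v < m, s'.arr 19 v = if asg v = 0 then 0 else
      base (asg v) + Nat.count (fun w => asg w = asg v) v % a (asg v) + 1) ∧
      ∀ k, 1 ≤ k → k ≤ n → s'.arr 17 k = Nat.count (fun w => asg w = k) m % a k)
    ⟨by simp, fun k h1 h2 => by simpa using h17 k h1 h2⟩ ?_
  · rw [hn] at this
    exact this.1
  · intro m hm s' hF h6 ⟨ih₁, ih₂⟩
    rw [hn] at hm
    have e10 : s'.arr 10 = asg := by rw [hF.arr 10 rfl, hasg]
    have e12 : s'.arr 12 = a := by rw [hF.arr 12 rfl, ha]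
    have e16 : s'.arr 16 = base := by rw [hF.arr 16 rfl, hbase]
    obtain ⟨k, hk⟩ : ∃ k, k = asg m := ⟨_, rfl⟩
    have h15 : (s'.setVar 15 k).var 15 = k := by simp
    rw [run_seq, run_assign]
    simp only [NExpr.eval_get, NExpr.eval_var, e10, h6, ← hk]
    rw [run_ite]
    simp only [NExpr.eval_var, h15]
    split_ifs with h
    · have hp := hpos m hm (hk ▸ h)
      rw [← hk] at hp
      have hr := ih₂ k (by omega) hp.1
      have hrlt : Nat.count (fun w => asg w = k) m % a k < a k := Nat.mod_lt _ hp.2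
      obtain ⟨r, hr'⟩ : ∃ r, r = Nat.count (fun w => asg w = k) m % a k := ⟨_, rfl⟩
      rw [← hr'] at hr hrlt
      have hsucc : (Nat.count (fun w => asg w = k) m + 1) % a k =
          if r + 1 = a k then 0 else r + 1 := by
        rw [Nat.add_mod_eq_ite, ← hr']
        rcases Nat.lt_or_ge 1 (a k) with h1 | h1
        · rw [Nat.mod_eq_of_lt h1]
          split_ifs <;> omega
        · obtain h1 : a k = 1 := by omega
          obtain rfl : r = 0 := by omega
          simp [h1]
      rw [run_seq, run_seq, run_store, run_store, run_ite]
      simp only [NExpr.eval_var, NExpr.eval_add, NExpr.eval_get, NExpr.eval_lit, h15, h6,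
        State.setVar_arr, State.setArr_arr_apply, State.setVar_var, State.setArr_var, e16, e12, hr,
        if_true, Ne, NExpr.eval_eq, not_not, show ¬ (6 = 15) by decide, show ¬ (16 = 17) by decide,
        if_false, show ¬ (17 = 19) by decide, show ¬ (12 = 19) by decide, show ¬ (12 = 17) by decide]
      constructor
      · intro v hv
        rcases Nat.lt_succ_iff_lt_or_eq.1 hv with hv | rfl
        · rw [← ih₁ v hv]
          split_ifs <;> simp [hv.ne]
        · rw [← hk, if_neg h, ← hr']
          split_ifs <;> simp <;> omega
      · intro l hl1 hl2
        rw [Nat.count_succ, ← hk]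
        by_cases hlk : l = k
        · subst hlk
          rw [if_pos rfl, hsucc]
          split_ifs <;> simp
        · rw [if_neg (Ne.symm hlk), add_zero, ← ih₂ l hl1 hl2]
          split_ifs <;> simp [hlk]
    · rw [run_store]
      constructor
      · intro v hv
        rcases Nat.lt_succ_iff_lt_or_eq.1 hv with hv | rfl
        · rw [← ih₁ v hv]
          simp [h6, hv.ne]
        · simp only [not_not] at h
          simp [h6, ← hk, h]
      · intro l hl1 hl2
        rw [Nat.count_succ, ← hk, if_neg (by omega), add_zero, ← ih₂ l hl1 hl2]
        simp

end Loop

/-! ### Splitting clusters -/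

/-- The elements satisfying `p` have the ranks `0, 1, …`, each once, so only residues of ranks have
to be counted. -/
theorem card_filter_count_mod (p : ℕ → Prop) [DecidablePred p] (a c n : ℕ) :
    ((Finset.range n).filter fun v => p v ∧ Nat.count p v % a = c).card =
      Nat.count (fun j => j % a = c) (Nat.count p n) := by
  induction n with
  | zero => simp
  | succ n ih =>
    rw [Finset.range_add_one, Finset.filter_insert, Nat.count_succ]
    by_cases hp : p n
    · rw [if_pos hp, Nat.count_succ]
      by_cases hc : Nat.count p n % a = c
      · rw [if_pos ⟨hp, hc⟩, if_pos hc, Finset.card_insert_of_notMem (by simp), ih]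
      · rw [if_neg fun h => hc h.2, if_neg hc, ih]
        rfl
    · rw [if_neg fun h => hp h.1, if_neg hp, ih]
      rfl

/-- Both sides increase at the same steps: `t % a = c` holds exactly when `a` divides `t + (a - c)`.
-/
theorem count_mod_eq {a c : ℕ} (hc : c < a) (t : ℕ) :
    Nat.count (fun j => j % a = c) t = (t + a - 1 - c) / a := by
  induction t with
  | zero =>
    rw [Nat.count_zero, Nat.div_eq_of_lt (by omega)]
  | succ t ih =>
    rw [Nat.count_succ, ih]
    have e : t + 1 + a - 1 - c = (t + a - 1 - c) + 1 := by omega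
    rw [e, Nat.succ_div]
    congr 1
    refine if_congr ?_ rfl rfl
    have h1 : t + a - 1 - c + 1 = t + (a - c) := by omega
    rw [h1, ← Nat.modEq_zero_iff_dvd]
    have h2 : t % a = c ↔ t ≡ c [MOD a] := by
      rw [Nat.ModEq, Nat.mod_eq_of_lt hc]
    have h3 : c + (a - c) ≡ 0 [MOD a] := by
      rw [Nat.add_sub_cancel' hc.le]
      exact Nat.modEq_zero_iff_dvd.2 dvd_rfl
    rw [h2]
    constructor
    · exact fun h => (h.add_right _).trans h3
    · exact fun h => Nat.ModEq.add_right_cancel' _ (h.trans h3.symm)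

theorem count_mod_bounds {a c t L U : ℕ} (hc : c < a) (hL : a * L ≤ t) (hU : t ≤ a * U) :
    L ≤ Nat.count (fun j => j % a = c) t ∧ Nat.count (fun j => j % a = c) t ≤ U := by
  rw [count_mod_eq hc]
  constructor
  · rw [Nat.le_div_iff_mul_le (by omega), mul_comm]
    omega
  · rw [Nat.div_le_iff_le_mul_add_pred (by omega)]
    omega

/-! ### Instances in memory, and plans for one radius -/

variable {n : ℕ} {I : Instance n}

theorem Instance.distTable_symm (I : Instance n) (x y : ℕ) :
    I.distTable x y = I.distTable y x := by
  unfold Instance.distTable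
  by_cases h : x < n ∧ y < n
  · rw [dif_pos h, dif_pos h.symm]
    exact I.dist_symm _ _
  · rw [dif_neg h, dif_neg fun h' => h h'.symm]

/-- The table is `0` out of range, so the middle point must be in range, whereas for the other two
the left-hand side simply vanishes. -/
theorem Instance.distTable_triangle (I : Instance n) (x y z : ℕ) (hy : y < n) :
    I.distTable x z ≤ I.distTable x y + I.distTable y z := by
  unfold Instance.distTable
  by_cases h : x < n ∧ z < n
  · rw [dif_pos h, dif_pos ⟨h.1, hy⟩, dif_pos ⟨hy, h.2⟩]
    exact I.dist_triangle _ _ _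
  · rw [dif_neg h]
    exact zero_le

theorem Instance.distTable_val (I : Instance n) (x y : Fin n) :
    I.distTable x y = I.dist x y := by
  simp [Instance.distTable]

theorem Instance.input_clients (I : Instance n) (v : Fin n) :
    I.input.arr 0 v ≠ 0 ↔ v ∈ I.clients := by
  simp [Instance.input]

theorem Instance.input_facilities (I : Instance n) (v : Fin n) :
    I.input.arr 1 v ≠ 0 ↔ v ∈ I.facilities := by
  simp [Instance.input]

/-- The memory contains the instance `I`, where a lower bound `0` is replaced by `1`. -/
structure Holds (I : Instance n) (s : State) : Prop where
  n_eq : s.var 0 = n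
  L_eq : s.var 1 = max I.L 1
  U_eq : s.var 2 = I.U
  p_eq : s.var 3 = I.p
  clients : s.arr 0 = I.input.arr 0
  facilities : s.arr 1 = I.input.arr 1

theorem Holds.frame {s s' : State} {A : Loop} (h : Holds I s) (hF : A.Frame s s')
    (hA : (A.writesVar 0 || A.writesVar 1 || A.writesVar 2 || A.writesVar 3 || A.writesArr 0 ||
      A.writesArr 1) = false) : Holds I s' := by
  simp only [Bool.or_eq_false_iff] at hA
  obtain ⟨⟨⟨⟨⟨h0, h1⟩, h2⟩, h3⟩, a0⟩, a1⟩ := hA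
  exact ⟨by rw [hF.var 0 h0, h.n_eq], by rw [hF.var 1 h1, h.L_eq], by rw [hF.var 2 h2, h.U_eq],
    by rw [hF.var 3 h3, h.p_eq], by rw [hF.arr 0 a0, h.clients],
    by rw [hF.arr 1 a1, h.facilities]⟩

/-- A distribution of clients among net points `1, …, n` at locations `fac`, where net point `k`
can open `a k` centers; it serves at least as many clients as any solution of radius `ρ`. -/
structure Plan (I : Instance n) (ρ : ℝ≥0) (fac a asg : ℕ → ℕ) : Prop where
  asg_le : ∀ v < n, asg v ≤ n
  a_le : ∀ k, 1 ≤ k → k ≤ n → a k ≤ n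
  client : ∀ v < n, asg v ≠ 0 → I.input.arr 0 v ≠ 0
  dist_le : ∀ v < n, asg v ≠ 0 → I.distTable v (fac (asg v)) ≤ 5 * ρ
  lower : ∀ k, 1 ≤ k → k ≤ n → a k * max I.L 1 ≤ fiberCard n asg k
  upper : ∀ k, 1 ≤ k → k ≤ n → fiberCard n asg k ≤ a k * I.U
  facility : ∀ k, 1 ≤ k → k ≤ n → a k ≠ 0 → fac k < n ∧ I.input.arr 1 (fac k) ≠ 0
  optimal : ∀ T : Solution n, T.Feasible I → T.radius I ≤ ρ →
    T.served.card ≤ ((Finset.range n).filter fun v => asg v ≠ 0).card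

theorem sum_fiberCard {f : ℕ → ℕ} (hf : ∀ v < n, f v ≤ n) :
    ∑ k ∈ Finset.Icc 1 n, fiberCard n f k = ((Finset.range n).filter fun v => f v ≠ 0).card := by
  rw [Finset.card_eq_sum_card_fiberwise (f := f) (t := Finset.Icc 1 n)]
  · refine Finset.sum_congr rfl fun k hk => ?_
    rw [fiberCard]
    congr 1
    ext v
    simp only [Finset.mem_filter, Finset.mem_range, Finset.mem_Icc] at hk ⊢
    constructor
    · rintro ⟨h, rfl⟩
      exact ⟨⟨h, by omega⟩, rfl⟩
    · rintro ⟨⟨h, _⟩, e⟩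
      exact ⟨h, e⟩
  · intro v hv
    simp only [Finset.coe_filter, Finset.mem_range, Set.mem_ofPred_eq, Finset.coe_Icc,
      Set.mem_Icc] at hv ⊢
    have := hf v hv.1
    omega

namespace Solution

/-- The served clients of a solution as natural numbers. -/
def servedNat (T : Solution n) : Finset ℕ := T.served.map Fin.valEmbedding

open Classical in
/-- The number of the center that serves a client. -/
noncomputable def center (T : Solution n) (v : ℕ) : ℕ :=
  if h : ∃ hv : v < n, (⟨v, hv⟩ : Fin n) ∈ T.served then T.assign ⟨⟨v, h.1⟩, h.2⟩ else 0

theorem center_val (T : Solution n) (v : {v // v ∈ T.served}) : T.center v.1 = T.assign v := by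
  have h : ∃ hv : (v.1 : ℕ) < n, (⟨v.1, hv⟩ : Fin n) ∈ T.served := ⟨v.1.2, v.2⟩
  rw [center, dif_pos h]

theorem card_filter_center (T : Solution n) (v : {v // v ∈ T.served}) :
    (T.servedNat.filter (T.center · = T.center v.1)).card = T.load (T.assign v) := by
  symm
  refine Finset.card_bij (fun w _ => (w.1 : ℕ)) ?_ ?_ ?_
  · intro w hw
    simp only [Finset.mem_filter, Finset.mem_univ, true_and] at hw
    simp only [Finset.mem_filter, servedNat, Finset.mem_map, Fin.valEmbedding_apply]
    exact ⟨⟨w.1, w.2, rfl⟩, by rw [center_val, center_val, hw]⟩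
  · intro w _ w' _ h
    exact Subtype.ext (Fin.ext h)
  · intro w hw
    simp only [Finset.mem_filter, servedNat, Finset.mem_map, Fin.valEmbedding_apply] at hw
    obtain ⟨⟨w, hw, rfl⟩, h⟩ := hw
    refine ⟨⟨w, hw⟩, ?_, rfl⟩
    have h := h
    rw [center_val T ⟨w, hw⟩, center_val] at h
    simpa using Fin.ext h

theorem dist_le_radius (T : Solution n) (I : Instance n) (v : {v // v ∈ T.served}) :
    I.dist v.1 (T.loc (T.assign v)) ≤ T.radius I :=
  Finset.le_sup (f := fun v : {v // v ∈ T.served} => I.dist v.1 (T.loc (T.assign v)))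
    (Finset.mem_univ v)

end Solution

/-! ### The plan computed for one radius -/

namespace Loop

/-- The specifications of the phases are combined here with the two estimates of the method: the
distance bound `5ρ` and the comparison with an arbitrary solution of radius at most ρ. `hU` is what
makes `max I.L 1 ≤ I.U`. -/
theorem exists_plan {s : State} (h : Holds I s) (hU : 1 ≤ I.U) :
    ∃ t, (seq good <| seq net <| seq sizes <| seq passUp <| seq distribute exchange).run
        I.distTable s = t ∧
      Plan I (I.distTable (s.var 4) (s.var 5)) (t.arr 7) (t.arr 12) (t.arr 10) := by
  obtain ⟨d, hd⟩ : ∃ d, d = I.distTable := ⟨_, rfl⟩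
  have dsymm : ∀ x y, d x y = d y x := fun x y => by rw [hd]; exact I.distTable_symm x y
  have dtri : ∀ x y z, y < n → d x z ≤ d x y + d y z := fun x y z hy => by
    rw [hd]; exact I.distTable_triangle x y z hy
  obtain ⟨ρ, hρ⟩ : ∃ ρ, ρ = d (s.var 4) (s.var 5) := ⟨_, rfl⟩
  obtain ⟨L, hL⟩ : ∃ L, L = max I.L 1 := ⟨_, rfl⟩
  have hL1 : 1 ≤ L := hL ▸ le_max_right _ _
  have hLU : L ≤ I.U := hL ▸ max_le I.L_le_U hU
  rw [← hd, ← hρ]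
  -- the good facilities
  obtain ⟨s₁, hs₁⟩ : ∃ s₁, s₁ = good.run d s := ⟨_, rfl⟩
  have hF₁ := frame_run (d := d) good s
  have hgood : ∀ u < n, s₁.arr 2 u ≠ 0 ↔ I.input.arr 1 u ≠ 0 ∧ L ≤ ((Finset.range n).filter
      fun v => I.input.arr 0 v ≠ 0 ∧ d v u ≤ ρ).card := by
    intro u hu
    rw [hs₁, run_good h.n_eq hu, h.L_eq, h.clients, h.facilities, ← hL, ← hρ]
  rw [← hs₁] at hF₁
  have H₁ : Holds I s₁ := h.frame hF₁ rfl
  obtain ⟨E, hE⟩ : ∃ E : ℕ → ℕ → Prop, ∀ v u, E v u ↔ v < n ∧ u < n ∧ I.input.arr 0 v ≠ 0 ∧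
    s₁.arr 2 u ≠ 0 ∧ d v u ≤ ρ := ⟨fun v u => _, fun v u => Iff.rfl⟩
  obtain ⟨G, hG⟩ : ∃ G : ℕ → Prop, ∀ u, G u ↔ u < n ∧ s₁.arr 2 u ≠ 0 :=
    ⟨fun u => _, fun u => Iff.rfl⟩
  have hball : ∀ u, G u → L ≤ ((Finset.range n).filter fun v =>
      I.input.arr 0 v ≠ 0 ∧ d v u ≤ ρ).card := by
    intro u hu
    rw [hG] at hu
    exact ((hgood u hu.1).1 hu.2).2
  have hEG : ∀ v u, G u → (v < n ∧ I.input.arr 0 v ≠ 0 ∧ d v u ≤ ρ ↔ E v u) := by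
    intro v u hu
    rw [hE]
    rw [hG] at hu
    tauto
  have hR₁ : Represents d n E G s₁ := by
    refine ⟨H₁.n_eq, fun v u h => ?_, fun u h => ?_, fun v u h => ?_, fun u h => ?_,
      fun v hv u hu => ?_, fun u hu => ?_⟩
    · rw [hE] at h
      exact ⟨h.1, h.2.1⟩
    · rw [hG] at h
      exact h.1
    · rw [hE] at h
      rw [hG]
      exact ⟨h.2.1, h.2.2.2.1⟩
    · obtain ⟨v, hv⟩ := Finset.card_pos.1 (hL1.trans (hball u h))
      rw [Finset.mem_filter, Finset.mem_range] at hv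
      exact ⟨v, (hEG v u h).1 hv⟩
    · rw [hE, H₁.clients, hF₁.var 4 rfl, hF₁.var 5 rfl, ← hρ]
      tauto
    · rw [hG]
      tauto
  -- the net
  obtain ⟨F, hown, hnet⟩ := hR₁.run_net
  obtain ⟨s₂, hs₂⟩ : ∃ s₂, s₂ = net.run d s₁ := ⟨_, rfl⟩
  have hF₂ := frame_run (d := d) net s₁
  rw [← hs₂] at hF₂ F hown hnet
  have H₂ : Holds I s₂ := H₁.frame hF₂ rfl
  obtain ⟨K, hK⟩ : ∃ K, K = s₂.var 9 := ⟨_, rfl⟩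
  obtain ⟨fac, hfac⟩ : ∃ fac, fac = s₂.arr 7 := ⟨_, rfl⟩
  obtain ⟨par, hpar⟩ : ∃ par, par = s₂.arr 8 := ⟨_, rfl⟩
  obtain ⟨top, htop⟩ : ∃ top, top = s₂.arr 9 := ⟨_, rfl⟩
  obtain ⟨own, hown'⟩ : ∃ own, own = s₂.arr 3 := ⟨_, rfl⟩
  obtain ⟨asg₀, hasg₀⟩ : ∃ asg₀, asg₀ = s₂.arr 10 := ⟨_, rfl⟩
  rw [HasForest, ← hK, ← hfac, ← hpar, ← htop, ← hown'] at F
  rw [← hown', ← hasg₀] at hown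
  rw [← hown', ← hasg₀, ← htop] at hnet
  have hKn : K ≤ n := F.K_le hR₁.lt hR₁.nonempty
  have hforest : IsForest n par top := ⟨F.par_lt, F.top_root, F.top_par⟩
  have hTK : ∀ u k, Touches E own u k → 1 ≤ k ∧ k ≤ K := by
    rintro u k ⟨h0, v, hv, rfl⟩
    exact ⟨by omega, F.own_le v (hR₁.lt v u hv).1⟩
  have hasg₀K : ∀ v < n, asg₀ v ≤ K := by
    intro v hv
    by_cases h0 : asg₀ v = 0
    · omega
    · obtain ⟨u, _, hu⟩ := (hnet v hv).1 h0
      exact (hTK _ _ hu).2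
  -- the number of clients of each net point
  obtain ⟨s₃, hs₃⟩ : ∃ s₃, s₃ = sizes.run d s₂ := ⟨_, rfl⟩
  have hF₃ := frame_run (d := d) sizes s₂
  have hcnt := run_sizes (d := d) H₂.n_eq
  rw [← hs₃] at hF₃ hcnt
  have H₃ : Holds I s₃ := H₂.frame hF₃ rfl
  obtain ⟨cnt, hcnt'⟩ : ∃ cnt, cnt = s₃.arr 11 := ⟨_, rfl⟩
  rw [← hasg₀, ← hcnt'] at hcnt
  have hcn : ∑ k ∈ Finset.Icc 1 n, cnt k ≤ n := by
    rw [Finset.sum_congr rfl fun k hk =>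
      hcnt k (Finset.mem_Icc.1 hk).1 (Finset.mem_Icc.1 hk).2,
      sum_fiberCard fun v hv => (hasg₀K v hv).trans hKn]
    exact (Finset.card_filter_le _ _).trans (by simp)
  -- the remainders
  obtain ⟨s₄, hs₄⟩ : ∃ s₄, s₄ = passUp.run d s₃ := ⟨_, rfl⟩
  have hF₄ := frame_run (d := d) passUp s₃
  have e8₃ : s₃.arr 8 = par := by rw [hF₃.arr 8 rfl, hpar]
  have hup := run_passUp (d := d) H₃.n_eq (by rw [H₃.L_eq, ← hL]; exact hL1)
    (by rw [e8₃]; exact F.par_lt) (by rw [← hcnt']; exact hcn)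
  rw [← hs₄] at hF₄ hup
  have H₄ : Holds I s₄ := H₃.frame hF₄ rfl
  obtain ⟨a, ha⟩ : ∃ a, a = s₄.arr 12 := ⟨_, rfl⟩
  obtain ⟨x, hx⟩ : ∃ x, x = s₄.arr 13 := ⟨_, rfl⟩
  rw [H₃.L_eq, ← hL, ← hcnt', e8₃, ← ha, ← hx] at hup
  -- the extras
  obtain ⟨s₅, hs₅⟩ : ∃ s₅, s₅ = distribute.run d s₄ := ⟨_, rfl⟩
  have hF₅ := frame_run (d := d) distribute s₄
  have hdis := run_distribute (d := d) H₄.n_eq hforest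
    (by rw [hF₄.arr 8 rfl, e8₃]) (by rw [hF₄.arr 9 rfl, hF₃.arr 9 rfl, htop]) ha.symm
    (fun k h1 h2 => (hup k h1 h2).2.2.2) (fun k h1 h2 => (hup k h1 h2).2.2.1)
  rw [← hs₅] at hF₅ hdis
  have H₅ : Holds I s₅ := H₄.frame hF₅ rfl
  obtain ⟨e, he⟩ : ∃ e, e = s₅.arr 20 := ⟨_, rfl⟩
  obtain ⟨S, hS⟩ : ∃ S, S = s₅.arr 15 := ⟨_, rfl⟩
  rw [H₄.L_eq, H₄.U_eq, ← hL, ← he, ← hS] at hdis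
  have B : Balanced n L I.U par top cnt a x e S :=
    ⟨hforest, fun k h1 h2 => (hup k h1 h2).1, fun k h1 h2 => (hup k h1 h2).2.1, hdis.1, hdis.2.1,
      hdis.2.2⟩
  -- Numbers beyond `K` carry no facility, but they are isolated and without clients, so they open
  -- nothing and exchange nothing.
  have hch : ∀ k, K < k → children n par k = ∅ := by
    intro k hk
    ext c
    simp only [mem_children, Finset.notMem_empty, iff_false]
    rintro ⟨hc, e⟩
    have h1 := F.par_lt c hc.1 hc.2
    have h2 := F.par_of_gt c (by omega) hc.2
    omega
  have hcnt0 : ∀ k, K < k → k ≤ n → cnt k = 0 := by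
    intro k hk hk'
    rw [hcnt k (by omega) hk', fiberCard, Finset.card_eq_zero, Finset.filter_eq_empty_iff]
    intro v hv e
    have := hasg₀K v (Finset.mem_range.1 hv)
    omega
  have hout : ∀ k, 1 ≤ k → k ≤ n →
      (x k - S k) + ∑ c ∈ children n par k, (S c - x c) ≤ homeCard n own asg₀ k := by
    intro k h1 h2
    by_cases hk : k ≤ K
    · refine (B.out_lt h1 h2).le.trans ((hball _ (F.good k h1 hk)).trans ?_)
      refine Finset.card_le_card fun v hv => ?_
      rw [Finset.mem_filter, Finset.mem_range] at hv ⊢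
      have hEv := (hEG v _ (F.good k h1 hk)).1 hv
      have ho := (F.own_iff k h1 hk v hv.1).2 hEv
      exact ⟨hv.1, ho, by rw [hown v hv.1 (by omega), ho]⟩
    · rw [B.out_eq_zero h1 h2 (hch k (by omega)) (hcnt0 k (by omega) h2)]
      exact zero_le
  -- the exchange
  obtain ⟨s₆, hs₆⟩ : ∃ s₆, s₆ = exchange.run d s₅ := ⟨_, rfl⟩
  have hF₆ := frame_run (d := d) exchange s₅
  have X := run_exchange (d := d) H₅.n_eq (par := par) (x := x) (S := S) (own := own)
    (asg₀ := asg₀) (by rw [hF₅.arr 8 rfl, hF₄.arr 8 rfl, e8₃]) (by rw [hF₅.arr 13 rfl, hx]) hS.symm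
    (by rw [hF₅.arr 3 rfl, hF₄.arr 3 rfl, hF₃.arr 3 rfl, hown'])
    (by rw [hF₅.arr 10 rfl, hF₄.arr 10 rfl, hF₃.arr 10 rfl, hasg₀]) F.par_lt
    (fun k h1 h2 h => B.S_root_le h1 h2 h) hout
  rw [← hs₆] at hF₆ X
  obtain ⟨asg, hasg⟩ : ∃ asg, asg = s₆.arr 10 := ⟨_, rfl⟩
  have e7 : s₆.arr 7 = fac := by
    rw [hF₆.arr 7 rfl, hF₅.arr 7 rfl, hF₄.arr 7 rfl, hF₃.arr 7 rfl, hfac]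
  have e12 : s₆.arr 12 = a := by rw [hF₆.arr 12 rfl, hF₅.arr 12 rfl, ha]
  refine ⟨s₆, by simp only [run_seq, ← hs₁, ← hs₂, ← hs₃, ← hs₄, ← hs₅, ← hs₆], ?_⟩
  rw [e7, e12, ← hasg]
  rw [← hasg] at X
  have hfib := X.fiberCard_eq B hcnt
  have ha0 : ∀ k, 1 ≤ k → k ≤ n → a k ≠ 0 → k ≤ K := by
    intro k h1 h2 h0
    by_contra hk
    have := B.up k h1 h2
    rw [hch k (by omega), hcnt0 k (by omega) h2, Finset.sum_empty] at this
    have h3 : L * a k = 0 := by omega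
    rcases Nat.mul_eq_zero.1 h3 with h | h <;> omega
  have hasgn : ∀ v < n, asg v ≤ n := by
    intro v hv
    rcases X.asg_eq v hv with h | ⟨h1, h2, h⟩ | h
    · rw [h]
      exact (hasg₀K v hv).trans hKn
    · rw [h]
      exact (F.par_lt _ h1 h2).le.trans h2
    · exact h.2.1
  have hupper : ∀ k, 1 ≤ k → k ≤ n → fiberCard n asg k ≤ a k * I.U := by
    intro k h1 h2
    rw [hfib k h1 h2]
    have := B.extra k h1 h2
    obtain ⟨D, hD⟩ := Nat.exists_eq_add_of_le hLU
    rw [hD, Nat.add_sub_cancel_left] at this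
    rw [hD, mul_add, mul_comm L]
    omega
  have hasgK : ∀ v < n, asg v ≠ 0 → asg v ≤ K := by
    intro v hv h0
    refine ha0 _ (by omega) (hasgn v hv) fun h => ?_
    have h1 := hupper (asg v) (by omega) (hasgn v hv)
    rw [h, zero_mul, Nat.le_zero, fiberCard, Finset.card_eq_zero, Finset.filter_eq_empty_iff] at h1
    exact h1 (Finset.mem_range.2 hv) rfl
  have hEd : ∀ v u, E v u → d v u ≤ ρ := fun v u h => ((hE v u).1 h).2.2.2.2
  have hEown : ∀ v < n, own v ≠ 0 → E v (fac (own v)) := fun v hv h0 =>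
    (F.own_iff _ (by omega) (F.own_le v hv) v hv).1 rfl
  -- The path `fac k`, `w`, `u`, `v`, `fac (par k)` consists of four edges of length at most ρ.
  have hlink : ∀ k, 1 ≤ k → k ≤ n → par k ≠ 0 → d (fac k) (fac (par k)) ≤ 4 * ρ := by
    intro k h1 h2 h0
    obtain ⟨v, u, w, hv, ev, hw, ew⟩ := F.link k h1 h2 h0
    have hvn := (hR₁.lt _ _ hv).1
    have hwn := (hR₁.lt _ _ hw).1
    have hun := (hR₁.lt _ _ hv).2
    have d1 := hEd _ _ (hEown w hwn (by omega))
    have d2 := hEd _ _ hw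
    have d3 := hEd _ _ hv
    have d4 := hEd _ _ (hEown v hvn (by omega))
    rw [ew, dsymm] at d1
    rw [ev] at d4
    rw [dsymm] at d3
    calc d (fac k) (fac (par k)) ≤ d (fac k) w + d w (fac (par k)) := dtri _ _ _ hwn
      _ ≤ d (fac k) w + (d w u + d u (fac (par k))) := by gcongr; exact dtri _ _ _ hun
      _ ≤ d (fac k) w + (d w u + (d u v + d v (fac (par k)))) := by
        gcongr; exact dtri _ _ _ hvn
      _ ≤ ρ + (ρ + (ρ + ρ)) := by gcongr
      _ = 4 * ρ := by ring
  have hcase : ∀ v < n, asg v ≠ 0 → I.input.arr 0 v ≠ 0 ∧ d v (fac (asg v)) ≤ 5 * ρ := by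
    intro v hv h0
    -- A client that was not moved is three edges from its net point. A moved client lay in the ball
    -- of its home and crossed one link, up or down.
    rcases X.asg_eq v hv with h | ⟨h1, h2, h⟩ | ⟨h1, h2, h3, h⟩
    · rw [h] at h0 ⊢
      obtain ⟨u, hu, ht⟩ := (hnet v hv).1 h0
      obtain ⟨-, w, hw, ew⟩ := ht
      have hwn := (hR₁.lt _ _ hw).1
      have hun := (hR₁.lt _ _ hw).2
      refine ⟨((hE v u).1 hu).2.2.1, ?_⟩
      have d1 := hEd _ _ hu
      have d2 := hEd _ _ hw
      have d3 := hEd _ _ (hEown w hwn (by omega))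
      rw [ew] at d3
      rw [dsymm] at d2
      calc d v (fac (asg₀ v)) ≤ d v u + d u (fac (asg₀ v)) := dtri _ _ _ hun
        _ ≤ d v u + (d u w + d w (fac (asg₀ v))) := by gcongr; exact dtri _ _ _ hwn
        _ ≤ ρ + (ρ + ρ) := by gcongr
        _ = 3 * ρ := by ring
        _ ≤ 5 * ρ := by gcongr; norm_num
    · rw [h] at h0 ⊢
      have hEv := hEown v hv (by omega)
      refine ⟨((hE _ _).1 hEv).2.2.1, ?_⟩
      calc d v (fac (par (own v))) ≤ d v (fac (own v)) + d (fac (own v)) (fac (par (own v))) :=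
            dtri _ _ _ (hR₁.lt _ _ hEv).2
        _ ≤ ρ + 4 * ρ := by gcongr; exacts [hEd _ _ hEv, hlink _ h1 h2 h0]
        _ = 5 * ρ := by ring
    · have hEv := hEown v hv h3
      refine ⟨((hE _ _).1 hEv).2.2.1, ?_⟩
      have hl := hlink _ h1 h2 (by omega)
      rw [dsymm, h] at hl
      calc d v (fac (asg v)) ≤ d v (fac (own v)) + d (fac (own v)) (fac (asg v)) :=
            dtri _ _ _ (hR₁.lt _ _ hEv).2
        _ ≤ ρ + 4 * ρ := by gcongr; exact hEd _ _ hEv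
        _ = 5 * ρ := by ring
  refine ⟨hasgn, fun k h1 h2 => (hup k h1 h2).2.2.1, fun v hv h0 => (hcase v hv h0).1,
    fun v hv h0 => hd ▸ (hcase v hv h0).2, fun k h1 h2 => ?_, hupper, fun k h1 h2 h0 => ?_, ?_⟩
  · rw [hfib k h1 h2, ← hL, mul_comm]
    omega
  · have hg := F.good k h1 (ha0 k h1 h2 h0)
    rw [hG] at hg
    exact ⟨hg.1, ((hgood _ hg.1).1 hg.2).1⟩
  · intro T hT hTρ
    have hTE : ∀ v : {v // v ∈ T.served}, E v.1 (T.loc (T.assign v)) := by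
      intro v
      have hcl : ∀ w : {v // v ∈ T.served}, I.input.arr 0 w.1 ≠ 0 := fun w =>
        (I.input_clients _).2 (hT.served_clients w.2)
      have hdist : ∀ w : {v // v ∈ T.served}, d w.1 (T.loc (T.assign w)) ≤ ρ := fun w => by
        rw [hd, I.distTable_val]
        exact (T.dist_le_radius I w).trans hTρ
      rw [hE]
      refine ⟨v.1.2, (T.loc _).2, hcl v, (hgood _ (T.loc _).2).2
        ⟨(I.input_facilities _).2 (hT.loc_facilities _), ?_⟩, hdist v⟩
      -- The cluster of `v` contains `v` and lies in the ball of its facility; hence this facility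
      -- is good, also when `I.L = 0`.
      have h1 : L ≤ T.load (T.assign v) := by
        rw [hL]
        refine max_le (hT.lower _) (Finset.card_pos.2 ⟨v, ?_⟩)
        simp
      rw [← T.card_filter_center] at h1
      refine h1.trans (Finset.card_le_card fun w hw => ?_)
      simp only [Finset.mem_filter, Solution.servedNat, Finset.mem_map,
        Fin.valEmbedding_apply] at hw
      obtain ⟨⟨w, hw, rfl⟩, hc⟩ := hw
      rw [T.center_val ⟨w, hw⟩, T.center_val] at hc
      rw [Finset.mem_filter, Finset.mem_range, ← Fin.ext hc]
      exact ⟨w.2, hcl ⟨w, hw⟩, hdist ⟨w, hw⟩⟩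
    rw [← sum_fiberCard hasgn, Finset.sum_congr rfl fun k hk =>
      hfib k (Finset.mem_Icc.1 hk).1 (Finset.mem_Icc.1 hk).2]
    have hmem : ∀ v ∈ T.servedNat, ∃ w : {v // v ∈ T.served}, (w.1 : ℕ) = v := by
      intro v hv
      obtain ⟨w, hw, rfl⟩ := Finset.mem_map.1 hv
      exact ⟨⟨w, hw⟩, rfl⟩
    have hcard : T.served.card = T.servedNat.card := (Finset.card_map _).symm
    rw [hcard]
    refine B.card_le hLU (asg := asg₀) hcnt (V := T.servedNat) ?_ T.center ?_ ?_ ?_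
    · intro v hv
      obtain ⟨w, rfl⟩ := hmem v hv
      have := ((hnet _ w.1.2).2 _ (hTE w)).1
      exact ⟨w.1.2, by omega, (hasg₀K _ w.1.2).trans hKn⟩
    · intro v hv w hw hc
      obtain ⟨v, rfl⟩ := hmem v hv
      obtain ⟨w, rfl⟩ := hmem w hw
      rw [T.center_val, T.center_val] at hc
      -- Both clients are adjacent to the same facility, so their trees agree with that of any net
      -- point it touches.
      have h1 := hTE v
      rw [Fin.ext hc] at h1
      obtain ⟨-, k, hk, e1, -⟩ := (hnet _ v.1.2).2 _ h1
      obtain ⟨-, k', hk', e2, h2⟩ := (hnet _ w.1.2).2 _ (hTE w)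
      rw [e1, e2, h2 k hk]
    · intro v hv
      obtain ⟨v, rfl⟩ := hmem v hv
      rw [T.card_filter_center, hL]
      refine max_le (hT.lower _) (Finset.card_pos.2 ⟨v, ?_⟩)
      simp
    · intro v hv
      obtain ⟨v, rfl⟩ := hmem v hv
      rw [T.card_filter_center]
      exact hT.upper _

end Loop

/-! ### From a plan to a solution -/

/-- `m`, `loc` and `out` encode the solution `S` as the output does. -/
structure Encodes (S : Solution n) (m : ℕ) (loc out : ℕ → ℕ) : Prop where
  numOpen : m = S.numOpen
  loc : ∀ j : Fin S.numOpen, loc j = S.loc j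
  assign : ∀ v : {v // v ∈ S.served}, out v.1 = S.assign v + 1
  unserved : ∀ v : Fin n, v ∉ S.served → out v = 0

theorem exists_solution {m : ℕ} {loc out : ℕ → ℕ} {R : ℝ≥0} (hle : ∀ v < n, out v ≤ m)
    (hcl : ∀ v < n, out v ≠ 0 → I.input.arr 0 v ≠ 0)
    (hd : ∀ v < n, out v ≠ 0 → I.distTable v (loc (out v - 1)) ≤ R)
    (hloc : ∀ j < m, loc j < n ∧ I.input.arr 1 (loc j) ≠ 0)
    (hL : ∀ j < m, I.L ≤ fiberCard n out (j + 1)) (hU : ∀ j < m, fiberCard n out (j + 1) ≤ I.U)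
    (hp : I.p ≤ ((Finset.range n).filter fun v => out v ≠ 0).card) :
    ∃ S : Solution n, S.Feasible I ∧ S.radius I ≤ R ∧ Encodes S m loc out := by
  have hmem : ∀ v : {v : Fin n // v ∈ Finset.univ.filter fun v : Fin n => out v ≠ 0},
      out v.1 ≠ 0 := fun v => (Finset.mem_filter.1 v.2).2
  obtain ⟨S, hS⟩ : ∃ S : Solution n, S = ⟨Finset.univ.filter fun v : Fin n => out v ≠ 0, m,
      fun j => ⟨loc j, (hloc j j.2).1⟩,
      fun v => ⟨out v.1 - 1, by have := hmem v; have := hle v.1 v.1.2; omega⟩⟩ := ⟨_, rfl⟩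
  have hcard : ∀ p : ℕ → Prop, [DecidablePred p] →
      (Finset.univ.filter fun v : Fin n => p v).card = ((Finset.range n).filter p).card := by
    intro p _
    rw [← Finset.card_map Fin.valEmbedding]
    congr 1
    ext v
    simp only [Finset.mem_map, Finset.mem_filter, Finset.mem_univ, true_and,
      Fin.valEmbedding_apply, Finset.mem_range]
    exact ⟨fun ⟨w, h, e⟩ => e ▸ ⟨w.2, h⟩, fun ⟨h, h'⟩ => ⟨⟨v, h⟩, h', rfl⟩⟩
  have hload : ∀ j : Fin S.numOpen, S.load j = fiberCard n out (j + 1) := by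
    subst hS
    intro j
    rw [Solution.load, fiberCard, ← hcard]
    refine Finset.card_bij (fun v _ => v.1) ?_ ?_ ?_
    · intro v hv
      have h1 := hmem v
      have h2 := congrArg Fin.val (Finset.mem_filter.1 hv).2
      dsimp only at h2
      simp only [Finset.mem_filter, Finset.mem_univ, true_and]
      omega
    · exact fun v _ w _ h => Subtype.ext h
    · intro v hv
      have h := (Finset.mem_filter.1 hv).2
      refine ⟨⟨v, by simp [h]⟩, ?_, rfl⟩
      simp only [Finset.mem_filter, Finset.mem_univ, true_and]
      ext
      simp [h]
  refine ⟨S, ⟨?_, ?_, ?_, ?_, ?_⟩, ?_, ?_⟩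
  · subst hS
    intro v hv
    exact (I.input_clients v).1 (hcl v v.2 (Finset.mem_filter.1 hv).2)
  · subst hS
    exact hp.trans (hcard fun v => out v ≠ 0).ge
  · subst hS
    intro j
    exact (I.input_facilities _).1 (hloc j j.2).2
  · intro j
    rw [hload]
    exact hL j (by subst hS; exact j.2)
  · intro j
    rw [hload]
    exact hU j (by subst hS; exact j.2)
  · subst hS
    refine Finset.sup_le fun v _ => ?_
    rw [← I.distTable_val]
    exact hd v.1 v.1.2 (hmem v)
  · subst hS
    refine ⟨rfl, fun j => rfl, fun v => ?_, fun v hv => ?_⟩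
    · have := hmem v
      change out v.1 = out v.1 - 1 + 1
      omega
    · simpa using hv

/-- Together with `block_unique` this identifies a center number with a pair of a net point and an
offset below its number of centers. -/
theorem exists_block (a : ℕ → ℕ) {c : ℕ} (n : ℕ) (hc : c < ∑ j ∈ Finset.range n, a (j + 1)) :
    ∃ i < n, ∃ t < a (i + 1), c = ∑ j ∈ Finset.range i, a (j + 1) + t := by
  induction n with
  | zero => simp at hc
  | succ n ih =>
    by_cases h : c < ∑ j ∈ Finset.range n, a (j + 1)
    · obtain ⟨i, hi, h⟩ := ih h
      exact ⟨i, by omega, h⟩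
    · rw [Finset.sum_range_succ] at hc
      exact ⟨n, by omega, c - ∑ j ∈ Finset.range n, a (j + 1), by omega, by omega⟩

theorem block_unique (a : ℕ → ℕ) {i i' t t' : ℕ} (ht : t < a (i + 1)) (ht' : t' < a (i' + 1))
    (h : ∑ j ∈ Finset.range i, a (j + 1) + t = ∑ j ∈ Finset.range i', a (j + 1) + t') :
    i = i' ∧ t = t' := by
  have key : ∀ i i' : ℕ, i < i' → ∑ j ∈ Finset.range i, a (j + 1) + a (i + 1) ≤
      ∑ j ∈ Finset.range i', a (j + 1) := by
    intro i i' hi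
    rw [← Finset.sum_range_succ]
    exact Finset.sum_le_sum_of_subset (Finset.range_subset_range.2 hi)
  rcases lt_trichotomy i i' with hi | rfl | hi
  · have := key i i' hi
    omega
  · exact ⟨rfl, by omega⟩
  · have := key i' i hi
    omega

/-- Each center receives at least one client. The bound is needed because the final loop copies only
`n` locations to the output. -/
theorem Plan.sum_le {ρ : ℝ≥0} {fac a asg : ℕ → ℕ} (P : Plan I ρ fac a asg) :
    ∑ j ∈ Finset.range n, a (j + 1) ≤ n := by
  calc ∑ j ∈ Finset.range n, a (j + 1) = ∑ k ∈ Finset.Icc 1 n, a k := by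
        rw [Finset.range_eq_Ico, Finset.sum_Ico_add' a 0 n 1]
        rfl
    _ ≤ ∑ k ∈ Finset.Icc 1 n, fiberCard n asg k := by
        refine Finset.sum_le_sum fun k hk => ?_
        rw [Finset.mem_Icc] at hk
        exact (Nat.le_mul_of_pos_right _ (by omega)).trans (P.lower k hk.1 hk.2)
    _ = ((Finset.range n).filter fun v => asg v ≠ 0).card := sum_fiberCard P.asg_le
    _ ≤ n := (Finset.card_filter_le _ _).trans (by simp)

theorem Plan.exists_solution {ρ : ℝ≥0} {fac a asg loc out : ℕ → ℕ} (P : Plan I ρ fac a asg)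
    (hp : I.p ≤ ((Finset.range n).filter fun v => asg v ≠ 0).card)
    (hloc : ∀ i < n, ∀ t < a (i + 1), loc (∑ j ∈ Finset.range i, a (j + 1) + t) = fac (i + 1))
    (hout : ∀ v < n, out v = if asg v = 0 then 0 else ∑ j ∈ Finset.range (asg v - 1), a (j + 1) +
      Nat.count (fun w => asg w = asg v) v % a (asg v) + 1) :
    ∃ S : Solution n, S.Feasible I ∧ S.radius I ≤ 5 * ρ ∧
      Encodes S (∑ j ∈ Finset.range n, a (j + 1)) loc out := by
  -- A net point without clusters has no clients by the upper bound, so the modulus `a (asg v)` is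
  -- positive.
  have hpos : ∀ v < n, asg v ≠ 0 → 0 < a (asg v) := by
    intro v hv h0
    by_contra h
    have h1 := P.upper (asg v) (by omega) (P.asg_le v hv)
    rw [Nat.eq_zero_of_not_pos h, zero_mul, Nat.le_zero, fiberCard, Finset.card_eq_zero,
      Finset.filter_eq_empty_iff] at h1
    exact h1 (Finset.mem_range.2 hv) rfl
  have hout0 : ∀ v < n, out v ≠ 0 ↔ asg v ≠ 0 := by
    intro v hv
    rw [hout v hv]
    split_ifs with h <;> simp [h]
  have hout1 : ∀ v < n, asg v ≠ 0 → ∃ i < n, asg v = i + 1 ∧ ∃ t < a (i + 1),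
      t = Nat.count (fun w => asg w = i + 1) v % a (i + 1) ∧
      out v = ∑ j ∈ Finset.range i, a (j + 1) + t + 1 := by
    intro v hv h0
    obtain ⟨i, hi⟩ := Nat.exists_eq_succ_of_ne_zero h0
    have h1 := hpos v hv h0
    have h2 := hout v hv
    have h3 := P.asg_le v hv
    rw [if_neg h0] at h2
    rw [Nat.succ_eq_add_one] at hi
    rw [hi] at h1 h2 h3
    exact ⟨i, h3, hi, _, Nat.mod_lt _ h1, rfl, h2⟩
  have hfib : ∀ i < n, ∀ t < a (i + 1),
      fiberCard n out (∑ j ∈ Finset.range i, a (j + 1) + t + 1) =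
        Nat.count (fun j => j % a (i + 1) = t) (fiberCard n asg (i + 1)) := by
    intro i hi t ht
    have e : fiberCard n asg (i + 1) = Nat.count (fun w => asg w = i + 1) n := by
      rw [fiberCard, Nat.count_eq_card_filter_range]
    rw [e, fiberCard, ← card_filter_count_mod]
    congr 1
    refine Finset.filter_congr fun v hv => ?_
    rw [Finset.mem_range] at hv
    constructor
    · intro h
      obtain ⟨i', hi', e1, t', ht', e2, e3⟩ := hout1 v hv ((hout0 v hv).1 (by omega))
      obtain ⟨rfl, rfl⟩ := block_unique a ht ht' (by omega)
      exact ⟨e1, e2.symm⟩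
    · rintro ⟨h1, h2⟩
      rw [hout v hv, if_neg (by omega), h1, Nat.add_sub_cancel, h2]
  have hmono : ∀ i < n, ∑ j ∈ Finset.range i, a (j + 1) + a (i + 1) ≤
      ∑ j ∈ Finset.range n, a (j + 1) := by
    intro i hi
    rw [← Finset.sum_range_succ]
    exact Finset.sum_le_sum_of_subset (Finset.range_subset_range.2 hi)
  refine CapSupplier.exists_solution ?_ ?_ ?_ ?_ ?_ ?_ ?_
  · intro v hv
    by_cases h0 : asg v = 0
    · rw [hout v hv, if_pos h0]
      exact zero_le
    · obtain ⟨i, hi, -, t, ht, -, e⟩ := hout1 v hv h0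
      have := hmono i hi
      omega
  · exact fun v hv h => P.client v hv ((hout0 v hv).1 h)
  · intro v hv h
    have h0 := (hout0 v hv).1 h
    obtain ⟨i, hi, e1, t, ht, -, e⟩ := hout1 v hv h0
    rw [e, Nat.add_sub_cancel, hloc i hi t ht, ← e1]
    exact P.dist_le v hv h0
  · intro c hc
    obtain ⟨i, hi, t, ht, rfl⟩ := exists_block a n hc
    rw [hloc i hi t ht]
    exact P.facility (i + 1) (by omega) hi (by omega)
  · intro c hc
    obtain ⟨i, hi, t, ht, rfl⟩ := exists_block a n hc
    rw [hfib i hi t ht]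
    exact (le_max_left _ _).trans (count_mod_bounds ht (P.lower (i + 1) (by omega) hi)
      (P.upper (i + 1) (by omega) hi)).1
  · intro c hc
    obtain ⟨i, hi, t, ht, rfl⟩ := exists_block a n hc
    rw [hfib i hi t ht]
    exact (count_mod_bounds ht (P.lower (i + 1) (by omega) hi)
      (P.upper (i + 1) (by omega) hi)).2
  · refine hp.trans (Finset.card_le_card fun v hv => ?_)
    rw [Finset.mem_filter, Finset.mem_range] at hv ⊢
    exact ⟨hv.1, (hout0 v hv.1).2 hv.2⟩

/-! ### The search over all radii -/

namespace Loop

/-- The saved solution, if there is one, is feasible and has at most five times the saved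
radius. -/
def Saved (I : Instance n) (s : State) : Prop :=
  s.var 19 ≠ 0 → s.var 22 ≤ n ∧ ∃ S : Solution n, S.Feasible I ∧
    S.radius I ≤ 5 * I.distTable (s.var 20) (s.var 21) ∧
    Encodes S (s.var 22) (s.arr 18) (s.arr 19)

/-- There is a saved solution, and its radius is at most `ρ`. -/
def SavedLE (I : Instance n) (s : State) (ρ : ℝ≥0) : Prop :=
  s.var 19 ≠ 0 ∧ I.distTable (s.var 20) (s.var 21) ≤ ρ

/-- The saved guess never gets worse. If a solution of the current radius exists, the plan serves at
least `p` clients by `Plan.optimal`, so it is rejected only in favour of a strictly smaller saved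
guess. -/
theorem run_save {s : State} (h : Holds I s) (hs : Saved I s)
    (P : Plan I (I.distTable (s.var 4) (s.var 5)) (s.arr 7) (s.arr 12) (s.arr 10)) :
    Saved I (save.run I.distTable s) ∧
      (∀ ρ, SavedLE I s ρ → SavedLE I (save.run I.distTable s) ρ) ∧
      ∀ T : Solution n, T.Feasible I → T.radius I ≤ I.distTable (s.var 4) (s.var 5) →
        SavedLE I (save.run I.distTable s) (I.distTable (s.var 4) (s.var 5)) := by
  obtain ⟨d, hd⟩ : ∃ d, d = I.distTable := ⟨_, rfl⟩
  rw [← hd]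
  obtain ⟨N, hN⟩ : ∃ N, N = ((Finset.range n).filter fun v => s.arr 10 v ≠ 0).card := ⟨_, rfl⟩
  obtain ⟨s₁, hs₁⟩ : ∃ s₁, s₁ = (s.setVar 8 N).setVar 7 n := ⟨_, rfl⟩
  obtain ⟨s₂, hs₂⟩ : ∃ s₂, s₂ = ((s₁.setVar 19 1).setVar 20 (s.var 4)).setVar 21 (s.var 5) :=
    ⟨_, rfl⟩
  have hv : ∀ x, s₂.var x = if x = 21 then s.var 5 else if x = 20 then s.var 4 else
      if x = 19 then 1 else if x = 7 then n else if x = 8 then N else s.var x := by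
    intro x
    simp [hs₂, hs₁]
  have ha : s₂.arr = s.arr := by simp [hs₂, hs₁]
  obtain ⟨s₃, hs₃⟩ : ∃ s₃, s₃ = openCenters.run d s₂ := ⟨_, rfl⟩
  obtain ⟨s₄, hs₄⟩ : ∃ s₄, s₄ = assignCenters.run d s₃ := ⟨_, rfl⟩
  have hF₃ := frame_run (d := d) openCenters s₂
  have hF₄ := frame_run (d := d) assignCenters s₃
  have hrun : save.run d s = if I.p ≤ N ∧
      (s.var 19 = 0 ∨ d (s.var 4) (s.var 5) ≤ d (s.var 20) (s.var 21)) then s₄ else s₁ := by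
    have hc := run_count (d := d) (acc := 8) (j := 7) (c := .get 10 (.var 7)) (s := s) (by decide)
      (by decide) (fun v => s.arr 10 v ≠ 0) (fun k _ z => by simp)
    rw [h.n_eq, ← hN, ← hs₁] at hc
    rw [save, run_seq, hc, run_ite]
    have e : (((((assign 19 (.lit 1)).seq ((assign 20 (.var 4)).seq ((assign 21 (.var 5)).seq
        (openCenters.seq assignCenters))))))).run d s₁ = s₄ := by
      rw [hs₄, hs₃, hs₂, hs₁]
      simp
    rw [e]
    have h3 : s₁.var 3 = I.p := by simp [hs₁, h.p_eq]
    have h8 : s₁.var 8 = N := by simp [hs₁]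
    have h19 : s₁.var 19 = s.var 19 := by simp [hs₁]
    have h4 : s₁.var 4 = s.var 4 := by simp [hs₁]
    have h5 : s₁.var 5 = s.var 5 := by simp [hs₁]
    have h20 : s₁.var 20 = s.var 20 := by simp [hs₁]
    have h21 : s₁.var 21 = s.var 21 := by simp [hs₁]
    refine if_congr ?_ rfl rfl
    simp only [Ne, NExpr.eval_and, NExpr.eval_not, NExpr.eval_le, NExpr.eval_distLE,
      NExpr.eval_var, h3, h8, h19, h4, h5, h20, h21]
    tauto
  rw [← hs₃] at hF₃
  rw [← hs₄] at hF₄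
  have e4 : s₄.var 19 ≠ 0 ∧ s₄.var 20 = s.var 4 ∧ s₄.var 21 = s.var 5 := by
    rw [hF₄.var 19 rfl, hF₄.var 20 rfl, hF₄.var 21 rfl, hF₃.var 19 rfl, hF₃.var 20 rfl,
      hF₃.var 21 rfl]
    simp [hv]
  have e1 : s₁.var 19 = s.var 19 ∧ s₁.var 20 = s.var 20 ∧ s₁.var 21 = s.var 21 ∧
      s₁.var 22 = s.var 22 ∧ s₁.arr = s.arr := by simp [hs₁]
  rw [hrun]
  split_ifs with hc
  · refine ⟨fun _ => ?_, fun ρ hρ => ⟨e4.1, ?_⟩, fun T hT hTρ => ⟨e4.1, ?_⟩⟩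
    · have hn₂ : s₂.var 0 = n := by simp [hv, h.n_eq]
      have hopen := run_openCenters (d := d) hn₂ (a := s.arr 12) (fac := s.arr 7) (by rw [ha])
        (by rw [ha]) P.a_le
      rw [← hs₃] at hopen
      obtain ⟨h22, hopen⟩ := hopen
      have hassign := run_assignCenters (d := d) (s := s₃) (n := n) (by rw [hF₃.var 0 rfl, hn₂])
        (asg := s.arr 10) (a := s.arr 12) (base := s₃.arr 16) (by rw [hF₃.arr 10 rfl, ha])
        (by rw [hF₃.arr 12 rfl, ha]) rfl (fun v hv h0 => ⟨P.asg_le v hv, ?_⟩) ?_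
      · rw [← hs₄] at hassign
        rw [e4.2.1, e4.2.2, hF₄.var 22 rfl, h22]
        refine ⟨P.sum_le, P.exists_solution (hN ▸ hc.1) (fun i hi t ht => ?_) fun v hv => ?_⟩
        · rw [hF₄.arr 18 rfl]
          exact (hopen i hi).2.2 t ht
        · rw [hassign v hv]
          by_cases h0 : s.arr 10 v = 0
          · rw [if_pos h0, if_pos h0]
          · rw [if_neg h0, if_neg h0]
            have hle := P.asg_le v hv
            have := (hopen (s.arr 10 v - 1) (by omega)).2.1
            rw [Nat.sub_add_cancel (by omega)] at this
            rw [this]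
      · by_contra h
        have h1 := P.upper (s.arr 10 v) (by omega) (P.asg_le v hv)
        rw [Nat.eq_zero_of_not_pos h, zero_mul, Nat.le_zero, fiberCard, Finset.card_eq_zero,
          Finset.filter_eq_empty_iff] at h1
        exact h1 (Finset.mem_range.2 hv) rfl
      · intro k h1 h2
        have := (hopen (k - 1) (by omega)).1
        rwa [Nat.sub_add_cancel h1] at this
    · rw [e4.2.1, e4.2.2, ← hd]
      have h1 := hc.2.resolve_left hρ.1
      rw [hd] at h1 ⊢
      exact h1.trans hρ.2
    · rw [e4.2.1, e4.2.2, ← hd]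
  · obtain ⟨h19, h20, h21, h22, harr⟩ := e1
    refine ⟨?_, ?_, fun T hT hTρ => ?_⟩
    · rw [Saved, h19, h20, h21, h22, harr]
      exact hs
    · intro ρ hρ
      rw [SavedLE, h19, h20, h21]
      exact hρ
    · have hp : I.p ≤ N := hT.served_card.trans (hN ▸ P.optimal T hT (hd ▸ hTρ))
      rw [SavedLE, h19, h20, h21, ← hd]
      have h1 : ¬ (s.var 19 = 0 ∨ d (s.var 4) (s.var 5) ≤ d (s.var 20) (s.var 21)) :=
        fun h => hc ⟨hp, h⟩
      rw [not_or, not_le] at h1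
      exact ⟨h1.1, h1.2.le⟩

theorem run_attempt {s : State} (h : Holds I s) (hU : 1 ≤ I.U) (hs : Saved I s) :
    Saved I (attempt.run I.distTable s) ∧
      (∀ ρ, SavedLE I s ρ → SavedLE I (attempt.run I.distTable s) ρ) ∧
      ∀ T : Solution n, T.Feasible I → T.radius I ≤ I.distTable (s.var 4) (s.var 5) →
        SavedLE I (attempt.run I.distTable s) (I.distTable (s.var 4) (s.var 5)) := by
  obtain ⟨t, ht, P⟩ := exists_plan h hU
  have hF := frame_run (d := I.distTable)
    (seq good <| seq net <| seq sizes <| seq passUp <| seq distribute exchange) s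
  rw [ht] at hF
  have e : attempt.run I.distTable s = save.run I.distTable t := by
    rw [← ht]
    rfl
  have h19 : t.var 19 = s.var 19 := hF.var 19 rfl
  have h20 : t.var 20 = s.var 20 := hF.var 20 rfl
  have h21 : t.var 21 = s.var 21 := hF.var 21 rfl
  have hst : Saved I t := by
    rw [Saved, h19, h20, h21, hF.var 22 rfl, hF.arr 18 rfl, hF.arr 19 rfl]
    exact hs
  have h4 : t.var 4 = s.var 4 := hF.var 4 rfl
  have h5 : t.var 5 = s.var 5 := hF.var 5 rfl
  rw [← h4, ← h5] at P ⊢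
  obtain ⟨h1, h2, h3⟩ := run_save (h.frame hF rfl) hst P
  rw [e]
  refine ⟨h1, fun ρ hρ => h2 ρ ?_, h3⟩
  rw [SavedLE, h19, h20, h21]
  exact hρ

theorem SavedLE.setVar {s : State} {ρ : ℝ≥0} {x v : ℕ} (hx : x < 19) :
    SavedLE I (s.setVar x v) ρ ↔ SavedLE I s ρ := by
  rw [SavedLE, SavedLE, State.setVar_var, State.setVar_var, State.setVar_var, if_neg (by omega),
    if_neg (by omega), if_neg (by omega)]

theorem Saved.setVar {s : State} {x v : ℕ} (hx : x < 19) :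
    Saved I (s.setVar x v) ↔ Saved I s := by
  rw [Saved, Saved, State.setVar_var, State.setVar_var, State.setVar_var, State.setVar_var,
    State.setVar_arr, if_neg (by omega), if_neg (by omega), if_neg (by omega), if_neg (by omega)]

theorem run_attempts {s : State} (h : Holds I s) (hU : 1 ≤ I.U) (hs : s.var 19 = 0) :
    Saved I ((forN 4 (forN 5 attempt)).run I.distTable s) ∧
      ∀ T : Solution n, T.Feasible I → ∀ x < n, ∀ y < n, T.radius I ≤ I.distTable x y →
        SavedLE I ((forN 4 (forN 5 attempt)).run I.distTable s) (I.distTable x y) := by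
  have := forN_induction (d := I.distTable) (i := 4) (A := forN 5 attempt) (s := s)
    (fun m s' => Saved I s' ∧ ∀ T : Solution n, T.Feasible I → ∀ x < m, ∀ y < n,
      T.radius I ≤ I.distTable x y → SavedLE I s' (I.distTable x y))
    ⟨fun h => absurd (by simpa using hs) h, by simp⟩ (by
      intro m hm s₁ hF₁ h4 ⟨ih₁, ih₂⟩
      rw [h.n_eq] at hm
      have H₁ : Holds I s₁ := h.frame hF₁ rfl
      -- The middle clause carries the results of earlier outer rounds through the inner loop.
      have := forN_induction (d := I.distTable) (i := 5) (A := attempt) (s := s₁)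
        (fun l s' => Saved I s' ∧ (∀ ρ, SavedLE I s₁ ρ → SavedLE I s' ρ) ∧
          ∀ T : Solution n, T.Feasible I → ∀ y < l,
          T.radius I ≤ I.distTable m y → SavedLE I s' (I.distTable m y))
        ⟨(Saved.setVar (by decide)).2 ih₁, fun ρ h => (SavedLE.setVar (by decide)).2 h, by simp⟩ (by
          intro l hl s₂ hF₂ h5 ⟨ih₃, ih₄, ih₅⟩
          obtain ⟨h1, h2, h3⟩ := run_attempt (H₁.frame hF₂ rfl) hU ih₃
          rw [hF₂.var 4 rfl, h4, h5] at h3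
          rw [Saved.setVar (by decide)]
          simp only [SavedLE.setVar (show 5 < 19 by decide)]
          refine ⟨h1, fun ρ hρ => h2 ρ (ih₄ ρ hρ), fun T hT y hy hTy => ?_⟩
          rcases Nat.lt_succ_iff_lt_or_eq.1 hy with hy | rfl
          · exact h2 _ (ih₅ T hT y hy hTy)
          · exact h3 T hT hTy)
      rw [H₁.n_eq] at this
      obtain ⟨h1, h2, h3⟩ := this
      rw [Saved.setVar (by decide)]
      simp only [SavedLE.setVar (show 4 < 19 by decide)]
      refine ⟨h1, fun T hT x hx y hy hTx => ?_⟩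
      rcases Nat.lt_succ_iff_lt_or_eq.1 hx with hx | rfl
      · exact h2 _ (ih₂ T hT x hx y hy hTx)
      · exact h3 T hT y hy hTx)
  rw [h.n_eq] at this
  exact this

/-- A solution that serves a client has the radius of some pair of points. -/
theorem _root_.CapSupplier.Solution.exists_radius_eq (T : Solution n) (h : T.served.Nonempty) :
    ∃ x y : Fin n, T.radius I = I.dist x y := by
  obtain ⟨v, hv⟩ := h
  obtain ⟨w, -, hw⟩ := Finset.exists_mem_eq_sup (Finset.univ : Finset {v // v ∈ T.served})
    ⟨⟨v, hv⟩, Finset.mem_univ _⟩ fun v => I.dist v.1 (T.loc (T.assign v))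
  exact ⟨_, _, hw⟩

theorem run_supplier_of_p_eq_zero (hp : I.p = 0) :
    (supplier.run I.distTable I.input).var 19 ≠ 0 ∧
      ∃ S : Solution n, S.IsApprox I 5 ∧ Encodes S ((supplier.run I.distTable I.input).var 1)
        ((supplier.run I.distTable I.input).arr 0)
        ((supplier.run I.distTable I.input).arr 1) := by
  obtain ⟨d, hd⟩ : ∃ d, d = I.distTable := ⟨_, rfl⟩
  have := forN_induction (d := d) (i := 6) (s := I.input) (A := store 1 (.var 6) (.lit 0))
    (fun m s' => ∀ v < m, s'.arr 1 v = 0) (by simp) (by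
      intro m hm s' hF h6 ih v hv
      rcases Nat.lt_succ_iff_lt_or_eq.1 hv with hv | rfl
      · simp [h6, hv.ne, ih v hv]
      · simp [h6])
  rw [← hd]
  obtain ⟨s₁, hs₁⟩ : ∃ s₁, s₁ = (forN 6 (store 1 (.var 6) (.lit 0))).run d I.input := ⟨_, rfl⟩
  rw [← hs₁] at this
  have hrun : supplier.run d I.input = (s₁.setVar 1 0).setVar 19 1 := by
    rw [supplier, run_ite, if_neg (by simpa [Instance.input] using hp), hs₁]
    simp
  rw [hrun]
  refine ⟨by simp, ⟨∅, 0, Fin.elim0, fun v => (Finset.notMem_empty _ v.2).elim⟩,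
    ⟨⟨by simp, by simp [hp], fun j => j.elim0, fun j => j.elim0, fun j => j.elim0⟩, fun T _ => ?_⟩,
    ⟨by simp, fun j => j.elim0, fun v => (Finset.notMem_empty _ v.2).elim, fun v _ => ?_⟩⟩
  · refine Finset.sup_le fun v _ => (Finset.notMem_empty _ v.2).elim
  · simpa using this v v.2

theorem not_feasible_of_U_eq_zero (hp : I.p ≠ 0) (hU : I.U = 0) :
    ¬ ∃ T : Solution n, T.Feasible I := by
  rintro ⟨T, hT⟩
  obtain ⟨v, hv⟩ := Finset.card_pos.1 ((Nat.pos_of_ne_zero hp).trans_le hT.served_card)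
  have h1 : 0 < T.load (T.assign ⟨v, hv⟩) := Finset.card_pos.2 ⟨⟨v, hv⟩, by simp⟩
  have h2 := hT.upper (T.assign ⟨v, hv⟩)
  omega

theorem run_supplier_of_U_eq_zero (hp : I.p ≠ 0) (hU : I.U = 0) :
    (supplier.run I.distTable I.input).var 19 = 0 := by
  rw [supplier, run_ite, if_pos (by simpa [Instance.input] using hp), run_ite,
    if_neg (by simpa [Instance.input] using hU)]
  rfl

theorem run_supplier_of_ne_zero (hp : I.p ≠ 0) (hU : I.U ≠ 0) :
    ((∃ T : Solution n, T.Feasible I) → (supplier.run I.distTable I.input).var 19 ≠ 0) ∧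
      ((supplier.run I.distTable I.input).var 19 ≠ 0 → ∃ S : Solution n, S.IsApprox I 5 ∧
        Encodes S ((supplier.run I.distTable I.input).var 1)
          ((supplier.run I.distTable I.input).arr 0)
          ((supplier.run I.distTable I.input).arr 1)) := by
  obtain ⟨s₁, hs₁⟩ : ∃ s₁, s₁ =
      (ite (.var 1) skip (assign 1 (.lit 1))).run I.distTable I.input := ⟨_, rfl⟩
  have hF₁ := frame_run (d := I.distTable) (ite (.var 1) skip (assign 1 (.lit 1))) I.input
  have h1 : s₁.var 1 = max I.L 1 := by
    rw [hs₁, run_ite]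
    by_cases h : I.L = 0
    · rw [if_neg (by simpa [Instance.input] using h)]
      simp [h]
    · rw [if_pos (by simpa [Instance.input] using h), run_skip]
      simp only [Instance.input]
      omega
  rw [← hs₁] at hF₁
  have H₁ : Holds I s₁ := ⟨hF₁.var 0 rfl, h1, hF₁.var 2 rfl, hF₁.var 3 rfl, hF₁.arr 0 rfl,
    hF₁.arr 1 rfl⟩
  obtain ⟨hsav, hall⟩ := run_attempts H₁ (by omega) (hF₁.var 19 rfl)
  obtain ⟨s₂, hs₂⟩ : ∃ s₂, s₂ = (forN 4 (forN 5 attempt)).run I.distTable s₁ := ⟨_, rfl⟩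
  have hF₂ := frame_run (d := I.distTable) (forN 4 (forN 5 attempt)) s₁
  rw [← hs₂] at hF₂ hsav hall
  have H₂ : Holds I s₂ := H₁.frame hF₂ rfl
  have hcopy := forN_induction (d := I.distTable) (i := 6) (s := s₂)
    (A := seq (store 0 (.var 6) (.get 18 (.var 6))) (store 1 (.var 6) (.get 19 (.var 6))))
    (fun m s' => ∀ v < m, s'.arr 0 v = s₂.arr 18 v ∧ s'.arr 1 v = s₂.arr 19 v) (by simp) (by
      intro m hm s' hF h6 ih v hv
      have e18 : s'.arr 18 = s₂.arr 18 := hF.arr 18 rfl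
      have e19 : s'.arr 19 = s₂.arr 19 := hF.arr 19 rfl
      rcases Nat.lt_succ_iff_lt_or_eq.1 hv with hv | rfl
      · simp [h6, hv.ne, ih v hv]
      · simp [h6, e18, e19])
  obtain ⟨s₃, hs₃⟩ : ∃ s₃, s₃ = (forN 6 (seq (store 0 (.var 6) (.get 18 (.var 6)))
    (store 1 (.var 6) (.get 19 (.var 6))))).run I.distTable s₂ := ⟨_, rfl⟩
  have hF₃ := frame_run (d := I.distTable) (forN 6 (seq (store 0 (.var 6) (.get 18 (.var 6)))
    (store 1 (.var 6) (.get 19 (.var 6))))) s₂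
  rw [H₂.n_eq, ← hs₃] at hcopy
  rw [← hs₃] at hF₃
  have hrun : supplier.run I.distTable I.input = s₃.setVar 1 (s₂.var 22) := by
    rw [supplier, run_ite, if_pos (by simpa [Instance.input] using hp), run_ite,
      if_pos (by simpa [Instance.input] using hU)]
    simp only [run_seq, ← hs₁, ← hs₂, ← hs₃]
    rw [run_assign, NExpr.eval_var, hF₃.var 22 rfl]
  rw [hrun]
  have h19 : (s₃.setVar 1 (s₂.var 22)).var 19 = s₂.var 19 := by simp [hF₃.var 19 rfl]
  -- Since `p ≠ 0`, the radius of `T` is the distance of a pair of points and was itself tried.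
  have hT : ∀ T : Solution n, T.Feasible I → SavedLE I s₂ (T.radius I) := by
    intro T hT
    obtain ⟨x, y, hxy⟩ := T.exists_radius_eq (I := I)
      (Finset.card_pos.1 ((Nat.pos_of_ne_zero hp).trans_le hT.served_card))
    rw [← I.distTable_val] at hxy
    rw [hxy]
    exact hall T hT x x.2 y y.2 hxy.le
  rw [h19]
  refine ⟨fun ⟨T, h⟩ => (hT T h).1, fun h0 => ?_⟩
  obtain ⟨hle, S, hS, hrad, hen⟩ := hsav h0
  refine ⟨S, ⟨hS, fun T h => hrad.trans ?_⟩, by simpa using hen.numOpen, fun j => ?_, fun v => ?_,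
    fun v hv => ?_⟩
  · gcongr
    exact (hT T h).2
  · have hj : (j : ℕ) < n := by have := hen.numOpen; omega
    rw [State.setVar_arr, (hcopy j hj).1, hen.loc]
  · rw [State.setVar_arr, (hcopy v.1 v.1.2).2, hen.assign]
  · rw [State.setVar_arr, (hcopy v v.2).2, hen.unserved v hv]

end Loop
end CapSupplier

/-! ### The theorem -/

open CapSupplier Loop in
theorem mainTheorem1 :
    ∃ A : CapSupplier.Program, CapSupplier.IsPolyTimeApproxAlgorithm A 5 := by
  obtain ⟨P, hP⟩ := exists_exec supplier supplier_safe supplier_writesVar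
  -- Variable `0` bounds every loop, so the success flag is moved into it only at the very end, at a
  -- cost of 4.
  refine ⟨.seq supplier.toProgram (.assign 0 (.le (.lit 1) (.var 19))), P + 4, fun n I => ?_⟩
  obtain ⟨t, ht, hE⟩ := hP I.distTable I.input
  refine ⟨_, _, .seq hE (.assign _ _ _), ?_, ?_⟩
  · rw [Polynomial.eval_add]
    refine Nat.add_le_add ht ?_
    simp [NExpr.cost]
  have key : ((∃ T : Solution n, T.Feasible I) →
      (supplier.run I.distTable I.input).var 19 ≠ 0 ∧ ∃ S : Solution n, S.IsApprox I 5 ∧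
        Encodes S ((supplier.run I.distTable I.input).var 1)
          ((supplier.run I.distTable I.input).arr 0)
          ((supplier.run I.distTable I.input).arr 1)) ∧
      ((¬ ∃ T : Solution n, T.Feasible I) →
        (supplier.run I.distTable I.input).var 19 = 0) := by
    by_cases hp : I.p = 0
    · obtain ⟨h1, S, hS, hen⟩ := run_supplier_of_p_eq_zero hp
      exact ⟨fun _ => ⟨h1, S, hS, hen⟩, fun h => absurd ⟨S, hS.1⟩ h⟩
    by_cases hU : I.U = 0
    · exact ⟨fun h => absurd h (not_feasible_of_U_eq_zero hp hU),
        fun _ => run_supplier_of_U_eq_zero hp hU⟩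
    obtain ⟨h1, h2⟩ := run_supplier_of_ne_zero hp hU
    refine ⟨fun h => ⟨h1 h, h2 (h1 h)⟩, fun h => ?_⟩
    by_contra h0
    obtain ⟨S, hS, -⟩ := h2 h0
    exact h ⟨S, hS.1⟩
  generalize supplier.run I.distTable I.input = s at key
  refine ⟨fun h => ?_, fun h => ?_⟩
  · obtain ⟨h1, S, hS, hen⟩ := key.1 h
    refine ⟨S, ⟨?_, ?_, hen.loc, hen.assign, hen.unserved⟩, hS⟩
    · rw [State.setVar_var, if_pos rfl, NExpr.eval, if_pos]
      simpa [Nat.one_le_iff_ne_zero] using h1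
    · simpa using hen.numOpen
  · rw [State.OutputsInfeasible, State.setVar_var, if_pos rfl, NExpr.eval_le]
    simp [key.2 h]
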